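/- Let $n\ge 0$ and consider $n$ parties, each holding one bosonic mode with Hilbert space $L^2(\mathbb R)$, so that the total Hilbert space is $\mathcal H_n=L^2(\mathbb R)^{\otimes n}=L^2(\mathbb R^n)$. Let $r=(x_1,p_1,\dots,x_n,p_n)^{\intercal}$ be the vector of position and momentum operators ($p_j=-i\partial_j$), so that $[r,r^\intercal]=i\Omega$ with $\Omega=\begin{pmatrix}0&1\\-1&0\end{pmatrix}^{\oplus n}$. Let $S$ be an arbitrary real $2n\times 2n$ symplectic matrix, i.e. $S\Omega S^{\intercal}=\Omega$, and let $U_S$ be the corresponding Gaussian unitary on $\mathcal H_n$, i.e. a unitary (unique up to a phase) with $U_S^\dagger\, r_i\, U_S=\sum_k S_{ik}r_k$ for all $i$. For $\lambda>0$ let $\mathcal E_\lambda$ be the ensemble of coherent states $|\alpha\rangle=|\alpha_1\rangle\otimes\cdots\otimes|\alpha_n\rangle$, $\alpha\in\mathbb C^n$, with probability density $p_\lambda(\alpha)=(\lambda/\pi)^n e^{-\lambda\sum_j|\alpha_j|^2}$, where $|\alpha_j\rangle=e^{-|\alpha_j|^2/2}\sum_{k\ge 0}\frac{\alpha_j^k}{\sqrt{k!}}|k\rangle$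 in terms of the Fock states $|k\rangle$. Define the classical (LOCC) simulation fidelity $$F_{c\ell}(\mathcal E_\lambda,U_S)=\sup_{\Lambda}\int_{\mathbb C^n}p_\lambda(\alpha)\,\langle\alpha|U_S^\dagger\,\Lambda(|\alpha\rangle\langle\alpha|)\,U_S|\alpha\rangle\,d^{2n}\alpha ,$$ where $\Lambda$ ranges over the quantum channels on $\mathcal H_n$ that the $n$ parties can implement (exactly or as a limit) by local operations and classical communication. For $J\subseteq[n]=\{1,\dots,n\}$ let $$\Omega_J=\bigoplus_{j\in J}\begin{pmatrix}0&1\\-1&0\end{pmatrix}\oplus\bigoplus_{k\in [n]\setminus J}\begin{pmatrix}0&-1\\1&0\end{pmatrix}$$ (each block acting on the mode with the same label), and let $z_1(\lambda,S,J),\dots,z_{2n}(\lambda,S,J)$ be the eigenvalues, with multiplicity, of the Hermitian matrix $(1+\lambda)S^{-1}\,i\Omega_J\,S^{-\intercal}-i\Omega_J$. Then $$F_{c\ell}(\mathcal E_\lambda,U_S)\le\min_{J\subseteq[n]}\frac{2^n(1+\lambda)^n}{\prod_{\ell=1}^{2n}\sqrt{2+\lambda+|z_\ell(\lambda,S,J)|}}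 .$$ Moreover, if $n\ge 2$, the minimum on the right-hand side does not change when it is restricted to the subsets $J$ with $1\le|J|\le\lfloor n/2\rfloor$. -/

import Mathlib

open MeasureTheory SchwartzMap
open scoped ENNReal Matrix

noncomputable section

namespace GaussLOCC

/-! ### Hilbert spaces of one and of `n` modes -/

/-- The Hilbert space `L²(ℝ)` of one mode. -/
abbrev Mode : Type := Lp ℂ 2 (volume : Measure ℝ)

/-- The Hilbert space `L²(ℝⁿ)` of `n` modes. -/
abbrev Modes (n : ℕ) : Type := Lp ℂ 2 (volume : Measure (Fin n → ℝ))

theorem memLp_tensor {n : ℕ} (f : Fin n → Mode) :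
    MemLp (fun q : Fin n → ℝ => ∏ j, (f j : ℝ → ℂ) (q j)) 2 volume := by
  have hm : AEStronglyMeasurable (fun q : Fin n → ℝ => ∏ j, (f j : ℝ → ℂ) (q j)) volume := by
    refine Finset.aestronglyMeasurable_fun_prod _ fun j _ => ?_
    exact (Lp.aestronglyMeasurable (f j)).comp_quasiMeasurePreserving
      (Measure.quasiMeasurePreserving_eval (fun _ : Fin n => (volume : Measure ℝ)) j)
  rw [memLp_two_iff_integrable_sq_norm hm]
  have h : ∀ j, Integrable (fun x : ℝ => ‖(f j : ℝ → ℂ) x‖ ^ 2) volume := fun j =>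
    (memLp_two_iff_integrable_sq_norm (Lp.aestronglyMeasurable (f j))).1 (Lp.memLp (f j))
  have := Integrable.fintype_prod h
  rw [← volume_pi] at this
  simpa [norm_prod, Finset.prod_pow] using this

/-- The product vector `f₁ ⊗ ⋯ ⊗ fₙ` in `L²(ℝ) ⊗ ⋯ ⊗ L²(ℝ) = L²(ℝⁿ)`. -/
def tensor {n : ℕ} (f : Fin n → Mode) : Modes n := (memLp_tensor f).toLp

/-- `K` is the product operator `A₁ ⊗ ⋯ ⊗ Aₙ`. -/
def IsTensorOp {n : ℕ} (A : Fin n → (Mode →L[ℂ] Mode)) (K : Modes n →L[ℂ] Modes n) : Prop :=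
  ∀ f : Fin n → Mode, K (tensor f) = tensor fun j => A j (f j)

/-! ### Canonical operators and Gaussian unitaries -/

/-- The canonical operators on Schwartz functions: index `(0, j)` is the position operator `x_j`,
index `(1, j)` the momentum operator `p_j = -i ∂_j`. -/
def canonicalOp {n : ℕ} (i : Fin 2 × Fin n) (φ : 𝓢(Fin n → ℝ, ℂ)) : 𝓢(Fin n → ℝ, ℂ) :=
  if i.1 = 0 then SchwartzMap.smulLeftCLM ℂ (fun q : Fin n → ℝ => (q i.2 : ℂ)) φ
  else (-Complex.I) • LineDeriv.lineDerivOp (Pi.single i.2 (1 : ℝ) : Fin n → ℝ) φ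

/-- The matrix `Ω_J`: the direct sum over the modes of `[[0, 1], [-1, 0]]` for `j ∈ J` and of its
negative for `j ∉ J`. -/
def omegaJ {n : ℕ} (J : Finset (Fin n)) : Matrix (Fin 2 × Fin n) (Fin 2 × Fin n) ℝ :=
  Matrix.blockDiagonal fun j => if j ∈ J then !![0, 1; -1, 0] else !![0, -1; 1, 0]

/-- The standard symplectic form `Ω`, the direct sum over the modes of `[[0, 1], [-1, 0]]`. -/
def omega (n : ℕ) : Matrix (Fin 2 × Fin n) (Fin 2 × Fin n) ℝ :=
  Matrix.blockDiagonal fun _ => !![0, 1; -1, 0]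

/-- `S` is symplectic: `S Ω Sᵀ = Ω`. -/
def IsSymplectic {n : ℕ} (S : Matrix (Fin 2 × Fin n) (Fin 2 × Fin n) ℝ) : Prop :=
  S * omega n * Sᵀ = omega n

/-- `U` is a Gaussian unitary with symplectic matrix `S`, i.e. `U† r_i U = ∑ₖ S_{ik} r_k`, read as
`r_i U ψ = U ∑ₖ S_{ik} r_k ψ` for every Schwartz function `ψ`. As `U ψ` is only known to lie in
`L²(ℝⁿ)`, the left-hand side is tested against Schwartz functions `φ`: this says that `U ψ` lies in
the domain of the adjoint of the canonical operator on Schwartz functions, which is its self-adjoint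
closure, and gives the value of that closure there. -/
def IsGaussianUnitary {n : ℕ} (S : Matrix (Fin 2 × Fin n) (Fin 2 × Fin n) ℝ)
    (U : Modes n ≃ₗᵢ[ℂ] Modes n) : Prop :=
  ∀ (i : Fin 2 × Fin n) (φ ψ : 𝓢(Fin n → ℝ, ℂ)),
    inner ℂ ((canonicalOp i φ).toLp 2 volume) (U (ψ.toLp 2 volume)) =
      inner ℂ (φ.toLp 2 volume) (U ((∑ k, (S i k : ℂ) • canonicalOp k ψ).toLp 2 volume))

/-! ### Fock states and coherent states -/

/-- The creation operator `a† = (x - i p) / √2 = (x - d/dx) / √2` of one mode. -/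
def creation (f : ℝ → ℂ) : ℝ → ℂ := fun q => (q * f q - deriv f q) / (Real.sqrt 2 : ℂ)

/-- The normalised vacuum wave function. -/
def vacuumFun : ℝ → ℂ := fun q => ((Real.pi ^ (-(1 / 4) : ℝ) * Real.exp (-q ^ 2 / 2) : ℝ) : ℂ)

/-- The wave function of the Fock state `|k⟩ = (k!)^{-1/2} (a†)^k |0⟩`. -/
def fockFun (k : ℕ) : ℝ → ℂ := fun q => (creation^[k] vacuumFun) q / (Real.sqrt (k.factorial) : ℂ)

theorem creation_iterate_vacuum (k : ℕ) : ∃ p : Polynomial ℂ, ∀ q : ℝ,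
    (creation^[k] vacuumFun) q = p.eval (q : ℂ) * ((Real.exp (-q ^ 2 / 2) : ℝ) : ℂ) := by
  induction k with
  | zero =>
    refine ⟨Polynomial.C ((Real.pi ^ (-(1 / 4) : ℝ) : ℝ) : ℂ), fun q => ?_⟩
    simp only [Function.iterate_zero, id, vacuumFun, Polynomial.eval_C]
    push_cast
    rfl
  | succ k ih =>
    obtain ⟨p, hp⟩ := ih
    refine ⟨Polynomial.C ((Real.sqrt 2 : ℂ)⁻¹) *
      (2 * Polynomial.X * p - Polynomial.derivative p), fun q => ?_⟩
    rw [Function.iterate_succ_apply']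
    have hf : (creation^[k] vacuumFun) =
        fun q : ℝ => p.eval (q : ℂ) * ((Real.exp (-q ^ 2 / 2) : ℝ) : ℂ) := funext hp
    have h1 : HasDerivAt (fun q : ℝ => p.eval (q : ℂ)) (p.derivative.eval (q : ℂ)) q :=
      (p.hasDerivAt (q : ℂ)).comp_ofReal
    have h2 : HasDerivAt (fun q : ℝ => ((Real.exp (-q ^ 2 / 2) : ℝ) : ℂ))
        ((Real.exp (-q ^ 2 / 2) * (-q) : ℝ) : ℂ) q := by
      have h0 : HasDerivAt (fun q : ℝ => -q ^ 2 / 2) (-q) q := by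
        have := ((hasDerivAt_pow 2 q).neg).div_const 2
        refine this.congr_deriv ?_
        norm_num
        ring
      exact h0.exp.ofReal_comp
    simp only [creation, hf]
    rw [(h1.fun_mul h2).deriv]
    simp only [Polynomial.eval_mul, Polynomial.eval_C, Polynomial.eval_sub, Polynomial.eval_X,
      Polynomial.eval_ofNat]
    push_cast
    ring

theorem memLp_fockFun (k : ℕ) : MemLp (fockFun k) 2 volume := by
  obtain ⟨p, hp⟩ := creation_iterate_vacuum k
  have hmon : ∀ m : ℕ,
      MemLp (fun q : ℝ => (q : ℂ) ^ m * ((Real.exp (-q ^ 2 / 2) : ℝ) : ℂ)) 2 volume := by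
    intro m
    have hc : Continuous (fun q : ℝ => (q : ℂ) ^ m * ((Real.exp (-q ^ 2 / 2) : ℝ) : ℂ)) := by
      fun_prop
    rw [memLp_two_iff_integrable_sq_norm hc.aestronglyMeasurable]
    have h := integrable_rpow_mul_exp_neg_mul_sq (b := 1) one_pos (s := (2 * m : ℕ))
      (by have : (0 : ℝ) ≤ ((2 * m : ℕ) : ℝ) := Nat.cast_nonneg _
          linarith)
    refine h.congr (Filter.Eventually.of_forall fun q => ?_)
    simp only [Real.rpow_natCast, norm_mul, norm_pow, Complex.norm_real, Real.norm_eq_abs,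
      Real.abs_exp, mul_pow, ← pow_mul, ← Real.exp_nat_mul]
    rw [mul_comm m 2, pow_mul |q| 2 m, sq_abs, ← pow_mul]
    congr 2
    push_cast
    ring
  have heq : fockFun k = fun q : ℝ => ∑ m ∈ p.support,
      (p.coeff m / (Real.sqrt (k.factorial) : ℂ)) *
        ((q : ℂ) ^ m * ((Real.exp (-q ^ 2 / 2) : ℝ) : ℂ)) := by
    funext q
    simp only [fockFun, hp, Polynomial.eval_eq_sum, Polynomial.sum, Finset.sum_mul,
      Finset.sum_div]
    exact Finset.sum_congr rfl fun m _ => by ring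
  rw [heq]
  exact memLp_finsetSum _ fun m _ => (hmon m).const_mul _

/-- The Fock state `|k⟩`. -/
def fock (k : ℕ) : Mode := (memLp_fockFun k).toLp

/-- The one-mode coherent state `|α⟩ = e^{-|α|²/2} ∑ₖ α^k / √(k!) |k⟩`. -/
def coherentMode (α : ℂ) : Mode :=
  ((Real.exp (-‖α‖ ^ 2 / 2) : ℝ) : ℂ) •
    ∑' k : ℕ, (α ^ k / (Real.sqrt (k.factorial) : ℂ)) • fock k

/-- The coherent state `|α₁⟩ ⊗ ⋯ ⊗ |αₙ⟩`. -/
def coherent {n : ℕ} (α : Fin n → ℂ) : Modes n := tensor fun j => coherentMode (α j)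

/-- The Gaussian probability measure with density `(l/π)^n e^{-l ‖α‖²}` on `ℂⁿ`. -/
def gaussianEnsemble (n : ℕ) (l : ℝ) : Measure (Fin n → ℂ) :=
  volume.withDensity fun α =>
    ENNReal.ofReal ((l / Real.pi) ^ n * Real.exp (-l * ∑ j, ‖α j‖ ^ 2))

/-! ### Quantum channels and LOCC -/

/-- The operator `|ψ⟩⟨ψ|`. -/
def pureState {H : Type} [NormedAddCommGroup H] [InnerProductSpace ℂ H] (ψ : H) : H →L[ℂ] H :=
  (innerSL ℂ ψ).smulRight ψ

/-- A quantum channel on a Hilbert space, given by Kraus operators with `∑ Kᵢ† Kᵢ = 1`. -/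
structure Channel (H : Type) [NormedAddCommGroup H] [InnerProductSpace ℂ H] [CompleteSpace H] where
  kraus : ℕ → (H →L[ℂ] H)
  complete : ∀ ψ : H, HasSum (fun i => ‖kraus i ψ‖ ^ 2) (‖ψ‖ ^ 2)

/-- The action `ρ ↦ ∑ᵢ Kᵢ ρ Kᵢ†` of a channel on trace class operators (on which the series
converges). -/
def Channel.apply {H : Type} [NormedAddCommGroup H] [InnerProductSpace ℂ H] [CompleteSpace H]
    (L : Channel H) (ρ : H →L[ℂ] H) : H →L[ℂ] H :=
  ∑' i, (L.kraus i).comp (ρ.comp (ContinuousLinearMap.adjoint (L.kraus i)))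

/-- A complex Hilbert space, bundled. -/
structure HilbertSpace where
  carrier : Type
  [normed : NormedAddCommGroup carrier]
  [innerProduct : InnerProductSpace ℂ carrier]
  [complete : CompleteSpace carrier]

attribute [instance] HilbertSpace.normed HilbertSpace.innerProduct HilbertSpace.complete

/-- The Hilbert space `L²(ℝ)`, bundled. -/
def modeSpace : HilbertSpace := ⟨Mode⟩

/-- A protocol of local operations and classical communication for `n` parties whose local systems
are `H₁, …, Hₙ` at the start and `H'₁, …, H'ₙ` at the end. In a round, party `j` measures its own
system with Kraus operators `M j x : H j → K j`, where `∑ₓ (M j x)† (M j x) = 1`; here `K j` is an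
arbitrary Hilbert space, so that ancillas can be added and discarded. All outcomes `x j` are then
broadcast, and the rest of the protocol may depend on them. Coarser local instruments, local
channels, local randomness and idle parties are special cases, because later operations may ignore
outcomes. Every branch of the protocol has finitely many rounds. -/
inductive Protocol {n : ℕ} : (Fin n → HilbertSpace) → (Fin n → HilbertSpace) → Type 1
  | done (H : Fin n → HilbertSpace) : Protocol H H
  | round {H K H' : Fin n → HilbertSpace}
      (M : ∀ j, ℕ → ((H j).carrier →L[ℂ] (K j).carrier))
      (complete : ∀ j (v : (H j).carrier), HasSum (fun x => ‖M j x v‖ ^ 2) (‖v‖ ^ 2))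
      (next : (Fin n → ℕ) → Protocol K H') : Protocol H H'

/-- The branches of a protocol: the complete records of outcomes. -/
def Protocol.Branch {n : ℕ} {H H' : Fin n → HilbertSpace} : Protocol H H' → Type
  | .done _ => Unit
  | .round _ _ next => Σ x, (next x).Branch

/-- The local Kraus operators that the parties have applied along a branch. -/
def Protocol.localOp {n : ℕ} {H H' : Fin n → HilbertSpace} :
    (P : Protocol H H') → P.Branch → ∀ j, (H j).carrier →L[ℂ] (H' j).carrier
  | .done _ => fun _ _ => ContinuousLinearMap.id ℂ _
  | .round M _ next => fun (b : Σ x, (next x).Branch) j =>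
      ((next b.1).localOp b.2 j).comp (M j (b.1 j))

/-- `L` is the channel implemented by the protocol `P` on `n` modes, one for each party:
`L(|ψ⟩⟨ψ|) = ∑_b K_b |ψ⟩⟨ψ| K_b†`, where `K_b` is the tensor product of the local Kraus operators
of the branch `b`. -/
def IsImplementedBy {n : ℕ} (L : Channel (Modes n))
    (P : Protocol (fun _ : Fin n => modeSpace) (fun _ : Fin n => modeSpace)) : Prop :=
  ∃ K : P.Branch → (Modes n →L[ℂ] Modes n),
    (∀ b, IsTensorOp (P.localOp b) (K b)) ∧
    ∀ ψ, HasSum (fun b => pureState (K b ψ)) (L.apply (pureState ψ))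

/-- LOCC channels on `n` modes: channels implemented by protocols as above, and channels that are
limits `L_m(|ψ⟩⟨ψ|) → L(|ψ⟩⟨ψ|)` of such (weak convergence of states to a state is convergence in
trace norm). The limits bring in measurements with a continuum of outcomes, such as heterodyne
detection, and protocols with infinitely many rounds; they do not change the supremum in
`simulationFidelity`, in which the average fidelity is continuous in `L`. -/
def IsLOCC {n : ℕ} (L : Channel (Modes n)) : Prop :=
  ∃ (P : ℕ → Protocol (fun _ : Fin n => modeSpace) (fun _ : Fin n => modeSpace))
    (Lm : ℕ → Channel (Modes n)),
    (∀ m, IsImplementedBy (Lm m) (P m)) ∧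
    ∀ φ ψ : Modes n, Filter.Tendsto (fun m => inner ℂ φ ((Lm m).apply (pureState ψ) φ))
      Filter.atTop (nhds (inner ℂ φ (L.apply (pureState ψ) φ)))

/-- The LOCC (classical) simulation fidelity of the unitary `U` on the ensemble of pure states
`ψ a` with `a` distributed according to `μ`: the supremum over LOCC channels `L` of the average of
`Tr [L(|ψ⟩⟨ψ|) |Uψ⟩⟨Uψ|] = ⟨Uψ| L(|ψ⟩⟨ψ|) |Uψ⟩`. -/
def simulationFidelity {n : ℕ} {A : Type} [MeasurableSpace A] (μ : Measure A) (ψ : A → Modes n)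
    (U : Modes n ≃ₗᵢ[ℂ] Modes n) : ℝ≥0∞ :=
  ⨆ (L : Channel (Modes n)) (_ : IsLOCC L),
    ∫⁻ a, ENNReal.ofReal (inner ℂ (U (ψ a)) (L.apply (pureState (ψ a)) (U (ψ a)))).re ∂μ

/-! ### The upper bound -/

/-- The matrix `(1 + l) S⁻¹ (iΩ_J) S⁻ᵀ - iΩ_J`. -/
def zMatrix {n : ℕ} (l : ℝ) (S : Matrix (Fin 2 × Fin n) (Fin 2 × Fin n) ℝ) (J : Finset (Fin n)) :
    Matrix (Fin 2 × Fin n) (Fin 2 × Fin n) ℂ :=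
  ((1 + l : ℝ) : ℂ) • ((S⁻¹).map Complex.ofReal * (Complex.I • (omegaJ J).map Complex.ofReal) *
    ((S⁻¹)ᵀ).map Complex.ofReal) - Complex.I • (omegaJ J).map Complex.ofReal

theorem omegaJ_transpose {n : ℕ} (J : Finset (Fin n)) : (omegaJ J)ᵀ = -omegaJ J := by
  rw [omegaJ, Matrix.blockDiagonal_transpose, ← Matrix.blockDiagonal_neg]
  congr 1
  funext j
  by_cases h : j ∈ J <;> ext a b <;> fin_cases a <;> fin_cases b <;> simp [h]

theorem zMatrix_isHermitian {n : ℕ} (l : ℝ) (S : Matrix (Fin 2 × Fin n) (Fin 2 × Fin n) ℝ)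
    (J : Finset (Fin n)) : (zMatrix l S J).IsHermitian := by
  have hmap : ∀ A : Matrix (Fin 2 × Fin n) (Fin 2 × Fin n) ℝ,
      (A.map Complex.ofReal)ᴴ = Aᵀ.map Complex.ofReal := by
    intro A
    ext a b
    simp [Matrix.conjTranspose_apply]
  have hneg : ((-omegaJ J).map Complex.ofReal) = -((omegaJ J).map Complex.ofReal) := by
    ext a b
    simp
  simp only [Matrix.IsHermitian, zMatrix, Matrix.conjTranspose_sub, Matrix.conjTranspose_smul,
    Matrix.conjTranspose_mul, hmap, Matrix.transpose_transpose, omegaJ_transpose, hneg,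
    Complex.star_def, Complex.conj_ofReal, Complex.conj_I, neg_smul_neg, Matrix.mul_assoc]

/-- The bound `2ⁿ (1 + l)ⁿ / ∏_ℓ √(2 + l + |z_ℓ|)`, where the `z_ℓ` are the `2n` eigenvalues of
`(1 + l) S⁻¹ (iΩ_J) S⁻ᵀ - iΩ_J`, with multiplicity. -/
def bound {n : ℕ} (l : ℝ) (S : Matrix (Fin 2 × Fin n) (Fin 2 × Fin n) ℝ) (J : Finset (Fin n)) :
    ℝ :=
  2 ^ n * (1 + l) ^ n /
    ∏ k : Fin 2 × Fin n, Real.sqrt (2 + l + |(zMatrix_isHermitian l S J).eigenvalues k|)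

end GaussLOCC

end

/-! For one branch `K = A₁ ⊗ ⋯ ⊗ Aₙ` of an LOCC protocol, expand `|α⟩⟨α|` in Weyl operators, which
the Gaussian unitary permutes. The Gaussian average of `|⟨Kα|Uα⟩|²` becomes
`(2π)⁻ⁿ ∫ e^{-|ξ|²/4} ∏ⱼ kⱼ(ξ) dξ`, where `kⱼ` involves `Aⱼ` alone. Up to a Gaussian factor `kⱼ` is
the characteristic function of a quantum state, hence positive definite with respect to the twist of
a symplectic form. Complex conjugation (partial transposition) of the modes outside `J` flips the
sign of their twists, so that the product is positive definite with respect to the twist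
`Z = S⁻¹ Ω_J S⁻ᵀ - Ω_J / (1 + λ)`, with value at the origin the average of `‖Kα‖²`.

If the eigenvalues of `iZ` are `ζₖ` and `h` is positive definite with twist `Z`, then the
Cauchy–Schwarz inequality bounds the Gaussian average of `h` by the square root of `h 0` times
another Gaussian average of `h`. Iteration yields `|∫ e^{-c|x|²} h| ≤ h 0 ∏ₖ √(π / (c + |ζₖ| / 4))`.
Summing over the branches, whose values `‖Kα‖²` add up to `1`, gives the bound for every `J`.

The sets `J` and `Jᶜ` give the same bound and `J = [n]` gives `1`. Since the eigenvalues of the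
symplectically transformed `iΩ_J` have product of modulus `1`, Weyl's perturbation theorem and the
AM-GM inequality show that every bound is at most `1`.
-/

noncomputable section

namespace GaussLOCC

/-! ### Eigenvalues of Hermitian matrices -/

section Eigenvalues

variable {𝕜 ι : Type*} [RCLike 𝕜] [Fintype ι] [DecidableEq ι] {A B : Matrix ι ι 𝕜}

open Polynomial in
theorem prod_eigenvalues_of_charpoly_eq (hA : A.IsHermitian) {d : ι → ℝ}
    (h : A.charpoly = ∏ i, (X - C (d i : 𝕜))) (f : ℝ → ℝ) :
    ∏ i, f (hA.eigenvalues i) = ∏ i, f (d i) := by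
  have hroots : A.charpoly.roots = Multiset.map (RCLike.ofReal ∘ d) Finset.univ.val := by
    rw [h, Polynomial.roots_prod]
    · simp
    · simp [Finset.prod_ne_zero_iff, Polynomial.X_sub_C_ne_zero]
  rw [hA.roots_charpoly_eq_eigenvalues] at hroots
  have hmap := congrArg (Multiset.map fun z : 𝕜 => f (RCLike.re z)) hroots
  simp only [Multiset.map_map, Function.comp_def, RCLike.ofReal_re] at hmap
  exact congrArg Multiset.prod hmap

theorem prod_eigenvalues_neg (hA : A.IsHermitian) (hB : (-A).IsHermitian) (f : ℝ → ℝ) :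
    ∏ i, f (hB.eigenvalues i) = ∏ i, f (-hA.eigenvalues i) :=
  prod_eigenvalues_of_charpoly_eq hB
    (by rw [← hA.charpoly_cfc_eq, cfc_neg_id (R := ℝ) A hA.isSelfAdjoint]) f

theorem prod_eigenvalues_smul (hA : A.IsHermitian) {r : ℝ} (hB : (r • A).IsHermitian)
    (f : ℝ → ℝ) : ∏ i, f (hB.eigenvalues i) = ∏ i, f (r * hA.eigenvalues i) :=
  prod_eigenvalues_of_charpoly_eq hB
    (by rw [← hA.charpoly_cfc_eq, cfc_const_mul_id r A hA.isSelfAdjoint]) f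

theorem prod_eigenvalues_sq_of_charpoly_eq (hA : A.IsHermitian) {d : ι → ℝ}
    (h : (A ^ 2).charpoly = ∏ i, (Polynomial.X - Polynomial.C (d i : 𝕜))) (f : ℝ → ℝ) :
    ∏ i, f (hA.eigenvalues i ^ 2) = ∏ i, f (d i) := by
  rw [← prod_eigenvalues_of_charpoly_eq (hA.pow 2) h]
  refine (prod_eigenvalues_of_charpoly_eq (hA.pow 2)
    (d := fun i => hA.eigenvalues i ^ 2) ?_ f).symm
  rw [← hA.charpoly_cfc_eq fun x => x ^ 2, cfc_pow_id (R := ℝ) A 2 hA.isSelfAdjoint]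

section Weyl

variable {n : ℕ} {E : Type*} [NormedAddCommGroup E] [InnerProductSpace 𝕜 E]
  [FiniteDimensional 𝕜 E] {T T' : E →ₗ[𝕜] E}

theorem re_inner_apply_self_eq_sum (hT : T.IsSymmetric) (hn : Module.finrank 𝕜 E = n) (x : E) :
    RCLike.re (inner 𝕜 x (T x)) =
      ∑ i, hT.eigenvalues hn i * ‖inner 𝕜 (hT.eigenvectorBasis hn i) x‖ ^ 2 := by
  rw [← (hT.eigenvectorBasis hn).sum_inner_mul_inner x (T x), map_sum]
  refine Finset.sum_congr rfl fun i _ => ?_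
  rw [← OrthonormalBasis.repr_apply_apply, hT.eigenvectorBasis_apply_self_apply hn,
    OrthonormalBasis.repr_apply_apply, mul_left_comm, ← inner_conj_symm, RCLike.conj_mul,
    ← RCLike.ofReal_pow, ← RCLike.ofReal_mul, RCLike.ofReal_re]

theorem eigenvalues_mul_norm_sq_le (hT : T.IsSymmetric) (hn : Module.finrank 𝕜 E = n)
    {k : Fin n} {x : E} (hx : ∀ i, k < i → inner 𝕜 (hT.eigenvectorBasis hn i) x = 0) :
    hT.eigenvalues hn k * ‖x‖ ^ 2 ≤ RCLike.re (inner 𝕜 x (T x)) := by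
  rw [re_inner_apply_self_eq_sum hT hn, ← (hT.eigenvectorBasis hn).sum_sq_norm_inner_right x,
    Finset.mul_sum]
  refine Finset.sum_le_sum fun i _ => ?_
  rcases lt_or_ge k i with hi | hi
  · simp [hx i hi]
  · exact mul_le_mul_of_nonneg_right (hT.eigenvalues_antitone hn hi) (by positivity)

theorem re_inner_apply_self_le (hT : T.IsSymmetric) (hn : Module.finrank 𝕜 E = n)
    {k : Fin n} {x : E} (hx : ∀ i, i < k → inner 𝕜 (hT.eigenvectorBasis hn i) x = 0) :
    RCLike.re (inner 𝕜 x (T x)) ≤ hT.eigenvalues hn k * ‖x‖ ^ 2 := by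
  rw [re_inner_apply_self_eq_sum hT hn, ← (hT.eigenvectorBasis hn).sum_sq_norm_inner_right x,
    Finset.mul_sum]
  refine Finset.sum_le_sum fun i _ => ?_
  rcases lt_or_ge i k with hi | hi
  · simp [hx i hi]
  · exact mul_le_mul_of_nonneg_right (hT.eigenvalues_antitone hn hi) (by positivity)

theorem exists_ne_zero_inner_eq_zero (hn : Module.finrank 𝕜 E = n) (e e' : Fin n → E)
    (k : Fin n) : ∃ x : E, x ≠ 0 ∧ (∀ i, k < i → inner 𝕜 (e i) x = 0) ∧
      ∀ i, i < k → inner 𝕜 (e' i) x = 0 := by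
  let L : E →ₗ[𝕜] ({i : Fin n // i ≠ k} → 𝕜) := LinearMap.pi fun i =>
    (innerSL 𝕜 (if k < i.1 then e i.1 else e' i.1)).toLinearMap
  have hker : LinearMap.ker L ≠ ⊥ := by
    apply LinearMap.ker_ne_bot_of_finrank_lt
    have := k.pos
    simp only [hn, Module.finrank_fintype_fun_eq_card, ne_eq, Fintype.card_subtype_compl,
      Fintype.card_fin, Fintype.card_unique]
    omega
  obtain ⟨x, hx, hx0⟩ := (Submodule.ne_bot_iff _).1 hker
  have hL (i : {i : Fin n // i ≠ k}) : inner 𝕜 (if k < i.1 then e i.1 else e' i.1) x = 0 :=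
    congrFun (LinearMap.mem_ker.1 hx) i
  refine ⟨x, hx0, fun i hi => ?_, fun i hi => ?_⟩
  · simpa [hi] using hL ⟨i, hi.ne'⟩
  · simpa [hi.not_gt] using hL ⟨i, hi.ne⟩

theorem eigenvalues_le_add (hT : T.IsSymmetric) (hT' : T'.IsSymmetric)
    (hn : Module.finrank 𝕜 E = n) {ε : ℝ}
    (h : ∀ x, RCLike.re (inner 𝕜 x (T x)) ≤ RCLike.re (inner 𝕜 x (T' x)) + ε * ‖x‖ ^ 2)
    (k : Fin n) : hT.eigenvalues hn k ≤ hT'.eigenvalues hn k + ε := by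
  obtain ⟨x, hx0, hx, hx'⟩ := exists_ne_zero_inner_eq_zero hn (hT.eigenvectorBasis hn)
    (hT'.eigenvectorBasis hn) k
  refine le_of_mul_le_mul_right ?_ (by positivity : 0 < ‖x‖ ^ 2)
  linarith [h x, eigenvalues_mul_norm_sq_le hT hn hx, re_inner_apply_self_le hT' hn hx']

end Weyl

open scoped Matrix.Norms.L2Operator

theorem eigenvalues_le_add_norm_sub (hA : A.IsHermitian) (hB : B.IsHermitian) (k : ι) :
    hA.eigenvalues k ≤ hB.eigenvalues k + ‖A - B‖ := by
  refine eigenvalues_le_add (Matrix.isSymmetric_toEuclideanLin_iff.mpr hA)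
    (Matrix.isSymmetric_toEuclideanLin_iff.mpr hB) finrank_euclideanSpace (fun x => ?_)
    ((Fintype.equivOfCardEq (Fintype.card_fin _)).symm k)
  have hsub : RCLike.re (inner 𝕜 x (Matrix.toEuclideanLin (A - B) x)) ≤ ‖A - B‖ * ‖x‖ ^ 2 :=
    calc RCLike.re (inner 𝕜 x (Matrix.toEuclideanLin (A - B) x))
      _ ≤ ‖x‖ * ‖Matrix.toEuclideanLin (A - B) x‖ :=
        (RCLike.re_le_norm _).trans (norm_inner_le_norm _ _)
      _ ≤ ‖x‖ * (‖A - B‖ * ‖x‖) := by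
        gcongr
        exact Matrix.l2_opNorm_mulVec (A - B) x
      _ = ‖A - B‖ * ‖x‖ ^ 2 := by ring
  rw [map_sub, LinearMap.sub_apply, inner_sub_right, map_sub] at hsub
  linarith

/-- Weyl's perturbation theorem: `Matrix.IsHermitian.eigenvalues` is sorted, so no matching of the
eigenvalues is needed. -/
theorem abs_eigenvalues_sub_le (hA : A.IsHermitian) (hB : B.IsHermitian) (k : ι) :
    |hA.eigenvalues k - hB.eigenvalues k| ≤ ‖A - B‖ := by
  have hAB := eigenvalues_le_add_norm_sub hA hB k
  have hBA := eigenvalues_le_add_norm_sub hB hA k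
  rw [norm_sub_rev] at hBA
  exact abs_sub_le_iff.2 ⟨by linarith, by linarith⟩

end Eigenvalues

/-! ### The Hermitian matrix `iA` of a real antisymmetric matrix `A` -/

section IMatrix

variable {ι : Type*} {A B : Matrix ι ι ℝ}

/-- The complex matrix `iA` of a real matrix `A`. It is Hermitian if `A` is antisymmetric, and is
then how the spectrum of `A` enters: all bounds are in terms of the eigenvalues of `iA`. -/
def iMatrix (A : Matrix ι ι ℝ) : Matrix ι ι ℂ := Complex.I • A.map Complex.ofReal

theorem iMatrix_isHermitian (hA : Aᵀ = -A) : (iMatrix A).IsHermitian := by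
  ext a b
  have h : A b a = -A a b := congrFun (congrFun hA a) b
  simp [iMatrix, h]

theorem iMatrix_neg (A : Matrix ι ι ℝ) : iMatrix (-A) = -iMatrix A := by
  ext
  simp [iMatrix]

theorem iMatrix_sub (A B : Matrix ι ι ℝ) : iMatrix (A - B) = iMatrix A - iMatrix B := by
  ext
  simp [iMatrix, mul_sub]

theorem iMatrix_smul (r : ℝ) (A : Matrix ι ι ℝ) : iMatrix (r • A) = r • iMatrix A := by
  ext
  simp [iMatrix, mul_left_comm]

variable [Fintype ι]

theorem map_ofReal_mul (A B : Matrix ι ι ℝ) :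
    (A * B).map Complex.ofReal = A.map Complex.ofReal * B.map Complex.ofReal :=
  Matrix.map_mul (f := Complex.ofRealHom)

variable [DecidableEq ι]

theorem iMatrix_sq (A : Matrix ι ι ℝ) : iMatrix A ^ 2 = -(A * A).map Complex.ofReal := by
  rw [sq, iMatrix, Matrix.smul_mul, Matrix.mul_smul, smul_smul, Complex.I_mul_I, map_ofReal_mul,
    neg_one_smul]

theorem norm_det_iMatrix (A : Matrix ι ι ℝ) : ‖(iMatrix A).det‖ = |A.det| := by
  have hmap : (A.map Complex.ofReal).det = A.det := (RingHom.map_det Complex.ofRealHom A).symm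
  rw [iMatrix, Matrix.det_smul, hmap, norm_mul, norm_pow, Complex.norm_I, one_pow, one_mul,
    Complex.norm_real, Real.norm_eq_abs]

open scoped Matrix.Norms.L2Operator in
theorem norm_iMatrix_le_one (hA : Aᵀ = -A) (hA2 : A * A = -1) : ‖iMatrix A‖ ≤ 1 := by
  have hsq : iMatrix A * star (iMatrix A) = 1 := by
    rw [Matrix.star_eq_conjTranspose, (iMatrix_isHermitian hA).eq, ← sq, iMatrix_sq, hA2]
    ext i j
    simp [Matrix.one_apply, apply_ite]
  have hnorm := CStarRing.norm_self_mul_star (x := iMatrix A)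
  rw [hsq] at hnorm
  have hone : ‖(1 : Matrix ι ι ℂ)‖ ≤ 1 := by
    rcases subsingleton_or_nontrivial (Matrix ι ι ℂ) with h | h
    · simp [Subsingleton.elim (1 : Matrix ι ι ℂ) 0]
    · exact CStarRing.norm_one.le
  nlinarith [norm_nonneg (iMatrix A)]

end IMatrix

/-! ### Symmetries of the bound -/

section Bound

variable {n : ℕ} {S : Matrix (Fin 2 × Fin n) (Fin 2 × Fin n) ℝ} {l : ℝ}

theorem omegaJ_mul_omegaJ (J : Finset (Fin n)) : omegaJ J * omegaJ J = -1 := by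
  rw [omegaJ, ← Matrix.blockDiagonal_mul, ← Matrix.blockDiagonal_one, ← Matrix.blockDiagonal_neg]
  congr 1
  funext j
  by_cases h : j ∈ J <;> ext a b <;> fin_cases a <;> fin_cases b <;> simp [h]

theorem omegaJ_compl (J : Finset (Fin n)) : omegaJ Jᶜ = -omegaJ J := by
  rw [omegaJ, omegaJ, ← Matrix.blockDiagonal_neg]
  congr 1
  funext j
  by_cases h : j ∈ J <;> simp [h]

theorem omegaJ_univ (n : ℕ) : omegaJ (Finset.univ : Finset (Fin n)) = omega n := by
  simp [omegaJ, omega]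

theorem det_omegaJ_sq (J : Finset (Fin n)) : (omegaJ J).det ^ 2 = 1 := by
  have h := congrArg Matrix.det (omegaJ_mul_omegaJ J)
  rwa [Matrix.det_mul, Matrix.det_neg, Matrix.det_one, ← sq, Fintype.card_prod, Fintype.card_fin,
    pow_mul, neg_one_sq, one_pow, mul_one] at h

theorem IsSymplectic.det_sq (hS : IsSymplectic S) : S.det ^ 2 = 1 := by
  have h := congrArg Matrix.det hS
  have hΩ := det_omegaJ_sq (Finset.univ : Finset (Fin n))
  rw [omegaJ_univ] at hΩ
  rw [Matrix.det_mul, Matrix.det_mul, Matrix.det_transpose] at h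
  linear_combination (omega n).det * h + (1 - S.det ^ 2) * hΩ

theorem IsSymplectic.isUnit_det (hS : IsSymplectic S) : IsUnit S.det :=
  (isUnit_pow_iff two_ne_zero).1 (hS.det_sq ▸ isUnit_one)

/-- The matrix `S⁻¹ Ω_J S⁻ᵀ`: the partially transposed symplectic form in the modes transformed
by `S`. -/
def congOmega (S : Matrix (Fin 2 × Fin n) (Fin 2 × Fin n) ℝ) (J : Finset (Fin n)) :
    Matrix (Fin 2 × Fin n) (Fin 2 × Fin n) ℝ :=
  S⁻¹ * omegaJ J * (S⁻¹)ᵀ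

theorem congOmega_transpose (S : Matrix (Fin 2 × Fin n) (Fin 2 × Fin n) ℝ) (J : Finset (Fin n)) :
    (congOmega S J)ᵀ = -congOmega S J := by
  simp only [congOmega, Matrix.transpose_mul, Matrix.transpose_transpose, omegaJ_transpose,
    Matrix.neg_mul, Matrix.mul_neg, Matrix.mul_assoc]

theorem IsSymplectic.congOmega_univ (hS : IsSymplectic S) :
    congOmega S Finset.univ = omegaJ Finset.univ := by
  have hu := hS.isUnit_det
  have hut : IsUnit Sᵀ.det := by rwa [Matrix.det_transpose]
  rw [congOmega, omegaJ_univ]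
  conv_lhs => rw [← hS]
  rw [Matrix.transpose_nonsing_inv, ← Matrix.mul_assoc, ← Matrix.mul_assoc,
    Matrix.nonsing_inv_mul _ hu, Matrix.one_mul, Matrix.mul_assoc, Matrix.mul_nonsing_inv _ hut,
    Matrix.mul_one]

theorem IsSymplectic.abs_det_congOmega (hS : IsSymplectic S) (J : Finset (Fin n)) :
    |(congOmega S J).det| = 1 := by
  rw [← abs_one, ← sq_eq_sq_iff_abs_eq_abs, congOmega, Matrix.det_mul, Matrix.det_mul,
    Matrix.det_transpose, Matrix.det_nonsing_inv, Ring.inverse_eq_inv, mul_pow, mul_pow, inv_pow,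
    hS.det_sq, det_omegaJ_sq]
  norm_num

theorem zMatrix_eq_iMatrix (l : ℝ) (S : Matrix (Fin 2 × Fin n) (Fin 2 × Fin n) ℝ)
    (J : Finset (Fin n)) : zMatrix l S J = iMatrix ((1 + l) • congOmega S J - omegaJ J) := by
  rw [iMatrix_sub, iMatrix_smul, iMatrix, iMatrix, congOmega, map_ofReal_mul, map_ofReal_mul,
    zMatrix, Matrix.mul_smul, Matrix.smul_mul]
  rfl

theorem zMatrix_compl (l : ℝ) (S : Matrix (Fin 2 × Fin n) (Fin 2 × Fin n) ℝ)
    (J : Finset (Fin n)) : zMatrix l S Jᶜ = -zMatrix l S J := by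
  rw [zMatrix_eq_iMatrix, zMatrix_eq_iMatrix, ← iMatrix_neg, congOmega, congOmega, omegaJ_compl,
    Matrix.mul_neg, Matrix.neg_mul, smul_neg, neg_sub_neg, neg_sub]

theorem bound_compl (l : ℝ) (S : Matrix (Fin 2 × Fin n) (Fin 2 × Fin n) ℝ) (J : Finset (Fin n)) :
    bound l S Jᶜ = bound l S J := by
  have h := prod_eigenvalues_neg (zMatrix_isHermitian l S J)
    (zMatrix_compl l S J ▸ zMatrix_isHermitian l S Jᶜ) fun z => √(2 + l + |z|)
  simp only [abs_neg] at h
  simp only [bound, zMatrix_compl, h]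

theorem IsSymplectic.bound_univ (hS : IsSymplectic S) (hl : 0 < l) :
    bound l S Finset.univ = 1 := by
  have hz : zMatrix l S Finset.univ = iMatrix (l • omegaJ Finset.univ) := by
    rw [zMatrix_eq_iMatrix, hS.congOmega_univ, add_smul, one_smul, add_sub_cancel_left]
  have hsq : (zMatrix l S Finset.univ ^ 2).charpoly =
      ∏ _i : Fin 2 × Fin n, (Polynomial.X - Polynomial.C (RCLike.ofReal (l ^ 2) : ℂ)) := by
    rw [hz, iMatrix_sq, Matrix.smul_mul, Matrix.mul_smul, omegaJ_mul_omegaJ, smul_smul,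
      ← Matrix.charpoly_diagonal]
    congr 1
    ext i j
    by_cases h : i = j <;> simp [h, sq]
  have h := prod_eigenvalues_sq_of_charpoly_eq (zMatrix_isHermitian l S Finset.univ)
    (d := fun _ => l ^ 2) hsq (fun z => √(2 + l + √z))
  rw [Finset.prod_const, Finset.card_univ, Fintype.card_prod, Fintype.card_fin, Fintype.card_fin,
    pow_mul, Real.sqrt_sq hl.le, Real.sq_sqrt (by positivity), show 2 + l + l = 2 * (1 + l) by ring,
    mul_pow] at h
  simp only [Real.sqrt_sq_eq_abs] at h
  rw [bound, h]
  exact div_self (by positivity)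

theorem IsSymplectic.bound_le_one (hS : IsSymplectic S) (hl : 0 < l) (J : Finset (Fin n)) :
    bound l S J ≤ 1 := by
  set z := (zMatrix_isHermitian l S J).eigenvalues
  have hc : (iMatrix ((1 + l) • congOmega S J)).IsHermitian :=
    iMatrix_isHermitian (by rw [Matrix.transpose_smul, congOmega_transpose, smul_neg])
  set a := hc.eigenvalues
  have hza (k) : |a k| ≤ |z k| + 1 := by
    have hpert := abs_eigenvalues_sub_le hc (zMatrix_isHermitian l S J) k
    rw [show iMatrix ((1 + l) • congOmega S J) - zMatrix l S J = iMatrix (omegaJ J) by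
      rw [zMatrix_eq_iMatrix, iMatrix_sub, sub_sub_cancel]] at hpert
    linarith [abs_sub_abs_le_abs_sub (a k) (z k),
      norm_iMatrix_le_one (omegaJ_transpose J) (omegaJ_mul_omegaJ J)]
  have hdet : ∏ k, |a k| = (1 + l) ^ (2 * n) := by
    have h := congrArg norm hc.det_eq_prod_eigenvalues
    rw [norm_det_iMatrix, Matrix.det_smul, abs_mul, hS.abs_det_congOmega, mul_one, norm_prod,
      abs_of_pos (by positivity), Fintype.card_prod, Fintype.card_fin, Fintype.card_fin] at h
    simpa [a] using h.symm
  have hfactor (k) : 4 * (1 + l) * |a k| ≤ √(2 + l + |z k|) ^ 4 := by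
    rw [show 4 = 2 * 2 from rfl, pow_mul, Real.sq_sqrt (by positivity)]
    nlinarith [hza k, sq_nonneg (1 + l - |a k|), abs_nonneg (a k), abs_nonneg (z k)]
  rw [bound, div_le_one (Finset.prod_pos fun k _ => Real.sqrt_pos.2 (by positivity)),
    ← pow_le_pow_iff_left₀ (by positivity) (by positivity) four_ne_zero, ← Finset.prod_pow]
  calc ((2 : ℝ) ^ n * (1 + l) ^ n) ^ 4
      = (4 * (1 + l)) ^ (2 * n) * (1 + l) ^ (2 * n) := by
        rw [← mul_pow, ← mul_pow, ← pow_mul, pow_mul _ 2 n, mul_comm n 4, pow_mul _ 4 n]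
        ring_nf
    _ = ∏ k, 4 * (1 + l) * |a k| := by
        rw [Finset.prod_mul_distrib, hdet, Finset.prod_const, Finset.card_univ, Fintype.card_prod,
          Fintype.card_fin, Fintype.card_fin]
    _ ≤ ∏ k, √(2 + l + |z k|) ^ 4 :=
        Finset.prod_le_prod (fun k _ => by positivity) fun k _ => hfactor k

theorem IsSymplectic.exists_bound_le (hS : IsSymplectic S) (hl : 0 < l) (hn : 2 ≤ n)
    (J : Finset (Fin n)) :
    ∃ J' : Finset (Fin n), (1 ≤ J'.card ∧ J'.card ≤ n / 2) ∧ bound l S J' ≤ bound l S J := by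
  have htriv (h : bound l S J = 1) :
      ∃ J' : Finset (Fin n), (1 ≤ J'.card ∧ J'.card ≤ n / 2) ∧ bound l S J' ≤ bound l S J :=
    ⟨{⟨0, by omega⟩}, by rw [Finset.card_singleton]; omega, (hS.bound_le_one hl _).trans h.ge⟩
  have hcard := Finset.card_add_card_compl J
  rw [Fintype.card_fin] at hcard
  rcases J.eq_empty_or_nonempty with rfl | hJ
  · exact htriv (by rw [← bound_compl, Finset.compl_empty, hS.bound_univ hl])
  rcases Jᶜ.eq_empty_or_nonempty with hJc | hJc
  · exact htriv (by rw [(Finset.compl_eq_empty_iff J).1 hJc, hS.bound_univ hl])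
  rcases le_or_gt J.card (n / 2) with hle | hlt
  · exact ⟨J, ⟨hJ.card_pos, hle⟩, le_rfl⟩
  · exact ⟨Jᶜ, ⟨hJc.card_pos, by omega⟩, (bound_compl l S J).le⟩

theorem IsSymplectic.iInf_bound_eq (hS : IsSymplectic S) (hl : 0 < l) (hn : 2 ≤ n) :
    (⨅ J : Finset (Fin n), bound l S J) =
      ⨅ J : {J : Finset (Fin n) // 1 ≤ J.card ∧ J.card ≤ n / 2}, bound l S J.1 := by
  obtain ⟨J₀, hJ₀, -⟩ := hS.exists_bound_le hl hn ∅
  have : Nonempty {J : Finset (Fin n) // 1 ≤ J.card ∧ J.card ≤ n / 2} := ⟨⟨J₀, hJ₀⟩⟩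
  refine le_antisymm (le_ciInf fun J => ciInf_le (Set.finite_range _).bddBelow J.1)
    (le_ciInf fun J => ?_)
  obtain ⟨J', hJ', hle⟩ := hS.exists_bound_le hl hn J
  have hJ'_le := ciInf_le (f := fun J : {J : Finset (Fin n) // 1 ≤ J.card ∧ J.card ≤ n / 2} =>
    bound l S J.1) (Set.finite_range _).bddBelow ⟨J', hJ'⟩
  exact hJ'_le.trans hle

end Bound

/-! ### Positive semidefinite kernels -/

section PosSemidef

open scoped ComplexOrder

universe u

theorem continuous_of_norm_eq_of_inner {𝕜 X H : Type*} [RCLike 𝕜] [TopologicalSpace X]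
    [NormedAddCommGroup H] [InnerProductSpace 𝕜 H] {F : X → H} {M : ℝ} (hM : ∀ x, ‖F x‖ = M)
    (h : ∀ x₀, ContinuousAt (fun x => inner 𝕜 (F x₀) (F x)) x₀) : Continuous F := by
  refine continuous_iff_continuousAt.2 fun x₀ => ?_
  have hsq (x : X) : ‖F x - F x₀‖ ^ 2 = 2 * M ^ 2 - 2 * RCLike.re (inner 𝕜 (F x₀) (F x)) := by
    rw [norm_sub_rev, @norm_sub_sq 𝕜, hM, hM]
    ring
  have hlim : Filter.Tendsto (fun x => ‖F x - F x₀‖ ^ 2) (nhds x₀) (nhds 0) := by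
    have h0 : 2 * M ^ 2 - 2 * RCLike.re (inner 𝕜 (F x₀) (F x₀)) = 0 := by
      rw [inner_self_eq_norm_sq, hM, sub_self]
    simp only [hsq, ← h0]
    exact (((RCLike.continuous_re.tendsto _).comp (h x₀)).const_mul 2).const_sub (2 * M ^ 2)
  exact tendsto_iff_norm_sub_tendsto_zero.2 (by simpa using hlim.sqrt)

theorem posSemidef_gram {X H : Type*} [NormedAddCommGroup H] [InnerProductSpace ℂ H] (Φ : X → H) :
    (Matrix.gram ℂ Φ).PosSemidef := by
  refine ⟨Matrix.isHermitian_gram ℂ Φ, fun v => ?_⟩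
  have h : (v.sum fun i xi => v.sum fun j xj => star xi * Matrix.gram ℂ Φ i j * xj) =
      inner ℂ (v.sum fun i xi => xi • Φ i) (v.sum fun i xi => xi • Φ i) := by
    simp only [Finsupp.sum, sum_inner, inner_sum, inner_smul_left, inner_smul_right,
      Complex.star_def, Matrix.gram_apply]
    simp only [Finset.mul_sum]
    rw [Finset.sum_comm]
    exact Finset.sum_congr rfl fun i _ => Finset.sum_congr rfl fun j _ => by ring
  rw [h, inner_self_eq_norm_sq_to_K]
  exact pow_nonneg (Complex.zero_le_real.2 (norm_nonneg (v.sum fun i xi => xi • Φ i))) 2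

theorem posSemidef_integral {X A : Type*} [MeasurableSpace A] {μ : Measure A}
    {G : A → Matrix X X ℂ} (hG : ∀ a, (G a).PosSemidef)
    (hi : ∀ x y, Integrable (fun a => G a x y) μ) :
    (Matrix.of fun x y => ∫ a, G a x y ∂μ).PosSemidef := by
  refine ⟨?_, fun v => ?_⟩
  · ext x y
    rw [Matrix.conjTranspose_apply, Matrix.of_apply, Matrix.of_apply, Complex.star_def,
      ← integral_conj]
    exact integral_congr_ae (.of_forall fun a => (hG a).1.apply x y)
  · have h : (v.sum fun i xi => v.sum fun j xj =>
        star xi * (Matrix.of fun x y => ∫ a, G a x y ∂μ) i j * xj) =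
        ∫ a, v.sum fun i xi => v.sum fun j xj => star xi * G a i j * xj ∂μ := by
      have hij (i j : X) : Integrable (fun a => star (v i) * G a i j * v j) μ :=
        ((hi i j).const_mul _).mul_const _
      simp only [Finsupp.sum, Matrix.of_apply]
      rw [integral_finsetSum _ fun i _ => integrable_finsetSum _ fun j _ => hij i j]
      refine Finset.sum_congr rfl fun i _ => ?_
      rw [integral_finsetSum _ fun j _ => hij i j]
      exact Finset.sum_congr rfl fun j _ => by rw [integral_mul_const, integral_const_mul]
    rw [h]
    exact integral_nonneg fun a => (hG a).2 v

theorem exists_gram_of_posSemidef {X : Type u} {G : Matrix X X ℂ} (hG : G.PosSemidef) :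
    ∃ (H : Type u) (_ : NormedAddCommGroup H) (_ : InnerProductSpace ℂ H) (_ : CompleteSpace H)
      (Φ : X → H), Matrix.gram ℂ Φ = G := by
  let K : Matrix X X (ℂ →L[ℂ] ℂ) := Matrix.of fun x y => G x y • ContinuousLinearMap.id ℂ ℂ
  have hGh (x y : X) : (starRingEnd ℂ) (G x y) = G y x := hG.1.apply y x
  have hK : K.PosSemidef := by
    refine ((RKHS.posSemidef_tfae (K := K)).out 0 2 rfl rfl).mpr ⟨?_, fun v => ?_⟩
    · ext x y
      simp only [Matrix.conjTranspose_apply, K, Matrix.of_apply, star_smul]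
      rw [Complex.star_def, hGh, ← ContinuousLinearMap.one_def, star_one]
    · refine (Complex.le_def.1 (hG.2 v)).1.trans (le_of_eq ?_)
      simp only [RCLike.re_to_complex]
      congr 1
      refine Finsupp.sum_congr fun x _ => Finsupp.sum_congr fun y _ => ?_
      simp only [K, Matrix.of_apply, _root_.smul_apply, ContinuousLinearMap.id_apply, smul_eq_mul,
        RCLike.inner_apply, map_mul, hGh, Complex.star_def]
      ring
  have : Fact K.PosSemidef := ⟨hK⟩
  refine ⟨RKHS.OfKernel K, inferInstance, inferInstance, inferInstance,
    fun x => RKHS.kerFun (RKHS.OfKernel K) x (1 : ℂ), ?_⟩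
  ext x y
  rw [Matrix.gram_apply, ← RKHS.kernel_inner, RKHS.OfKernel.kernel_ofKernel]
  simp [K, hGh]

section ConstantDiagonal

variable {X : Type u} {G : Matrix X X ℂ} {M : ℝ}

theorem norm_sq_eq_of_gram {H : Type*} [NormedAddCommGroup H] [InnerProductSpace ℂ H] {Φ : X → H}
    (hM : ∀ x, (Matrix.gram ℂ Φ x x).re = M) (x : X) : ‖Φ x‖ ^ 2 = M :=
  (inner_self_eq_norm_sq (𝕜 := ℂ) (Φ x)).symm.trans (hM x)

theorem norm_apply_le_of_posSemidef (hG : G.PosSemidef) (hM : ∀ x, (G x x).re = M) (x y : X) :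
    ‖G x y‖ ≤ M := by
  obtain ⟨H, _, _, _, Φ, rfl⟩ := exists_gram_of_posSemidef hG
  have hnorm := norm_sq_eq_of_gram hM
  calc ‖Matrix.gram ℂ Φ x y‖ ≤ ‖Φ x‖ * ‖Φ y‖ := norm_inner_le_norm _ _
    _ ≤ M := by nlinarith [hnorm x, hnorm y, sq_nonneg (‖Φ x‖ - ‖Φ y‖)]

theorem continuous_of_continuous_gram [TopologicalSpace X] {H : Type*} [NormedAddCommGroup H]
    [InnerProductSpace ℂ H] {Φ : X → H} (hM : ∀ x, (Matrix.gram ℂ Φ x x).re = M)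
    (hc : ∀ x, Continuous (Matrix.gram ℂ Φ x)) : Continuous Φ :=
  continuous_of_norm_eq_of_inner (𝕜 := ℂ) (M := √M)
    (fun x => by rw [← norm_sq_eq_of_gram hM x, Real.sqrt_sq (norm_nonneg _)])
    fun x => (hc x).continuousAt

end ConstantDiagonal

section CauchySchwarz

variable {X H : Type*} [MeasurableSpace X] {μ : Measure X} [NormedAddCommGroup H]
  [InnerProductSpace ℂ H] [CompleteSpace H]

theorem integral_smul_inner_eq {g : X → ℝ} {Φ : X → H}
    (hi : Integrable (fun x => (g x : ℂ) • Φ x) μ) (w : H) :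
    ∫ x, (g x : ℂ) * inner ℂ w (Φ x) ∂μ = inner ℂ w (∫ x, (g x : ℂ) • Φ x ∂μ) := by
  rw [← integral_inner hi]
  exact integral_congr_ae (.of_forall fun x => by simp only [inner_smul_right])

theorem integral_mul_gram_eq_norm_sq [SFinite μ] {g : X → ℝ} {Φ : X → H}
    (hi : Integrable (fun x => (g x : ℂ) • Φ x) μ)
    (hint : Integrable (fun p : X × X => ((g p.1 * g p.2 : ℝ) : ℂ) * inner ℂ (Φ p.1) (Φ p.2))
      (μ.prod μ)) :
    ∫ p, ((g p.1 * g p.2 : ℝ) : ℂ) * inner ℂ (Φ p.1) (Φ p.2) ∂(μ.prod μ) =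
      ((‖∫ x, (g x : ℂ) • Φ x ∂μ‖ ^ 2 : ℝ) : ℂ) := by
  set v := ∫ x, (g x : ℂ) • Φ x ∂μ with hv
  calc ∫ p, ((g p.1 * g p.2 : ℝ) : ℂ) * inner ℂ (Φ p.1) (Φ p.2) ∂(μ.prod μ)
      = ∫ x, (g x : ℂ) * inner ℂ (Φ x) v ∂μ := by
        rw [integral_prod _ hint]
        refine integral_congr_ae (.of_forall fun x => ?_)
        simp only [Complex.ofReal_mul, mul_assoc, integral_const_mul, hv,
          integral_smul_inner_eq hi]
    _ = (starRingEnd ℂ) (inner ℂ v v) := by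
        nth_rewrite 3 [hv]
        rw [← integral_smul_inner_eq hi, ← integral_conj]
        simp only [map_mul, Complex.conj_ofReal, inner_conj_symm]
    _ = _ := by
        rw [inner_conj_symm, inner_self_eq_norm_sq_to_K]
        norm_cast

end CauchySchwarz

theorem norm_integral_sq_le_of_posSemidef {X : Type u} [TopologicalSpace X]
    [SecondCountableTopology X] [MeasurableSpace X] [BorelSpace X] {μ : Measure X} [SFinite μ]
    {G : Matrix X X ℂ} (hG : G.PosSemidef) (hc : Continuous fun p : X × X => G p.1 p.2) {M : ℝ}
    (hM : ∀ x, (G x x).re = M) {g : X → ℝ} (hg : Integrable g μ) (x₀ : X) :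
    ‖∫ x, (g x : ℂ) * G x₀ x ∂μ‖ ^ 2 ≤
      M * ‖∫ p, ((g p.1 * g p.2 : ℝ) : ℂ) * G p.1 p.2 ∂(μ.prod μ)‖ := by
  have hint : Integrable (fun p : X × X => ((g p.1 * g p.2 : ℝ) : ℂ) * G p.1 p.2) (μ.prod μ) :=
    (hg.mul_prod hg).ofReal.mul_bdd hc.aestronglyMeasurable
      (.of_forall fun p => norm_apply_le_of_posSemidef hG hM p.1 p.2)
  obtain ⟨H, _, _, _, Φ, rfl⟩ := exists_gram_of_posSemidef hG
  have hnorm := norm_sq_eq_of_gram hM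
  have hΦ : Continuous Φ := continuous_of_continuous_gram hM
    fun x => hc.comp (Continuous.prodMk_right x)
  have hi : Integrable (fun x => (g x : ℂ) • Φ x) μ :=
    (hg.ofReal (𝕜 := ℂ)).smul_bdd √M hΦ.aestronglyMeasurable
      (.of_forall fun x => by rw [← hnorm x, Real.sqrt_sq (norm_nonneg _)])
  simp only [Matrix.gram_apply] at hint ⊢
  rw [integral_smul_inner_eq hi, integral_mul_gram_eq_norm_sq hi hint, ← hnorm x₀,
    Complex.norm_real, Real.norm_of_nonneg (sq_nonneg _), ← mul_pow]
  gcongr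
  exact norm_inner_le_norm _ _

/-! ### Twisted positive definite functions -/

/-- `f` is positive definite with respect to the twist `e^{(i/2) B}`, as are the characteristic
functions of quantum states when `B` is the symplectic form. -/
def IsTwistedPosDef {V : Type*} [AddCommGroup V] (B : V → V → ℝ) (f : V → ℂ) : Prop :=
  (Matrix.of fun x y => Complex.exp (Complex.I / 2 * (B x y : ℝ)) * f (y - x)).PosSemidef

namespace IsTwistedPosDef

variable {V : Type*} [AddCommGroup V] {B B' : V → V → ℝ} {f f' : V → ℂ}

theorem mul (h : IsTwistedPosDef B f) (h' : IsTwistedPosDef B' f') :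
    IsTwistedPosDef (fun x y => B x y + B' x y) (fun x => f x * f' x) := by
  refine (congrArg Matrix.PosSemidef ?_).mpr (Matrix.PosSemidef.hadamard h h')
  ext x y
  simp only [Matrix.of_apply, Matrix.hadamard_apply, Complex.ofReal_add, mul_add, Complex.exp_add]
  ring

theorem one : IsTwistedPosDef (fun _ _ : V => 0) (fun _ => 1) := by
  refine (congrArg Matrix.PosSemidef ?_).mpr (posSemidef_gram fun _ : V => (1 : ℂ))
  ext x y
  simp

theorem prod {ι : Type*} (s : Finset ι) {B : ι → V → V → ℝ} {f : ι → V → ℂ}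
    (h : ∀ i ∈ s, IsTwistedPosDef (B i) (f i)) :
    IsTwistedPosDef (fun x y => ∑ i ∈ s, B i x y) (fun x => ∏ i ∈ s, f i x) := by
  classical
  induction s using Finset.induction_on with
  | empty => simpa using one
  | insert i s hi ih =>
    simp only [Finset.sum_insert hi, Finset.prod_insert hi]
    exact (h i (Finset.mem_insert_self _ _)).mul
      (ih fun j hj => h j (Finset.mem_insert_of_mem hj))

theorem comp {W : Type*} [AddCommGroup W] (h : IsTwistedPosDef B f) (L : W →+ V) :
    IsTwistedPosDef (fun x y => B (L x) (L y)) (fun x => f (L x)) := by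
  refine (congrArg Matrix.PosSemidef ?_).mpr (Matrix.PosSemidef.submatrix h L)
  ext x y
  simp

theorem neg_twist (h : IsTwistedPosDef B f) (hB : ∀ x y, B y x = -B x y)
    (hB' : ∀ x y, B (-x) (-y) = B x y) : IsTwistedPosDef (fun x y => -B x y) f := by
  refine (congrArg Matrix.PosSemidef ?_).mpr
    ((Matrix.PosSemidef.transpose h).submatrix fun x : V => -x)
  ext x y
  simp only [Matrix.of_apply, Matrix.submatrix_apply, Matrix.transpose_apply, hB', hB x y]
  congr 2
  abel

theorem zero_re_nonneg (h : IsTwistedPosDef B f) (hB : ∀ x, B x x = 0) : 0 ≤ (f 0).re := by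
  have h0 := h.diag_nonneg (i := 0)
  simp only [Matrix.of_apply, hB, sub_zero] at h0
  simpa using (Complex.le_def.1 h0).1

end IsTwistedPosDef

end PosSemidef

/-! ### Gaussian averages of twisted positive definite functions -/

section GaussianAverage

variable {ι : Type*} {ζ c : ι → ℝ}

/-- The coefficients of the Gaussian that arises as the twisted convolution square of
`e^{-∑ cₖ ξₖ²}`, for a twist whose square is diagonal with entries `-ζₖ²`. -/
def nextCoeff (ζ c : ι → ℝ) (k : ι) : ℝ := c k / 2 + ζ k ^ 2 / (32 * c k)

theorem nextCoeff_pos (hc : ∀ k, 0 < c k) (k : ι) : 0 < nextCoeff ζ c k := by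
  have := hc k
  unfold nextCoeff
  positivity

theorem le_nextCoeff (hc : ∀ k, 0 < c k) (k : ι) : ζ k / 4 ≤ nextCoeff ζ c k := by
  have h0 := hc k
  rw [nextCoeff, div_add_div _ _ (by norm_num) (by positivity),
    div_le_div_iff₀ (by norm_num) (by positivity)]
  nlinarith [sq_nonneg (4 * c k - ζ k)]

variable [Fintype ι]

/-- The bilinear form `xᵀ Z y` of the matrix `Z`, which will serve as a twist. -/
def matForm (Z : Matrix ι ι ℝ) (x y : ι → ℝ) : ℝ := x ⬝ᵥ Z *ᵥ y

theorem matForm_antisymm {Z : Matrix ι ι ℝ} (hZ : Zᵀ = -Z) (x y : ι → ℝ) :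
    matForm Z y x = -matForm Z x y := by
  rw [matForm, matForm, Matrix.dotProduct_mulVec, ← Matrix.mulVec_transpose, hZ, Matrix.neg_mulVec,
    neg_dotProduct, dotProduct_comm]

theorem matForm_self {Z : Matrix ι ι ℝ} (hZ : Zᵀ = -Z) (x : ι → ℝ) : matForm Z x x = 0 :=
  self_eq_neg.1 (matForm_antisymm hZ x x)

theorem matForm_mulVec (Z O : Matrix ι ι ℝ) (x y : ι → ℝ) :
    matForm Z (O *ᵥ x) (O *ᵥ y) = matForm (Oᵀ * Z * O) x y := by
  simp only [matForm, Matrix.dotProduct_mulVec, ← Matrix.vecMul_vecMul, Matrix.vecMul_transpose]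

theorem continuous_matForm (Z : Matrix ι ι ℝ) :
    Continuous fun p : (ι → ℝ) × (ι → ℝ) => matForm Z p.1 p.2 := by
  simp only [matForm, dotProduct, Matrix.mulVec]
  fun_prop

/-- The integral of `h` against the unnormalised Gaussian `e^{-∑ cₖ ξₖ²}`. -/
def gaussAvg (c : ι → ℝ) (h : (ι → ℝ) → ℂ) : ℂ :=
  ∫ ξ : ι → ℝ, (Real.exp (-∑ k, c k * ξ k ^ 2) : ℂ) * h ξ

theorem integrable_gauss (hc : ∀ k, 0 < c k) :
    Integrable fun ξ : ι → ℝ => Real.exp (-∑ k, c k * ξ k ^ 2) := by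
  have h := (GaussianFourier.integrable_cexp_neg_sum_mul_add (b := fun k => (c k : ℂ))
    (by simpa using hc) 0).norm
  refine h.congr (.of_forall fun ξ => ?_)
  simp only [Complex.norm_exp, Pi.zero_apply, zero_mul, Finset.sum_const_zero, add_zero]
  congr 1
  rw [← Complex.ofReal_re (-∑ k, c k * ξ k ^ 2)]
  push_cast
  rfl

theorem integral_gauss (c : ι → ℝ) :
    ∫ ξ : ι → ℝ, Real.exp (-∑ k, c k * ξ k ^ 2) = ∏ k, √(Real.pi / c k) := by
  simp_rw [← Finset.sum_neg_distrib, Real.exp_sum]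
  rw [integral_fintype_prod_volume_eq_prod (f := fun k (v : ℝ) => Real.exp (-(c k * v ^ 2)))]
  exact Finset.prod_congr rfl fun k _ => by simpa [neg_mul] using integral_gaussian (c k)

theorem norm_gaussAvg_le (hc : ∀ k, 0 < c k) {h : (ι → ℝ) → ℂ} {M : ℝ}
    (hM : ∀ ξ, ‖h ξ‖ ≤ M) : ‖gaussAvg c h‖ ≤ M * ∏ k, √(Real.pi / c k) := by
  rw [← integral_gauss c, ← integral_const_mul]
  refine norm_integral_le_of_norm_le ((integrable_gauss hc).const_mul M) (.of_forall fun ξ => ?_)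
  rw [norm_mul, Complex.norm_real, Real.norm_eq_abs, Real.abs_exp, mul_comm]
  exact mul_le_mul_of_nonneg_right (hM ξ) (Real.exp_pos _).le

variable {Z : Matrix ι ι ℝ} {h : (ι → ℝ) → ℂ}

theorem IsTwistedPosDef.norm_apply_le (hh : IsTwistedPosDef (matForm Z) h) (hZ : Zᵀ = -Z)
    (ξ : ι → ℝ) : ‖h ξ‖ ≤ (h 0).re := by
  simpa [matForm] using
    norm_apply_le_of_posSemidef hh (M := (h 0).re) (fun x => by simp [matForm_self hZ]) 0 ξ

/-- The value `∏ₖ √(π / (cₖ + ζₖ / 4))` that bounds the Gaussian averages of positive definite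
functions with twist of singular values `ζ`, normalised to be `1` at the origin. -/
def gaussBound (ζ c : ι → ℝ) : ℝ := ∏ k, √(Real.pi / (c k + ζ k / 4))

theorem gaussBound_pos (hζ : ∀ k, 0 ≤ ζ k) (hc : ∀ k, 0 < c k) : 0 < gaussBound ζ c :=
  Finset.prod_pos fun k _ => Real.sqrt_pos.2 (by have := hc k; have := hζ k; positivity)

theorem prod_mul_gaussBound_nextCoeff (hζ : ∀ k, 0 ≤ ζ k) (hc : ∀ k, 0 < c k) :
    (∏ k, √(Real.pi / (2 * c k))) * gaussBound ζ (nextCoeff ζ c) = gaussBound ζ c ^ 2 := by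
  rw [gaussBound, gaussBound, ← Finset.prod_pow, ← Finset.prod_mul_distrib]
  refine Finset.prod_congr rfl fun k _ => ?_
  have hck := hc k
  have hζk := hζ k
  have hnext : nextCoeff ζ c k + ζ k / 4 = (c k + ζ k / 4) ^ 2 / (2 * c k) := by
    rw [nextCoeff]
    field_simp
    ring
  have hsq : Real.pi / (2 * c k) * (Real.pi / ((c k + ζ k / 4) ^ 2 / (2 * c k))) =
      (Real.pi / (c k + ζ k / 4)) ^ 2 := by
    field_simp
  rw [← Real.sqrt_mul (by positivity), Real.sq_sqrt (by positivity), hnext, hsq,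
    Real.sqrt_sq (by positivity)]

theorem prod_sqrt_le_gaussBound (hζ : ∀ k, 0 ≤ ζ k) (hc : ∀ k, 0 < c k) (h : ∀ k, ζ k / 4 ≤ c k) :
    ∏ k, √(Real.pi / c k) ≤ (∏ _k : ι, √2) * gaussBound ζ c := by
  rw [gaussBound, ← Finset.prod_mul_distrib]
  refine Finset.prod_le_prod (fun k _ => Real.sqrt_nonneg _) fun k _ => ?_
  have hck := hc k
  have hζk := hζ k
  rw [← Real.sqrt_mul (by norm_num)]
  apply Real.sqrt_le_sqrt
  rw [mul_div_assoc', div_le_div_iff₀ hck (by positivity)]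
  nlinarith [Real.pi_pos, h k]

variable [DecidableEq ι]

theorem commute_diagonal_comp {A : Matrix ι ι ℝ} {d : ι → ℝ}
    (hc : Commute (Matrix.diagonal c) A) (hd : Commute (Matrix.diagonal d) A) (F : ℝ → ℝ → ℝ) :
    Commute (Matrix.diagonal fun k => F (c k) (d k)) A := by
  have eq_of_ne {e : ι → ℝ} (he : Commute (Matrix.diagonal e) A) {k l : ι} (hkl : A k l ≠ 0) :
      e k = e l := by
    have := congrFun (congrFun he.eq k) l
    rw [Matrix.diagonal_mul, Matrix.mul_diagonal, mul_comm] at this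
    exact mul_left_cancel₀ hkl this
  ext k l
  rw [Matrix.diagonal_mul, Matrix.mul_diagonal, mul_comm]
  by_cases hkl : A k l = 0
  · simp [hkl]
  · rw [eq_of_ne hc hkl, eq_of_ne hd hkl]

theorem sum_mul_mulVec_sq {d : ι → ℝ} (hd : Zᵀ * Z = Matrix.diagonal fun k => ζ k ^ 2)
    (hdZ : Commute (Matrix.diagonal d) Z) (σ : ι → ℝ) :
    ∑ k, d k * (Z *ᵥ σ) k ^ 2 = ∑ k, d k * (ζ k ^ 2 * σ k ^ 2) := by
  calc ∑ k, d k * (Z *ᵥ σ) k ^ 2 = (Z *ᵥ σ) ⬝ᵥ (Matrix.diagonal d *ᵥ (Z *ᵥ σ)) :=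
        Finset.sum_congr rfl fun k _ => by rw [Matrix.mulVec_diagonal]; ring
    _ = σ ⬝ᵥ ((Zᵀ * Z) *ᵥ (Matrix.diagonal d *ᵥ σ)) := by
        rw [Matrix.mulVec_mulVec, hdZ.eq, ← Matrix.mulVec_mulVec, ← Matrix.mulVec_mulVec,
          Matrix.dotProduct_mulVec σ, Matrix.vecMul_transpose]
    _ = ∑ k, d k * (ζ k ^ 2 * σ k ^ 2) := by
        rw [hd]
        exact Finset.sum_congr rfl fun k _ => by
          rw [Matrix.mulVec_diagonal, Matrix.mulVec_diagonal]; ring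

theorem sum_completed_square (hZ : Zᵀ = -Z)
    (hd : Zᵀ * Z = Matrix.diagonal fun k => ζ k ^ 2) (hc : ∀ k, c k ≠ 0)
    (hcZ : Commute (Matrix.diagonal c) Z) (σ : ι → ℝ) :
    ∑ k, (-2 * c k * σ k + Complex.I / 2 * (Z *ᵥ σ) k : ℂ) ^ 2 / (4 * ((2 * c k : ℝ) : ℂ)) =
      ((∑ k, c k * σ k ^ 2 - ∑ k, nextCoeff ζ c k * σ k ^ 2 : ℝ) : ℂ) := by
  have hcross : ∑ k, σ k * (Z *ᵥ σ) k = 0 := matForm_self hZ σ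
  have hdiag := sum_mul_mulVec_sq hd
    (commute_diagonal_comp hcZ hcZ fun x _ => (32 * x)⁻¹) σ
  have hterm (k : ι) : (-2 * c k * σ k + Complex.I / 2 * (Z *ᵥ σ) k : ℂ) ^ 2 /
      (4 * ((2 * c k : ℝ) : ℂ)) = ((c k * σ k ^ 2 / 2 - (32 * c k)⁻¹ * (Z *ᵥ σ) k ^ 2 : ℝ) : ℂ) -
        Complex.I / 4 * ((σ k * (Z *ᵥ σ) k : ℝ) : ℂ) := by
    have : (c k : ℂ) ≠ 0 := by exact_mod_cast hc k
    push_cast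
    field_simp
    ring_nf
    simp only [Complex.I_sq]
    ring
  simp only [hterm, Finset.sum_sub_distrib, ← Finset.mul_sum, ← Complex.ofReal_sum, hcross,
    Complex.ofReal_zero, mul_zero, sub_zero, hdiag]
  rw [← Finset.sum_sub_distrib, ← Finset.sum_sub_distrib]
  congr 1
  exact Finset.sum_congr rfl fun k _ => by rw [nextCoeff]; ring

theorem integral_twisted_gauss (hZ : Zᵀ = -Z)
    (hd : Zᵀ * Z = Matrix.diagonal fun k => ζ k ^ 2) (hc : ∀ k, 0 < c k)
    (hcZ : Commute (Matrix.diagonal c) Z) (σ : ι → ℝ) :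
    ∫ x : ι → ℝ, ((Real.exp (-∑ k, c k * x k ^ 2) * Real.exp (-∑ k, c k * (x + σ) k ^ 2) : ℝ) : ℂ)
        * Complex.exp (Complex.I / 2 * (matForm Z x σ : ℝ)) =
      ((∏ k, √(Real.pi / (2 * c k)) : ℝ) : ℂ) *
        (Real.exp (-∑ k, nextCoeff ζ c k * σ k ^ 2) : ℂ) := by
  have hexp (x : ι → ℝ) :
      ((Real.exp (-∑ k, c k * x k ^ 2) * Real.exp (-∑ k, c k * (x + σ) k ^ 2) : ℝ) : ℂ)
        * Complex.exp (Complex.I / 2 * (matForm Z x σ : ℝ)) =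
      Complex.exp (-((∑ k, c k * σ k ^ 2 : ℝ) : ℂ)) *
        Complex.exp (-∑ k, ((2 * c k : ℝ) : ℂ) * (x k : ℂ) ^ 2 +
          ∑ k, (-2 * c k * σ k + Complex.I / 2 * (Z *ᵥ σ) k : ℂ) * x k) := by
    push_cast [matForm, dotProduct]
    simp only [← Complex.exp_add, Finset.mul_sum, ← Finset.sum_neg_distrib,
      ← Finset.sum_add_distrib, Pi.add_apply]
    congr 1
    exact Finset.sum_congr rfl fun k _ => by push_cast; ring
  simp only [hexp]
  rw [integral_const_mul, GaussianFourier.integral_cexp_neg_sum_mul_add (by simpa using hc),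
    Finset.prod_mul_distrib, ← Complex.exp_sum,
    sum_completed_square hZ hd (fun k => (hc k).ne') hcZ, mul_left_comm, ← Complex.exp_add]
  congr 1
  · rw [Complex.ofReal_prod]
    refine Finset.prod_congr rfl fun k _ => ?_
    rw [Real.sqrt_eq_rpow, Complex.ofReal_cpow (by have := hc k; positivity)]
    push_cast
    rfl
  · push_cast
    ring_nf

theorem integral_twisted_conv (hZ : Zᵀ = -Z)
    (hd : Zᵀ * Z = Matrix.diagonal fun k => ζ k ^ 2) (hc : ∀ k, 0 < c k)
    (hcZ : Commute (Matrix.diagonal c) Z)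
    (hint : Integrable (fun p : (ι → ℝ) × (ι → ℝ) =>
      ((Real.exp (-∑ k, c k * p.1 k ^ 2) * Real.exp (-∑ k, c k * p.2 k ^ 2) : ℝ) : ℂ) *
      (Complex.exp (Complex.I / 2 * (matForm Z p.1 p.2 : ℝ)) * h (p.2 - p.1)))
      (volume.prod volume)) :
    ∫ p : (ι → ℝ) × (ι → ℝ),
      ((Real.exp (-∑ k, c k * p.1 k ^ 2) * Real.exp (-∑ k, c k * p.2 k ^ 2) : ℝ) : ℂ) *
      (Complex.exp (Complex.I / 2 * (matForm Z p.1 p.2 : ℝ)) * h (p.2 - p.1))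
      ∂(volume.prod volume) =
      ((∏ k, √(Real.pi / (2 * c k)) : ℝ) : ℂ) * gaussAvg (nextCoeff ζ c) h := by
  have hshear := measurePreserving_prod_add (volume : Measure (ι → ℝ)) (volume : Measure (ι → ℝ))
  have hemb : MeasurableEmbedding fun z : (ι → ℝ) × (ι → ℝ) => (z.1, z.1 + z.2) :=
    (MeasurableEquiv.shearAddRight (ι → ℝ)).measurableEmbedding
  rw [← hshear.integral_comp hemb]
  refine (integral_prod_symm _ ((hshear.integrable_comp_emb hemb).2 hint)).trans ?_
  rw [gaussAvg, ← integral_const_mul]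
  refine integral_congr_ae (.of_forall fun σ => ?_)
  simp only [Function.comp_apply, add_sub_cancel_left]
  rw [← mul_assoc, ← integral_twisted_gauss hZ hd hc hcZ σ, ← integral_mul_const]
  refine integral_congr_ae (.of_forall fun x => ?_)
  have hform : matForm Z x (x + σ) = matForm Z x σ := by
    have h0 := matForm_self hZ x
    simp only [matForm, Matrix.mulVec_add, dotProduct_add] at h0 ⊢
    rw [h0, zero_add]
  simp only [hform]
  ring

theorem IsTwistedPosDef.norm_gaussAvg_sq_le (hh : IsTwistedPosDef (matForm Z) h)
    (hcont : Continuous h) (hZ : Zᵀ = -Z)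
    (hd : Zᵀ * Z = Matrix.diagonal fun k => ζ k ^ 2) (hc : ∀ k, 0 < c k)
    (hcZ : Commute (Matrix.diagonal c) Z) :
    ‖gaussAvg c h‖ ^ 2 ≤
      (h 0).re * ((∏ k, √(Real.pi / (2 * c k))) * ‖gaussAvg (nextCoeff ζ c) h‖) := by
  have hGc : Continuous fun p : (ι → ℝ) × (ι → ℝ) =>
      Complex.exp (Complex.I / 2 * (matForm Z p.1 p.2 : ℝ)) * h (p.2 - p.1) := by
    have := continuous_matForm Z
    fun_prop
  have hdiag (x : ι → ℝ) : (Complex.exp (Complex.I / 2 * (matForm Z x x : ℝ)) * h (x - x)).re =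
      (h 0).re := by
    simp [matForm_self hZ]
  have hgauss := integrable_gauss hc
  have hconv := integral_twisted_conv hZ hd hc hcZ <|
    ((hgauss.mul_prod hgauss).ofReal (𝕜 := ℂ)).mul_bdd (c := (h 0).re) hGc.aestronglyMeasurable
      (.of_forall fun p => norm_apply_le_of_posSemidef hh hdiag p.1 p.2)
  have hCS := norm_integral_sq_le_of_posSemidef (μ := (volume : Measure (ι → ℝ))) hh hGc hdiag
    hgauss 0
  simp only [Matrix.of_apply] at hCS
  rw [hconv, norm_mul, Complex.norm_real, Real.norm_of_nonneg
    (Finset.prod_nonneg fun k _ => Real.sqrt_nonneg _)] at hCS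
  simpa [gaussAvg, matForm] using hCS

theorem le_one_of_sq_le_iterate {X : Type*} {s : Set X} {T : X → X} {R : X → ℝ} {B : ℝ}
    (hT : Set.MapsTo T s s) (hR : ∀ x ∈ s, R x ^ 2 ≤ R (T x)) (hB : ∀ x ∈ s, R (T x) ≤ B)
    {x : X} (hx : x ∈ s) : R x ≤ 1 := by
  have hpow (m : ℕ) : ∀ x ∈ s, R x ^ 2 ^ (m + 1) ≤ B := by
    induction m with
    | zero => exact fun x hx => by simpa using (hR x hx).trans (hB x hx)
    | succ m ih =>
      intro x hx
      rw [pow_succ', pow_mul]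
      exact (pow_le_pow_left₀ (sq_nonneg _) (hR x hx) _).trans (ih _ (hT hx))
  by_contra! hlt
  obtain ⟨m, hm⟩ := pow_unbounded_of_one_lt B hlt
  have hle : R x ^ m ≤ R x ^ 2 ^ (m + 1) :=
    pow_le_pow_right₀ hlt.le (m.lt_succ_self.le.trans Nat.lt_two_pow_self.le)
  linarith [hpow m x hx]

theorem IsTwistedPosDef.norm_gaussAvg_le_gaussBound (hh : IsTwistedPosDef (matForm Z) h)
    (hcont : Continuous h) (hZ : Zᵀ = -Z) (hζ : ∀ k, 0 ≤ ζ k)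
    (hd : Zᵀ * Z = Matrix.diagonal fun k => ζ k ^ 2) (hζZ : Commute (Matrix.diagonal ζ) Z)
    (hc : ∀ k, 0 < c k) (hcZ : Commute (Matrix.diagonal c) Z) :
    ‖gaussAvg c h‖ ≤ (h 0).re * gaussBound ζ c := by
  have htriv {c : ι → ℝ} (hc : ∀ k, 0 < c k) := norm_gaussAvg_le hc (hh.norm_apply_le hZ)
  set M := (h 0).re
  rcases (hh.zero_re_nonneg (matForm_self hZ) : 0 ≤ M).eq_or_lt with hM | hM
  · simpa [show M = 0 from hM.symm] using htriv hc
  rw [← div_le_one (mul_pos hM (gaussBound_pos hζ hc))]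
  refine le_one_of_sq_le_iterate (s := {c | (∀ k, 0 < c k) ∧ Commute (Matrix.diagonal c) Z})
    (T := nextCoeff ζ) (R := fun c => ‖gaussAvg c h‖ / (M * gaussBound ζ c))
    (B := ∏ _k : ι, √2) ?_ ?_ ?_ ⟨hc, hcZ⟩
  · exact fun c hc => ⟨nextCoeff_pos hc.1,
      commute_diagonal_comp hc.2 hζZ fun x y => x / 2 + y ^ 2 / (32 * x)⟩
  · rintro c ⟨hc, hcZ⟩
    have hpos := gaussBound_pos hζ hc
    have hpos' := gaussBound_pos hζ (nextCoeff_pos (ζ := ζ) hc)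
    rw [div_pow, div_le_div_iff₀ (by positivity) (by positivity), mul_pow,
      ← prod_mul_gaussBound_nextCoeff hζ hc]
    calc ‖gaussAvg c h‖ ^ 2 * (M * gaussBound ζ (nextCoeff ζ c))
        ≤ (M * ((∏ k, √(Real.pi / (2 * c k))) * ‖gaussAvg (nextCoeff ζ c) h‖)) *
          (M * gaussBound ζ (nextCoeff ζ c)) := by
          gcongr
          exact hh.norm_gaussAvg_sq_le hcont hZ hd hc hcZ
      _ = _ := by ring
  · rintro c ⟨hc, -⟩
    have hc' := nextCoeff_pos (ζ := ζ) hc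
    rw [div_le_iff₀ (mul_pos hM (gaussBound_pos hζ hc')), mul_left_comm]
    exact (htriv hc').trans (mul_le_mul_of_nonneg_left
      (prod_sqrt_le_gaussBound hζ hc' (le_nextCoeff hc)) hM.le)

theorem measurePreserving_mulVec {O : Matrix ι ι ℝ} (hO : Oᵀ * O = 1) :
    MeasurePreserving (fun ξ : ι → ℝ => O *ᵥ ξ) := by
  have hdet : O.det * O.det = 1 := by
    simpa [Matrix.det_mul] using congrArg Matrix.det hO
  refine ⟨by fun_prop, ?_⟩
  have := Real.map_matrix_volume_pi_eq_smul_volume_pi (left_ne_zero_of_mul_eq_one hdet)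
  change Measure.map (Matrix.toLin' O) volume = volume
  rcases mul_self_eq_one_iff.1 hdet with h | h <;> simpa [h] using this

theorem gaussAvg_comp_orthogonal {O : Matrix ι ι ℝ} (hO : Oᵀ * O = 1) (c : ℝ)
    (h : (ι → ℝ) → ℂ) :
    gaussAvg (fun _ => c) (fun ξ => h (O *ᵥ ξ)) = gaussAvg (fun _ => c) h := by
  have hinj : Function.Injective fun ξ : ι → ℝ => O *ᵥ ξ :=
    Matrix.mulVec_injective_of_isUnit (IsUnit.of_mul_eq_one_right Oᵀ hO)
  have hemb : MeasurableEmbedding fun ξ : ι → ℝ => O *ᵥ ξ :=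
    (by fun_prop : Continuous fun ξ : ι → ℝ => O *ᵥ ξ).measurableEmbedding hinj
  have hnorm (ξ : ι → ℝ) : ∑ k, (O *ᵥ ξ) k ^ 2 = ∑ k, ξ k ^ 2 := by
    simpa [matForm, hO, dotProduct, ← sq] using matForm_mulVec 1 O ξ ξ
  refine Eq.trans ?_ ((measurePreserving_mulVec hO).integral_comp hemb
    fun ξ => (Real.exp (-∑ k, c * ξ k ^ 2) : ℂ) * h ξ)
  simp only [gaussAvg, ← Finset.mul_sum, hnorm]

theorem exists_orthogonal_conj_sq_eq_diagonal (Z : Matrix ι ι ℝ) :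
    ∃ (O : Matrix ι ι ℝ) (ζ : ι → ℝ), Oᵀ * O = 1 ∧ (∀ k, 0 ≤ ζ k) ∧
      Oᵀ * (Zᵀ * Z) * O = Matrix.diagonal fun k => ζ k ^ 2 := by
  have hpos : (Zᵀ * Z).PosSemidef := by
    simpa using Matrix.posSemidef_conjTranspose_mul_self Z
  refine ⟨hpos.1.eigenvectorUnitary, fun k => √(hpos.1.eigenvalues k), ?_,
    fun k => Real.sqrt_nonneg _, ?_⟩
  · simpa [Matrix.star_eq_conjTranspose] using Unitary.coe_star_mul_self hpos.1.eigenvectorUnitary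
  · simp only [Real.sq_sqrt (hpos.eigenvalues_nonneg _)]
    simpa [Unitary.conjStarAlgAut_star_apply, Matrix.star_eq_conjTranspose, Function.comp_def]
      using hpos.1.conjStarAlgAut_star_eigenvectorUnitary

theorem prod_abs_eigenvalues_iMatrix (hZ : Zᵀ = -Z) {O : Matrix ι ι ℝ} (hO : Oᵀ * O = 1)
    (hζ : ∀ k, 0 ≤ ζ k)
    (hd : Oᵀ * (Zᵀ * Z) * O = Matrix.diagonal fun k => ζ k ^ 2) (f : ℝ → ℝ) :
    ∏ k, f |(iMatrix_isHermitian hZ).eigenvalues k| = ∏ k, f (ζ k) := by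
  have hchar : (Zᵀ * Z).charpoly = ∏ k, (Polynomial.X - Polynomial.C (ζ k ^ 2)) := by
    rw [← Matrix.charpoly_diagonal, ← hd, Matrix.charpoly_mul_comm (Oᵀ * (Zᵀ * Z)) O,
      ← Matrix.mul_assoc, mul_eq_one_comm.1 hO, Matrix.one_mul]
  have hsq : (iMatrix Z ^ 2).charpoly =
      ∏ k, (Polynomial.X - Polynomial.C (RCLike.ofReal (ζ k ^ 2) : ℂ)) := by
    have hmap : iMatrix Z ^ 2 = (Zᵀ * Z).map Complex.ofRealHom := by
      rw [iMatrix_sq, hZ, Matrix.neg_mul]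
      ext
      simp
    rw [hmap, Matrix.charpoly_map, hchar, Polynomial.map_prod]
    simp
  have h := prod_eigenvalues_sq_of_charpoly_eq (iMatrix_isHermitian hZ) hsq fun x => f (√x)
  simpa only [Real.sqrt_sq_eq_abs, Real.sqrt_sq (hζ _)] using h

theorem IsTwistedPosDef.norm_gaussAvg_const_le (hh : IsTwistedPosDef (matForm Z) h)
    (hcont : Continuous h) (hZ : Zᵀ = -Z) {c : ℝ} (hc : 0 < c) :
    ‖gaussAvg (fun _ => c) h‖ ≤ (h 0).re *
      ∏ k, √(Real.pi / (c + |(iMatrix_isHermitian hZ).eigenvalues k| / 4)) := by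
  obtain ⟨O, ζ, hO, hζ, hd⟩ := exists_orthogonal_conj_sq_eq_diagonal Z
  set Z' := Oᵀ * Z * O with hZ'
  have hZ't : Z'ᵀ = -Z' := by
    simp only [hZ', Matrix.transpose_mul, Matrix.transpose_transpose, hZ, Matrix.neg_mul,
      Matrix.mul_neg, Matrix.mul_assoc]
  have hd' : Z'ᵀ * Z' = Matrix.diagonal fun k => ζ k ^ 2 := by
    rw [← hd, hZ', Matrix.transpose_mul, Matrix.transpose_mul, Matrix.transpose_transpose]
    simp only [Matrix.mul_assoc]
    rw [← Matrix.mul_assoc O Oᵀ, mul_eq_one_comm.1 hO, Matrix.one_mul]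
  have hcomm : Commute (Matrix.diagonal fun k => ζ k ^ 2) Z' := by
    rw [← hd', hZ't, commute_iff_eq]
    simp only [Matrix.mul_neg, Matrix.neg_mul, Matrix.mul_assoc]
  have hζZ : Commute (Matrix.diagonal ζ) Z' := by
    simpa only [Real.sqrt_sq (hζ _)] using commute_diagonal_comp hcomm hcomm fun x _ => √x
  have hcZ : Commute (Matrix.diagonal fun _ => c) Z' := by
    rw [← Matrix.smul_one_eq_diagonal]
    exact (Commute.one_left Z').smul_left c
  have hh' : IsTwistedPosDef (matForm Z') fun ξ => h (O *ᵥ ξ) := by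
    simpa [matForm_mulVec] using hh.comp (Matrix.toLin' O).toAddMonoidHom
  rw [prod_abs_eigenvalues_iMatrix hZ hO hζ hd fun x => √(Real.pi / (c + x / 4)),
    ← gaussAvg_comp_orthogonal hO]
  simpa [gaussBound] using hh'.norm_gaussAvg_le_gaussBound (hcont.comp (by fun_prop)) hZ't hζ hd'
    hζZ (fun _ => hc) hcZ

end GaussianAverage

/-! ### The bound as a Gaussian average -/

section TwistMatrix

variable {n : ℕ} {S : Matrix (Fin 2 × Fin n) (Fin 2 × Fin n) ℝ} {l : ℝ}

/-- The twist `S⁻¹ Ω_J S⁻ᵀ - Ω_J / (1 + λ)` of the characteristic function of an LOCC branch on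
phase space; `i (1 + λ)` times it is the matrix whose eigenvalues are the `z_k`. -/
def twistMatrix (l : ℝ) (S : Matrix (Fin 2 × Fin n) (Fin 2 × Fin n) ℝ) (J : Finset (Fin n)) :
    Matrix (Fin 2 × Fin n) (Fin 2 × Fin n) ℝ :=
  congOmega S J - (1 + l)⁻¹ • omegaJ J

theorem twistMatrix_transpose (l : ℝ) (S : Matrix (Fin 2 × Fin n) (Fin 2 × Fin n) ℝ)
    (J : Finset (Fin n)) : (twistMatrix l S J)ᵀ = -twistMatrix l S J := by
  rw [twistMatrix, Matrix.transpose_sub, congOmega_transpose, Matrix.transpose_smul,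
    omegaJ_transpose, smul_neg]
  abel

theorem zMatrix_eq_smul_twistMatrix (hl : 0 < l) (J : Finset (Fin n)) :
    zMatrix l S J = (1 + l) • iMatrix (twistMatrix l S J) := by
  rw [zMatrix_eq_iMatrix, ← iMatrix_smul, twistMatrix, smul_sub, smul_smul,
    mul_inv_cancel₀ (by positivity), one_smul]

theorem prod_sqrt_eq_bound (hl : 0 < l) (J : Finset (Fin n)) :
    ((2 * Real.pi) ^ n)⁻¹ * ∏ k, √(Real.pi / ((2 + l) / (4 * (1 + l)) +
      |(iMatrix_isHermitian (twistMatrix_transpose l S J)).eigenvalues k| / 4)) = bound l S J := by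
  set ζ := (iMatrix_isHermitian (twistMatrix_transpose l S J)).eigenvalues
  have hz : ∏ k, √(2 + l + |(zMatrix_isHermitian l S J).eigenvalues k|) =
      ∏ k, √(2 + l + |(1 + l) * ζ k|) := by
    simp only [zMatrix_eq_smul_twistMatrix hl]
    exact prod_eigenvalues_smul _ _ fun x => √(2 + l + |x|)
  have hsqrt (k) : √(Real.pi / ((2 + l) / (4 * (1 + l)) + |ζ k| / 4)) =
      √(4 * Real.pi * (1 + l)) / √(2 + l + |(1 + l) * ζ k|) := by
    rw [← Real.sqrt_div (by positivity), abs_mul, abs_of_pos (by positivity : 0 < 1 + l)]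
    congr 1
    field_simp
  have hconst : ((2 * Real.pi) ^ n)⁻¹ * ∏ _k : Fin 2 × Fin n, √(4 * Real.pi * (1 + l)) =
      2 ^ n * (1 + l) ^ n := by
    rw [Finset.prod_const, Finset.card_univ, Fintype.card_prod, Fintype.card_fin, Fintype.card_fin,
      pow_mul, Real.sq_sqrt (by positivity), ← inv_pow, ← mul_pow, ← mul_pow]
    congr 1
    field_simp
    norm_num
  simp only [hsqrt]
  rw [Finset.prod_div_distrib, ← mul_div_assoc, hconst, bound, hz]

end TwistMatrix

/-! ### Weyl operators -/

section PhaseShift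

theorem norm_exp_mul_I_mul (x : ℝ) (z : ℂ) : ‖Complex.exp (x * Complex.I) * z‖ = ‖z‖ := by
  rw [norm_mul, Complex.norm_exp_ofReal_mul_I, one_mul]

variable {V : Type*} [MeasurableSpace V] {μ : Measure V} {θ θ' θ'' : V → ℝ}

theorem aestronglyMeasurable_exp_mul_I (hθ : Measurable θ) :
    AEStronglyMeasurable (fun q => Complex.exp (θ q * Complex.I)) μ :=
  (by fun_prop : Measurable fun q => Complex.exp (θ q * Complex.I)).aestronglyMeasurable

variable [AddCommGroup V] [MeasurableAdd₂ V] [μ.IsAddRightInvariant]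

theorem ae_add_right (b : V) {p : V → Prop} (h : ∀ᵐ q ∂μ, p q) : ∀ᵐ q ∂μ, p (q + b) :=
  (measurePreserving_add_right μ b).quasiMeasurePreserving.ae h

theorem memLp_phaseShift (hθ : Measurable θ) (b : V) (f : Lp ℂ 2 μ) :
    MemLp (fun q => Complex.exp (θ q * Complex.I) * (f : V → ℂ) (q + b)) 2 μ := by
  have hshift := (Lp.memLp f).comp_measurePreserving (measurePreserving_add_right μ b)
  exact (memLp_congr_norm ((aestronglyMeasurable_exp_mul_I hθ).mul hshift.1) hshift.1
    (.of_forall fun q => norm_exp_mul_I_mul _ _)).2 hshift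

/-- The isometry `(T f)(q) = e^{i θ(q)} f(q + b)` of `L²`, the common form of the Weyl operators
of one and of several modes. -/
def phaseShift (θ : V → ℝ) (hθ : Measurable θ) (b : V) : Lp ℂ 2 μ →ₗᵢ[ℂ] Lp ℂ 2 μ where
  toFun f := (memLp_phaseShift hθ b f).toLp
  map_add' f g := by
    rw [← MemLp.toLp_add, MemLp.toLp_eq_toLp_iff]
    filter_upwards [ae_add_right b (Lp.coeFn_add f g)] with q hq
    simp only [Pi.add_apply] at hq ⊢
    rw [hq, mul_add]
  map_smul' c f := by
    rw [RingHom.id_apply, ← MemLp.toLp_const_smul, MemLp.toLp_eq_toLp_iff]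
    filter_upwards [ae_add_right b (Lp.coeFn_smul c f)] with q hq
    simp only [Pi.smul_apply, smul_eq_mul] at hq ⊢
    rw [hq, mul_left_comm]
  norm_map' f := by
    change ‖(memLp_phaseShift hθ b f).toLp‖ = ‖f‖
    rw [Lp.norm_toLp, Lp.norm_def, ← eLpNorm_comp_measurePreserving
      (Lp.aestronglyMeasurable f) (measurePreserving_add_right μ b)]
    exact congrArg _ (eLpNorm_congr_norm_ae (.of_forall fun q => norm_exp_mul_I_mul _ _))

variable (hθ : Measurable θ) (hθ' : Measurable θ') (hθ'' : Measurable θ'') (b b' : V)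

theorem coeFn_phaseShift (f : Lp ℂ 2 μ) :
    phaseShift θ hθ b f =ᵐ[μ] fun q => Complex.exp (θ q * Complex.I) * (f : V → ℂ) (q + b) :=
  (memLp_phaseShift hθ b f).coeFn_toLp

theorem phaseShift_phaseShift (c : ℝ) (h : ∀ q, θ q + θ' (q + b) = c + θ'' q) (f : Lp ℂ 2 μ) :
    phaseShift θ hθ b (phaseShift θ' hθ' b' f) =
      Complex.exp (c * Complex.I) • phaseShift θ'' hθ'' (b + b') f := by
  ext1
  filter_upwards [coeFn_phaseShift hθ b (phaseShift θ' hθ' b' f),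
    ae_add_right b (coeFn_phaseShift hθ' b' f),
    Lp.coeFn_smul (Complex.exp (c * Complex.I)) (phaseShift θ'' hθ'' (b + b') f),
    coeFn_phaseShift hθ'' (b + b') f] with q houter hinner hsmul hcomp
  rw [houter, hinner, hsmul, Pi.smul_apply, hcomp, smul_eq_mul, ← mul_assoc, ← mul_assoc,
    ← Complex.exp_add, ← Complex.exp_add, ← add_mul, ← add_mul, add_assoc q, ← Complex.ofReal_add,
    ← Complex.ofReal_add, h]

theorem inner_phaseShift_zero (f : Lp ℂ 2 μ) :
    inner ℂ (phaseShift θ hθ 0 f) (phaseShift θ' hθ' 0 f) =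
      ∫ q, Complex.exp ((θ' q - θ q : ℝ) * Complex.I) * ((‖(f : V → ℂ) q‖ ^ 2 : ℝ) : ℂ) ∂μ := by
  rw [L2.inner_def]
  refine integral_congr_ae ?_
  filter_upwards [coeFn_phaseShift hθ 0 f, coeFn_phaseShift hθ' 0 f] with q hf hf'
  rw [hf, hf', add_zero, RCLike.inner_apply, map_mul, ← Complex.exp_conj, map_mul, Complex.conj_I,
    Complex.conj_ofReal, mul_mul_mul_comm, ← Complex.exp_add, Complex.mul_conj']
  push_cast
  ring_nf

theorem continuous_phaseShift_zero {P : Type*} [TopologicalSpace P] [FirstCountableTopology P]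
    {Θ : P → V → ℝ} (hΘ : ∀ p, Measurable (Θ p)) (hc : ∀ q, Continuous fun p => Θ p q)
    (f : Lp ℂ 2 μ) : Continuous fun p => phaseShift (Θ p) (hΘ p) 0 f := by
  refine continuous_of_norm_eq_of_inner (𝕜 := ℂ) (M := ‖f‖)
    (fun p => LinearIsometry.norm_map _ _) fun p₀ => ?_
  simp only [inner_phaseShift_zero]
  have hint : Integrable (fun q => ‖(f : V → ℂ) q‖ ^ 2) μ :=
    (memLp_two_iff_integrable_sq_norm (Lp.aestronglyMeasurable f)).1 (Lp.memLp f)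
  refine continuousAt_of_dominated (bound := fun q => ‖(f : V → ℂ) q‖ ^ 2)
    (.of_forall fun p => (aestronglyMeasurable_exp_mul_I ((hΘ p).sub (hΘ p₀))).mul
      hint.ofReal.aestronglyMeasurable)
    (.of_forall fun p => .of_forall fun q => ?_) hint (.of_forall fun q => ?_)
  · rw [norm_exp_mul_I_mul, Complex.norm_real, Real.norm_of_nonneg (by positivity)]
  · have := hc q
    fun_prop

end PhaseShift

theorem continuous_linearIsometry_apply {𝕜 P E F : Type*} [Semiring 𝕜] [TopologicalSpace P]
    [SeminormedAddCommGroup E] [Module 𝕜 E] [SeminormedAddCommGroup F] [Module 𝕜 F]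
    {T : P → E →ₗᵢ[𝕜] F} {x : P → E} (hT : ∀ v, Continuous fun p => T p v) (hx : Continuous x) :
    Continuous fun p => T p (x p) := by
  refine continuous_iff_continuousAt.2 fun p₀ => tendsto_iff_norm_sub_tendsto_zero.2 ?_
  have h := (tendsto_iff_norm_sub_tendsto_zero.1 (hx.tendsto p₀)).add
    (tendsto_iff_norm_sub_tendsto_zero.1 ((hT (x p₀)).tendsto p₀))
  rw [add_zero] at h
  refine squeeze_zero (fun _ => norm_nonneg _) (fun p => ?_) h
  rw [← (T p).norm_map (x p - x p₀), map_sub]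
  exact norm_sub_le_norm_sub_add_norm_sub _ _ _

/-- The Weyl operator `e^{i (a x + b p)}` of one mode, `ξ = (a, b)`. -/
def weylMode (ξ : ℝ × ℝ) : Mode →ₗᵢ[ℂ] Mode :=
  phaseShift (fun q => ξ.1 * q + ξ.1 * ξ.2 / 2) (by fun_prop) ξ.2

/-- The symplectic form of one mode. -/
def sympl (ξ η : ℝ × ℝ) : ℝ := ξ.1 * η.2 - η.1 * ξ.2

theorem weylMode_weylMode (ξ η : ℝ × ℝ) (f : Mode) :
    weylMode ξ (weylMode η f) = Complex.exp (((-sympl ξ η / 2 : ℝ) : ℂ) * Complex.I) •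
      weylMode (ξ + η) f := by
  refine phaseShift_phaseShift _ _ _ _ _ _ (fun q => ?_) f
  simp only [sympl, Prod.fst_add, Prod.snd_add]
  ring

theorem inner_weylMode_weylMode (ξ η : ℝ × ℝ) (f g : Mode) :
    inner ℂ (weylMode ξ f) (weylMode η g) =
      Complex.exp (Complex.I / 2 * (sympl ξ η : ℝ)) * inner ℂ f (weylMode (η - ξ) g) := by
  have hs : sympl ξ (η - ξ) = sympl ξ η := by
    simp only [sympl, Prod.fst_sub, Prod.snd_sub]
    ring
  have hη : weylMode η g =
      Complex.exp (Complex.I / 2 * (sympl ξ η : ℝ)) • weylMode ξ (weylMode (η - ξ) g) := by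
    rw [weylMode_weylMode, add_sub_cancel, hs, smul_smul, ← Complex.exp_add]
    push_cast
    ring_nf
    rw [Complex.exp_zero, one_smul]
  rw [hη, inner_smul_right, LinearIsometry.inner_map_map]

theorem continuous_phaseShift_const (f : Mode) :
    Continuous fun b : ℝ => phaseShift (fun _ : ℝ => 0) measurable_const b f := by
  have hcomp : Continuous fun b : ℝ => Lp.compMeasurePreserving (fun q : ℝ => q + b)
      (measurePreserving_add_right volume b) f :=
    Continuous.compMeasurePreservingLp
      (g := fun b : ℝ => (⟨fun q => q + b, by fun_prop⟩ : C(ℝ, ℝ))) continuous_const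
      (ContinuousMap.continuous_of_continuous_uncurry _ (by
        simp only [Function.uncurry_def, ContinuousMap.coe_mk]
        fun_prop))
      (measurePreserving_add_right volume) (by simp)
  refine hcomp.congr fun b => ?_
  ext1
  filter_upwards [coeFn_phaseShift (μ := (volume : Measure ℝ)) (θ := fun _ => 0) measurable_const
    b f, Lp.coeFn_compMeasurePreserving f (measurePreserving_add_right volume b)]
    with q hshift hcomp
  rw [hshift, hcomp]
  simp

theorem continuous_weylMode (f : Mode) : Continuous fun ξ : ℝ × ℝ => weylMode ξ f := by
  have hΘ (ξ : ℝ × ℝ) : Measurable fun q : ℝ => ξ.1 * q + ξ.1 * ξ.2 / 2 := by fun_prop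
  have hfactor (ξ : ℝ × ℝ) : phaseShift _ (hΘ ξ) 0
      (phaseShift (fun _ : ℝ => 0) measurable_const ξ.2 f) = weylMode ξ f := by
    simpa [weylMode] using phaseShift_phaseShift (hΘ ξ) (measurable_const (a := (0 : ℝ))) (hΘ ξ)
      0 ξ.2 0 (fun q => by simp) f
  exact (continuous_linearIsometry_apply
    (continuous_phaseShift_zero hΘ fun q => by fun_prop)
    ((continuous_phaseShift_const f).comp continuous_snd)).congr hfactor

section Modes

variable {n : ℕ}

/-- The phase of the Weyl operator of `n` modes. -/
def weylPhase (ξ : Fin 2 × Fin n → ℝ) (q : Fin n → ℝ) : ℝ :=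
  ∑ j, (ξ (0, j) * q j + ξ (0, j) * ξ (1, j) / 2)

theorem measurable_weylPhase (ξ : Fin 2 × Fin n → ℝ) : Measurable (weylPhase ξ) := by
  unfold weylPhase
  fun_prop

/-- The Weyl operator `e^{i ∑ ξ_k r_k}` of `n` modes. -/
def weyl (ξ : Fin 2 × Fin n → ℝ) : Modes n →ₗᵢ[ℂ] Modes n :=
  phaseShift (weylPhase ξ) (measurable_weylPhase ξ) fun j => ξ (1, j)

theorem coeFn_weyl (ξ : Fin 2 × Fin n → ℝ) (f : Modes n) :
    weyl ξ f =ᵐ[volume] fun q => Complex.exp (weylPhase ξ q * Complex.I) *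
      (f : (Fin n → ℝ) → ℂ) (q + fun j => ξ (1, j)) :=
  coeFn_phaseShift _ _ f

theorem weyl_zero (f : Modes n) : weyl 0 f = f := by
  ext1
  filter_upwards [coeFn_weyl 0 f] with q hq
  rw [hq, show (fun j => (0 : Fin 2 × Fin n → ℝ) (1, j)) = 0 from rfl]
  simp [weylPhase]

theorem coeFn_tensor (f : Fin n → Mode) :
    tensor f =ᵐ[volume] fun q : Fin n → ℝ => ∏ j, (f j : ℝ → ℂ) (q j) :=
  (memLp_tensor f).coeFn_toLp

theorem inner_tensor (f g : Fin n → Mode) :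
    inner ℂ (tensor f) (tensor g) = ∏ j, inner ℂ (f j) (g j) := by
  simp only [L2.inner_def]
  rw [← integral_fintype_prod_volume_eq_prod
    (f := fun j (x : ℝ) => inner ℂ ((f j : ℝ → ℂ) x) ((g j : ℝ → ℂ) x))]
  refine integral_congr_ae ?_
  filter_upwards [coeFn_tensor f, coeFn_tensor g] with q hf hg
  rw [hf, hg]
  simp [RCLike.inner_apply, map_prod, Finset.prod_mul_distrib]

theorem norm_tensor (f : Fin n → Mode) : ‖tensor f‖ = ∏ j, ‖f j‖ := by
  have h := inner_tensor f f
  simp only [inner_self_eq_norm_sq_to_K] at h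
  rw [← sq_eq_sq₀ (norm_nonneg _) (Finset.prod_nonneg fun j _ => norm_nonneg _), ← Finset.prod_pow]
  exact_mod_cast h

theorem weyl_tensor (ξ : Fin 2 × Fin n → ℝ) (f : Fin n → Mode) :
    weyl ξ (tensor f) = tensor fun j => weylMode (ξ (0, j), ξ (1, j)) (f j) := by
  ext1
  have hmode : ∀ᵐ q : Fin n → ℝ, ∀ j, (weylMode (ξ (0, j), ξ (1, j)) (f j) : ℝ → ℂ) (q j) =
      Complex.exp ((ξ (0, j) * q j + ξ (0, j) * ξ (1, j) / 2 : ℝ) * Complex.I) *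
        (f j : ℝ → ℂ) (q j + ξ (1, j)) :=
    ae_all_iff.2 fun j => (Measure.quasiMeasurePreserving_eval
      (fun _ : Fin n => (volume : Measure ℝ)) j).ae (coeFn_phaseShift _ _ (f j))
  filter_upwards [coeFn_weyl ξ (tensor f),
    coeFn_tensor fun j => weylMode (ξ (0, j), ξ (1, j)) (f j),
    ae_add_right (fun j => ξ (1, j)) (coeFn_tensor f), hmode] with q hweyl htensor hf hmodes
  simp only [hweyl, htensor, hf, hmodes, weylPhase]
  rw [Finset.prod_mul_distrib, ← Complex.exp_sum, ← Finset.sum_mul]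
  push_cast
  rfl

end Modes

/-! ### Weyl operators on Schwartz functions -/

section WeylSchwartz

theorem hasTemperateGrowth_exp_mul_I :
    Function.HasTemperateGrowth fun x : ℝ => Complex.exp (x * Complex.I) := by
  have hderiv (m : ℕ) : iteratedDeriv m (fun x : ℝ => Complex.exp (x * Complex.I)) =
      fun x : ℝ => Complex.I ^ m * Complex.exp (x * Complex.I) := by
    induction m with
    | zero => simp
    | succ m ih =>
      rw [iteratedDeriv_succ, ih]
      funext x
      have h : HasDerivAt (fun x : ℝ => Complex.exp (x * Complex.I))
          (Complex.exp (x * Complex.I) * Complex.I) x := by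
        simpa using ((hasDerivAt_id (x : ℂ)).mul_const Complex.I).cexp.comp_ofReal
      rw [(h.const_mul _).deriv]
      ring
  refine ⟨(Complex.ofRealCLM.contDiff.mul contDiff_const).cexp, fun m => ⟨0, 1, fun x => ?_⟩⟩
  rw [norm_iteratedFDeriv_eq_norm_iteratedDeriv, hderiv]
  simp [Complex.norm_exp_ofReal_mul_I]

variable {n : ℕ}

theorem hasTemperateGrowth_exp_weylPhase (ξ : Fin 2 × Fin n → ℝ) :
    Function.HasTemperateGrowth fun q => Complex.exp (weylPhase ξ q * Complex.I) := by
  refine hasTemperateGrowth_exp_mul_I.comp (f := weylPhase ξ)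
    (Function.HasTemperateGrowth.sum fun j _ => ?_)
  exact ((Function.HasTemperateGrowth.const _).mul (ContinuousLinearMap.proj (R := ℝ)
    (φ := fun _ : Fin n => ℝ) j).hasTemperateGrowth).add (Function.HasTemperateGrowth.const _)

/-- The Weyl operator restricted to Schwartz functions, where it can be differentiated. -/
def weylSchwartz (ξ : Fin 2 × Fin n → ℝ) (φ : 𝓢(Fin n → ℝ, ℂ)) : 𝓢(Fin n → ℝ, ℂ) :=
  SchwartzMap.smulLeftCLM ℂ (fun q => Complex.exp (weylPhase ξ q * Complex.I))
    (SchwartzMap.compSubConstCLM ℂ (-fun j => ξ (1, j)) φ)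

theorem weylSchwartz_apply (ξ : Fin 2 × Fin n → ℝ) (φ : 𝓢(Fin n → ℝ, ℂ)) (q : Fin n → ℝ) :
    weylSchwartz ξ φ q =
      Complex.exp (weylPhase ξ q * Complex.I) * φ (q + fun j => ξ (1, j)) := by
  rw [weylSchwartz, smulLeftCLM_apply_apply (hasTemperateGrowth_exp_weylPhase ξ),
    compSubConstCLM_apply, sub_neg_eq_add, smul_eq_mul]

theorem toLp_weylSchwartz (ξ : Fin 2 × Fin n → ℝ) (φ : 𝓢(Fin n → ℝ, ℂ)) :
    (weylSchwartz ξ φ).toLp 2 volume = weyl ξ (φ.toLp 2 volume) := by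
  ext1
  filter_upwards [(weylSchwartz ξ φ).coeFn_toLp 2 volume, coeFn_weyl ξ (φ.toLp 2 volume),
    ae_add_right (fun j => ξ (1, j)) (φ.coeFn_toLp 2 volume)] with q hleft hright hφ
  rw [hleft, hright, hφ, weylSchwartz_apply]

theorem weylSchwartz_zero (φ : 𝓢(Fin n → ℝ, ℂ)) : weylSchwartz 0 φ = φ := by
  ext q
  rw [weylSchwartz_apply, show (fun j => (0 : Fin 2 × Fin n → ℝ) (1, j)) = 0 from rfl]
  simp [weylPhase]

theorem weylSchwartz_add_smul (ξ : Fin 2 × Fin n → ℝ) (s t : ℝ) (φ : 𝓢(Fin n → ℝ, ℂ)) :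
    weylSchwartz ((t + s) • ξ) φ = weylSchwartz (s • ξ) (weylSchwartz (t • ξ) φ) := by
  ext q
  simp only [weylSchwartz_apply]
  rw [← mul_assoc, ← Complex.exp_add, ← add_mul, ← Complex.ofReal_add]
  congr 1
  · congr 3
    simp only [weylPhase, ← Finset.sum_add_distrib, Pi.smul_apply, smul_eq_mul, Pi.add_apply]
    exact Finset.sum_congr rfl fun j _ => by ring
  · congr 1
    funext j
    simp only [Pi.smul_apply, smul_eq_mul, Pi.add_apply]
    ring

/-- The generator `i ∑ ξ_k r_k` of the Weyl operators. -/
def weylGen (ξ : Fin 2 × Fin n → ℝ) (φ : 𝓢(Fin n → ℝ, ℂ)) : 𝓢(Fin n → ℝ, ℂ) :=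
  ∑ k, (Complex.I * ξ k) • canonicalOp k φ

theorem weylGen_apply (ξ : Fin 2 × Fin n → ℝ) (φ : 𝓢(Fin n → ℝ, ℂ)) (q : Fin n → ℝ) :
    weylGen ξ φ q = Complex.I * ((∑ j, ξ (0, j) * q j : ℝ) : ℂ) * φ q +
      fderiv ℝ φ q (fun j => ξ (1, j)) := by
  have hbasis : (fun j => ξ (1, j)) = ∑ j, ξ (1, j) • (Pi.single j (1 : ℝ) : Fin n → ℝ) := by
    funext i
    simp [Finset.sum_apply, Pi.single_apply]
  have hcoord (j : Fin n) : Function.HasTemperateGrowth fun q : Fin n → ℝ => ((q j : ℝ) : ℂ) :=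
    (Complex.ofRealCLM.comp (ContinuousLinearMap.proj (R := ℝ)
      (φ := fun _ : Fin n => ℝ) j)).hasTemperateGrowth
  rw [weylGen, _root_.sum_apply, Fintype.sum_prod_type, Fin.sum_univ_two, hbasis, map_sum]
  simp only [_root_.smul_apply, canonicalOp, smul_eq_mul, if_true, one_ne_zero, if_false,
    map_smul, smulLeftCLM_apply_apply (hcoord _), lineDerivOp_apply_eq_fderiv, Complex.real_smul]
  congr 1
  · push_cast
    rw [Finset.mul_sum, Finset.sum_mul]
    exact Finset.sum_congr rfl fun j _ => by ring
  · refine Finset.sum_congr rfl fun j _ => ?_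
    linear_combination (-(ξ (1, j) : ℂ) * (fderiv ℝ φ q) (Pi.single j 1)) * Complex.I_sq

theorem hasDerivAt_weylPhase (ξ : Fin 2 × Fin n → ℝ) (q : Fin n → ℝ) (s : ℝ) :
    HasDerivAt (fun s : ℝ => weylPhase (s • ξ) q)
      (∑ j, ξ (0, j) * (q + s • fun j => ξ (1, j)) j) s := by
  refine HasDerivAt.fun_sum fun j _ => ?_
  simp only [Pi.smul_apply, smul_eq_mul, Pi.add_apply]
  have hpoly := ((hasDerivAt_id s).mul_const (ξ (0, j) * q j)).add
    ((hasDerivAt_pow 2 s).mul_const (ξ (0, j) * ξ (1, j) / 2))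
  refine (hpoly.congr_deriv ?_).congr_of_eventuallyEq (.of_forall fun t => ?_) <;>
  · simp
    ring

theorem hasDerivAt_weylSchwartz_apply (ξ : Fin 2 × Fin n → ℝ) (φ : 𝓢(Fin n → ℝ, ℂ))
    (q : Fin n → ℝ) (s : ℝ) :
    HasDerivAt (fun s : ℝ => weylSchwartz (s • ξ) φ q)
      (weylSchwartz (s • ξ) (weylGen ξ φ) q) s := by
  have hline : HasDerivAt (fun s : ℝ => q + s • fun j => ξ (1, j)) (fun j => ξ (1, j)) s := by
    simpa using ((hasDerivAt_id s).smul_const fun j => ξ (1, j)).const_add q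
  have hφ := (φ.hasFDerivAt (q + s • fun j => ξ (1, j))).comp_hasDerivAt s hline
  have hphase := ((hasDerivAt_weylPhase ξ q s).ofReal_comp.mul_const Complex.I).cexp
  simp only [weylSchwartz_apply]
  refine (hphase.mul hφ).congr_deriv ?_
  rw [weylGen_apply, show (fun j => (s • ξ) (1, j)) = s • fun j => ξ (1, j) from rfl,
    Function.comp_apply]
  ring

theorem exists_integrable_sq_bound_translates (ψ : 𝓢(Fin n → ℝ, ℂ)) (b : Fin n → ℝ) :
    ∃ β : (Fin n → ℝ) → ℝ, Integrable (fun q => β q ^ 2) ∧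
      ∀ q, ∀ r ∈ Set.Icc (-1 : ℝ) 1, ‖ψ (q + r • b)‖ ≤ β q := by
  set k := n + 1
  set C := 2 ^ k * (Finset.Iic (k, 0)).sup (fun m => SchwartzMap.seminorm ℝ m.1 m.2) ψ
  refine ⟨fun q => C * (1 + ‖b‖) ^ k / (1 + ‖q‖) ^ k, ?_, fun q r hr => ?_⟩
  · have hdecay : Integrable (fun q : Fin n → ℝ => (1 + ‖q‖) ^ (-((2 * k : ℕ) : ℝ))) := by
      apply integrable_one_add_norm
      simp only [Module.finrank_fintype_fun_eq_card, Fintype.card_fin]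
      exact_mod_cast (by omega : n < 2 * k)
    refine (hdecay.const_mul ((C * (1 + ‖b‖) ^ k) ^ 2)).congr (.of_forall fun q => ?_)
    simp only
    rw [Real.rpow_neg (by positivity), Real.rpow_natCast, div_pow, ← pow_mul, mul_comm k 2,
      div_eq_mul_inv]
  · have hC : (1 + ‖q + r • b‖) ^ k * ‖ψ (q + r • b)‖ ≤ C := by
      simpa using SchwartzMap.one_add_le_sup_seminorm_apply (𝕜 := ℝ) (m := (k, 0)) le_rfl le_rfl ψ
        (q + r • b)
    have htranslate : 1 + ‖q‖ ≤ (1 + ‖b‖) * (1 + ‖q + r • b‖) := by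
      have hrb : ‖r • b‖ ≤ ‖b‖ := by
        rw [norm_smul]
        exact mul_le_of_le_one_left (norm_nonneg b) (abs_le.2 hr)
      have hq := norm_sub_le (q + r • b) (r • b)
      rw [add_sub_cancel_right] at hq
      nlinarith [norm_nonneg b, norm_nonneg (q + r • b)]
    rw [le_div_iff₀ (by positivity)]
    calc ‖ψ (q + r • b)‖ * (1 + ‖q‖) ^ k
        ≤ ‖ψ (q + r • b)‖ * ((1 + ‖b‖) * (1 + ‖q + r • b‖)) ^ k := by gcongr
      _ = ((1 + ‖q + r • b‖) ^ k * ‖ψ (q + r • b)‖) * (1 + ‖b‖) ^ k := by rw [mul_pow]; ring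
      _ ≤ C * (1 + ‖b‖) ^ k := by gcongr

theorem tendsto_norm_toLp_zero {A : Type*} {F : Filter A} [F.IsCountablyGenerated]
    {D : A → 𝓢(Fin n → ℝ, ℂ)} {β : (Fin n → ℝ) → ℝ} (hβ : Integrable fun q => β q ^ 2)
    (hD : ∀ᶠ s in F, ∀ q, ‖D s q‖ ≤ β q) (hlim : ∀ q, Filter.Tendsto (fun s => D s q) F (nhds 0)) :
    Filter.Tendsto (fun s => ‖(D s).toLp 2 volume‖) F (nhds 0) := by
  have hint : Filter.Tendsto (fun s => ∫ q, ‖D s q‖ ^ 2) F (nhds (∫ _q : Fin n → ℝ, 0)) := by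
    refine tendsto_integral_filter_of_dominated_convergence (fun q => β q ^ 2)
      (.of_forall fun s => ((D s).continuous.norm.pow 2).aestronglyMeasurable) ?_ hβ
      (.of_forall fun q => by simpa using (hlim q).norm.pow 2)
    filter_upwards [hD] with s hs
    refine .of_forall fun q => ?_
    rw [Real.norm_of_nonneg (by positivity)]
    exact pow_le_pow_left₀ (norm_nonneg _) (hs q) 2
  have hnorm (s : A) : ‖(D s).toLp 2 volume‖ = √(∫ q, ‖D s q‖ ^ 2) := by
    rw [SchwartzMap.norm_toLp' two_ne_zero (by simp), Real.sqrt_eq_rpow]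
    simp
  simpa [hnorm] using hint.sqrt

theorem norm_weylSchwartz_sub_le {ξ : Fin 2 × Fin n → ℝ} {φ : 𝓢(Fin n → ℝ, ℂ)} {q : Fin n → ℝ}
    {β s : ℝ} (hβ : ∀ r ∈ Set.Icc (-1 : ℝ) 1, ‖weylGen ξ φ (q + r • fun j => ξ (1, j))‖ ≤ β)
    (hs : s ∈ Set.Icc (-1 : ℝ) 1) : ‖weylSchwartz (s • ξ) φ q - φ q‖ ≤ β * ‖s‖ := by
  have h := (convex_Icc (-1 : ℝ) 1).norm_image_sub_le_of_norm_hasDerivWithin_le (C := β)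
    (fun r _ => (hasDerivAt_weylSchwartz_apply ξ φ q r).hasDerivWithinAt)
    (fun r hr => by rw [weylSchwartz_apply, norm_exp_mul_I_mul]; exact hβ r hr)
    (by norm_num : (0 : ℝ) ∈ Set.Icc (-1 : ℝ) 1) hs
  rwa [zero_smul, weylSchwartz_zero, sub_zero] at h

theorem hasDerivAt_toLp_weylSchwartz_zero (ξ : Fin 2 × Fin n → ℝ) (φ : 𝓢(Fin n → ℝ, ℂ)) :
    HasDerivAt (fun s : ℝ => (weylSchwartz (s • ξ) φ).toLp 2 volume)
      ((weylGen ξ φ).toLp 2 volume) 0 := by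
  obtain ⟨β, hβ, hβ'⟩ := exists_integrable_sq_bound_translates (weylGen ξ φ) fun j => ξ (1, j)
  set D : ℝ → 𝓢(Fin n → ℝ, ℂ) := fun s =>
    ((s⁻¹ : ℝ) : ℂ) • (weylSchwartz (s • ξ) φ - φ) - weylGen ξ φ with hD
  have hslope (s : ℝ) : slope (fun s : ℝ => (weylSchwartz (s • ξ) φ).toLp 2 volume) 0 s -
      (weylGen ξ φ).toLp 2 volume = (D s).toLp 2 volume := by
    rw [slope_def_module, sub_zero, zero_smul, weylSchwartz_zero, hD]
    change _ = SchwartzMap.toLpCLM ℂ ℂ 2 volume _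
    rw [map_sub, map_smul, map_sub]
    rfl
  have hbound : ∀ᶠ s in nhdsWithin (0 : ℝ) {0}ᶜ, ∀ q, ‖D s q‖ ≤ 2 * β q := by
    filter_upwards [mem_nhdsWithin_of_mem_nhds (Icc_mem_nhds neg_one_lt_zero one_pos),
      self_mem_nhdsWithin] with s hs hs0 q
    have hquot : ‖s‖⁻¹ * ‖weylSchwartz (s • ξ) φ q - φ q‖ ≤ β q := by
      rw [inv_mul_le_iff₀ (norm_pos_iff.2 hs0), mul_comm]
      exact norm_weylSchwartz_sub_le (hβ' q) hs
    have hgen : ‖weylGen ξ φ q‖ ≤ β q := by simpa using hβ' q 0 (by norm_num)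
    simp only [hD, _root_.sub_apply, _root_.smul_apply, smul_eq_mul]
    refine (norm_sub_le _ _).trans ?_
    rw [norm_mul, Complex.norm_real, norm_inv]
    linarith
  have hptw (q : Fin n → ℝ) : Filter.Tendsto (fun s => D s q) (nhdsWithin 0 {0}ᶜ) (nhds 0) := by
    have h := (hasDerivAt_iff_tendsto_slope.1 (hasDerivAt_weylSchwartz_apply ξ φ q 0)).sub_const
      (weylGen ξ φ q)
    rw [zero_smul, weylSchwartz_zero, sub_self] at h
    refine h.congr fun s => ?_
    simp only [slope_def_module, sub_zero, zero_smul, weylSchwartz_zero, hD, _root_.sub_apply,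
      _root_.smul_apply, smul_eq_mul, Complex.real_smul]
  rw [hasDerivAt_iff_tendsto_slope, tendsto_iff_norm_sub_tendsto_zero]
  simp only [hslope]
  exact tendsto_norm_toLp_zero ((hβ.const_mul 4).congr (.of_forall fun q => by simp only; ring))
    hbound hptw

theorem hasDerivAt_toLp_weylSchwartz (ξ : Fin 2 × Fin n → ℝ) (φ : 𝓢(Fin n → ℝ, ℂ)) (t : ℝ) :
    HasDerivAt (fun s : ℝ => (weylSchwartz (s • ξ) φ).toLp 2 volume)
      ((weylGen ξ (weylSchwartz (t • ξ) φ)).toLp 2 volume) t := by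
  have h := hasDerivAt_toLp_weylSchwartz_zero ξ (weylSchwartz (t • ξ) φ)
  simp only [← weylSchwartz_add_smul] at h
  rw [← neg_add_cancel t] at h
  simpa using h.comp_const_add (-t) t

end WeylSchwartz

/-! ### Gaussian unitaries -/

section GaussianUnitary

variable {n : ℕ} {S : Matrix (Fin 2 × Fin n) (Fin 2 × Fin n) ℝ} {U : Modes n ≃ₗᵢ[ℂ] Modes n}

theorem toLp_weylGen (ξ : Fin 2 × Fin n → ℝ) (φ : 𝓢(Fin n → ℝ, ℂ)) :
    (weylGen ξ φ).toLp 2 volume = ∑ k, (Complex.I * ξ k) • (canonicalOp k φ).toLp 2 volume := by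
  change SchwartzMap.toLpCLM ℂ ℂ 2 volume _ = _
  simp only [weylGen, map_sum, map_smul]
  rfl

theorem weylGen_transpose_mulVec (S : Matrix (Fin 2 × Fin n) (Fin 2 × Fin n) ℝ)
    (ξ : Fin 2 × Fin n → ℝ) (ψ : 𝓢(Fin n → ℝ, ℂ)) :
    weylGen (Sᵀ *ᵥ ξ) ψ = ∑ i, (Complex.I * ξ i) • ∑ k, (S i k : ℂ) • canonicalOp k ψ := by
  simp only [weylGen, Finset.smul_sum, smul_smul]
  rw [Finset.sum_comm]
  refine Finset.sum_congr rfl fun k _ => ?_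
  rw [← Finset.sum_smul]
  congr 1
  simp only [Matrix.mulVec, dotProduct, Matrix.transpose_apply]
  push_cast
  rw [Finset.mul_sum]
  exact Finset.sum_congr rfl fun i _ => by ring

theorem IsGaussianUnitary.inner_weylGen (hU : IsGaussianUnitary S U) (ξ : Fin 2 × Fin n → ℝ)
    (φ ψ : 𝓢(Fin n → ℝ, ℂ)) :
    inner ℂ ((weylGen ξ φ).toLp 2 volume) (U (ψ.toLp 2 volume)) +
      inner ℂ (φ.toLp 2 volume) (U ((weylGen (Sᵀ *ᵥ ξ) ψ).toLp 2 volume)) = 0 := by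
  have hψ : (weylGen (Sᵀ *ᵥ ξ) ψ).toLp 2 volume =
      ∑ i, (Complex.I * ξ i) • (∑ k, (S i k : ℂ) • canonicalOp k ψ).toLp 2 volume := by
    change SchwartzMap.toLpCLM ℂ ℂ 2 volume _ =
      ∑ i, (Complex.I * ξ i) • SchwartzMap.toLpCLM ℂ ℂ 2 volume _
    simp only [weylGen_transpose_mulVec, map_sum, map_smul]
  rw [toLp_weylGen, hψ, sum_inner, map_sum, inner_sum, ← Finset.sum_add_distrib]
  refine Finset.sum_eq_zero fun i _ => ?_
  rw [inner_smul_left, map_smul, inner_smul_right, hU i φ ψ]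
  simp

theorem IsGaussianUnitary.inner_weyl_weyl_toLp (hU : IsGaussianUnitary S U)
    (ξ : Fin 2 × Fin n → ℝ) (φ ψ : 𝓢(Fin n → ℝ, ℂ)) :
    inner ℂ (weyl ξ (φ.toLp 2 volume)) (U (weyl (Sᵀ *ᵥ ξ) (ψ.toLp 2 volume))) =
      inner ℂ (φ.toLp 2 volume) (U (ψ.toLp 2 volume)) := by
  set η := Sᵀ *ᵥ ξ
  set h : ℝ → ℂ := fun t => inner ℂ ((weylSchwartz (t • ξ) φ).toLp 2 volume)
    (U ((weylSchwartz (t • η) ψ).toLp 2 volume)) with hh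
  have hderiv (t : ℝ) : HasDerivAt h 0 t := by
    have hUψ := ((U.toContinuousLinearEquiv : Modes n →L[ℂ] Modes n).restrictScalars
      ℝ).hasFDerivAt.comp_hasDerivAt t (hasDerivAt_toLp_weylSchwartz η ψ t)
    refine ((hasDerivAt_toLp_weylSchwartz ξ φ t).inner ℂ hUψ).congr_deriv ?_
    rw [add_comm]
    exact hU.inner_weylGen ξ _ _
  have hconst := is_const_of_deriv_eq_zero (fun t => (hderiv t).differentiableAt)
    (fun t => (hderiv t).deriv) 1 0
  simpa only [hh, one_smul, toLp_weylSchwartz, zero_smul, weyl_zero] using hconst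

theorem IsGaussianUnitary.inner_weyl_weyl (hU : IsGaussianUnitary S U) (ξ : Fin 2 × Fin n → ℝ)
    (f g : Modes n) :
    inner ℂ (weyl ξ f) (U (weyl (Sᵀ *ᵥ ξ) g)) = inner ℂ f (U g) := by
  have hd : DenseRange fun φ : 𝓢(Fin n → ℝ, ℂ) => φ.toLp 2 (volume : Measure (Fin n → ℝ)) :=
    SchwartzMap.denseRange_toLpCLM (by simp)
  have hξ := (weyl ξ).continuous
  have hSξ := (weyl (Sᵀ *ᵥ ξ)).continuous
  have hUc := U.continuous
  refine congrFun (DenseRange.equalizer (hd.prodMap hd)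
    (g := fun p : Modes n × Modes n => inner ℂ (weyl ξ p.1) (U (weyl (Sᵀ *ᵥ ξ) p.2)))
    (h := fun p : Modes n × Modes n => inner ℂ p.1 (U p.2)) (by fun_prop) (by fun_prop) ?_) (f, g)
  exact funext fun p => hU.inner_weyl_weyl_toLp ξ p.1 p.2

theorem IsGaussianUnitary.conj_weyl (hU : IsGaussianUnitary S U) (ξ : Fin 2 × Fin n → ℝ)
    (w : Modes n) : U (weyl (Sᵀ *ᵥ ξ) (U.symm w)) = weyl ξ w := by
  have h := hU.inner_weyl_weyl ξ w (U.symm w)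
  rw [LinearIsometryEquiv.apply_symm_apply] at h
  rw [← sub_eq_zero, ← norm_eq_zero, ← sq_eq_zero_iff, norm_sub_rev, @norm_sub_sq ℂ, h]
  simp only [LinearIsometryEquiv.norm_map, LinearIsometry.norm_map, inner_self_eq_norm_sq]
  ring

end GaussianUnitary

/-! ### Coherent states -/

section CoherentStates

/-- The probabilists' Hermite polynomials over `ℂ`. The Fock states of the statement are their
values at `√2 q`, times the vacuum wave function. -/
def hermiteC (k : ℕ) : Polynomial ℂ := (Polynomial.hermite k).map (Int.castRingHom ℂ)

theorem hermiteC_succ (k : ℕ) :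
    hermiteC (k + 1) = Polynomial.X * hermiteC k - Polynomial.derivative (hermiteC k) := by
  simp [hermiteC, Polynomial.hermite_succ, Polynomial.derivative_map]

theorem ofReal_sqrt_mul_self {x : ℝ} (hx : 0 ≤ x) : (√x : ℂ) * √x = x := by
  rw [← Complex.ofReal_mul, Real.mul_self_sqrt hx]

theorem ofReal_sqrt_two_mul_self : (√2 : ℂ) * √2 = 2 := by
  exact_mod_cast ofReal_sqrt_mul_self (zero_le_two (α := ℝ))

theorem ofReal_sqrt_ne_zero {x : ℝ} (hx : 0 < x) : (√x : ℂ) ≠ 0 :=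
  Complex.ofReal_ne_zero.2 (Real.sqrt_pos.2 hx).ne'

theorem hasDerivAt_vacuumFun (q : ℝ) : HasDerivAt vacuumFun (-q * vacuumFun q) q := by
  have hexponent : HasDerivAt (fun q : ℝ => -q ^ 2 / 2) (-q) q := by
    refine (((hasDerivAt_pow 2 q).neg).div_const 2).congr_deriv ?_
    norm_num
    ring
  refine ((hexponent.exp.const_mul (Real.pi ^ (-(1 / 4) : ℝ))).ofReal_comp).congr_deriv ?_
  simp only [vacuumFun]
  push_cast
  ring

theorem creation_iterate_vacuumFun (k : ℕ) (q : ℝ) :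
    (creation^[k] vacuumFun) q = (hermiteC k).eval (√2 * q : ℂ) * vacuumFun q := by
  induction k generalizing q with
  | zero => simp [hermiteC]
  | succ k ih =>
    have hlin : HasDerivAt (fun z : ℂ => (√2 * z : ℂ)) (√2 : ℂ) (q : ℂ) := by
      simpa using (hasDerivAt_id (q : ℂ)).const_mul (√2 : ℂ)
    have hpoly : HasDerivAt (fun q : ℝ => (hermiteC k).eval (√2 * q : ℂ))
        ((hermiteC k).derivative.eval (√2 * q : ℂ) * (√2 : ℂ)) q :=
      (((hermiteC k).hasDerivAt (√2 * q : ℂ)).comp (q : ℂ) hlin).comp_ofReal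
    rw [Function.iterate_succ_apply', creation, funext ih,
      (hpoly.fun_mul (hasDerivAt_vacuumFun q)).deriv, hermiteC_succ,
      div_eq_iff (ofReal_sqrt_ne_zero two_pos)]
    simp only [Polynomial.eval_sub, Polynomial.eval_mul, Polynomial.eval_X]
    linear_combination (-(q : ℂ) * Polynomial.eval (√2 * q : ℂ) (hermiteC k) * vacuumFun q) *
      ofReal_sqrt_two_mul_self

/-- The generating function `∑ₖ α^k / k! He_k(x)` of the Hermite polynomials. -/
def hermiteGen (x α : ℂ) : ℂ := Complex.exp (x * α - α ^ 2 / 2)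

theorem hasDerivAt_hermiteGen (x α : ℂ) :
    HasDerivAt (hermiteGen x) ((x - α) * hermiteGen x α) α := by
  have hexponent : HasDerivAt (fun α : ℂ => x * α - α ^ 2 / 2) (x - α) α := by
    refine (((hasDerivAt_id α).const_mul x).sub ((hasDerivAt_pow 2 α).div_const 2)).congr_deriv ?_
    simp
  refine hexponent.cexp.congr_deriv ?_
  rw [hermiteGen, mul_comm]

theorem differentiable_hermiteGen (x : ℂ) : Differentiable ℂ (hermiteGen x) :=
  fun α => (hasDerivAt_hermiteGen x α).differentiableAt

theorem iteratedDeriv_hermiteGen (x : ℂ) (k : ℕ) :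
    iteratedDeriv k (hermiteGen x) = fun α => (hermiteC k).eval (x - α) * hermiteGen x α := by
  induction k with
  | zero => funext α; simp [hermiteC]
  | succ k ih =>
    funext α
    have hpoly : HasDerivAt (fun α : ℂ => (hermiteC k).eval (x - α))
        (-(hermiteC k).derivative.eval (x - α)) α :=
      (((hermiteC k).hasDerivAt (x - α)).comp α ((hasDerivAt_id α).const_sub x)).congr_deriv
        (by ring)
    rw [iteratedDeriv_succ, ih, (hpoly.fun_mul (hasDerivAt_hermiteGen x α)).deriv, hermiteC_succ]
    simp only [Polynomial.eval_sub, Polynomial.eval_mul, Polynomial.eval_X]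
    ring

theorem hasSum_hermiteGen (x α : ℂ) :
    HasSum (fun k : ℕ => (α ^ k / (k.factorial : ℂ)) * (hermiteC k).eval x) (hermiteGen x α) := by
  refine (Complex.hasSum_taylorSeries_of_entire (differentiable_hermiteGen x) 0 α).congr_fun
    fun k => ?_
  rw [iteratedDeriv_hermiteGen]
  simp [hermiteGen]
  ring

/- Cauchy's estimate for the generating function on the circle of radius `r`. -/
theorem norm_hermiteC_eval_le (x : ℂ) (k : ℕ) {r : ℝ} (hr : 0 < r) :
    ‖(hermiteC k).eval x‖ ≤ k.factorial * Real.exp (‖x‖ * r + r ^ 2 / 2) / r ^ k := by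
  have hsphere (z : ℂ) (hz : z ∈ Metric.sphere 0 r) :
      ‖hermiteGen x z‖ ≤ Real.exp (‖x‖ * r + r ^ 2 / 2) := by
    have hz' : ‖z‖ = r := by simpa using hz
    rw [hermiteGen, Complex.norm_exp]
    refine Real.exp_le_exp.2 ((Complex.re_le_norm _).trans ((norm_sub_le _ _).trans ?_))
    simp [hz']
  have hcauchy := Complex.norm_iteratedDeriv_le_of_forall_mem_sphere_norm_le k hr
    (differentiable_hermiteGen x).diffContOnCl hsphere
  rw [iteratedDeriv_hermiteGen] at hcauchy
  simpa [hermiteGen] using hcauchy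

theorem integrable_exp_mul_abs_sub_sq (t : ℝ) :
    Integrable (fun q : ℝ => Real.exp (t * |q| - q ^ 2)) := by
  have hlin (s : ℝ) : Integrable fun q : ℝ => Real.exp (s * q - q ^ 2) := by
    refine (integrable_cexp_quadratic (b := 1) (by simp) (s : ℂ) 0).norm.congr
      (.of_forall fun q => ?_)
    simp only [Complex.norm_exp]
    rw [show (-1 * (q : ℂ) ^ 2 + s * q + 0) = ((s * q - q ^ 2 : ℝ) : ℂ) by push_cast; ring,
      Complex.ofReal_re]
  refine ((hlin t).add (hlin (-t))).mono' (by fun_prop) (.of_forall fun q => ?_)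
  simp only [Real.norm_eq_abs, Real.abs_exp, Pi.add_apply]
  rcases abs_cases q with ⟨hq, _⟩ | ⟨hq, _⟩ <;> rw [hq]
  · linarith [Real.exp_pos (-t * q - q ^ 2)]
  · rw [mul_neg, ← neg_mul]
    linarith [Real.exp_pos (t * q - q ^ 2)]

theorem continuous_vacuumFun : Continuous vacuumFun := by
  unfold vacuumFun
  fun_prop

theorem norm_vacuumFun_sq (q : ℝ) :
    ‖vacuumFun q‖ ^ 2 = Real.pi ^ (-(1 / 2) : ℝ) * Real.exp (-q ^ 2) := by
  rw [vacuumFun, Complex.norm_real, Real.norm_eq_abs, sq_abs, mul_pow, ← Real.exp_nat_mul,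
    ← Real.rpow_mul_natCast Real.pi_pos.le]
  congr 2
  · norm_num
  · push_cast; ring

theorem memLp_exp_mul_vacuumFun (t : ℝ) :
    MemLp (fun q : ℝ => (Real.exp (t * |q|) : ℂ) * vacuumFun q) 2 volume := by
  have hc : Continuous fun q : ℝ => (Real.exp (t * |q|) : ℂ) * vacuumFun q := by
    have := continuous_vacuumFun
    fun_prop
  rw [memLp_two_iff_integrable_sq_norm hc.aestronglyMeasurable]
  refine ((integrable_exp_mul_abs_sub_sq (2 * t)).const_mul (Real.pi ^ (-(1 / 2) : ℝ))).congr
    (.of_forall fun q => ?_)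
  simp only [norm_mul, mul_pow, norm_vacuumFun_sq, Complex.norm_real, Real.norm_eq_abs,
    Real.abs_exp, ← Real.exp_nat_mul]
  rw [mul_left_comm, ← Real.exp_add]
  congr 2
  push_cast; ring

theorem coeFn_fock (k : ℕ) : (fock k : ℝ → ℂ) =ᵐ[volume] fun q =>
    (√k.factorial : ℂ)⁻¹ * ((hermiteC k).eval (√2 * q : ℂ) * vacuumFun q) := by
  filter_upwards [(memLp_fockFun k).coeFn_toLp] with q hq
  rw [fock, hq, fockFun, creation_iterate_vacuumFun, div_eq_inv_mul]

/- The Fock states are normalised, but this crude bound is all that the convergence of the coherent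
state series requires. -/
theorem exists_norm_fock_le {r : ℝ} (hr : 0 < r) :
    ∃ C : ℝ, ∀ k, ‖fock k‖ ≤ √k.factorial / r ^ k * C := by
  have hm := memLp_exp_mul_vacuumFun (√2 * r)
  refine ⟨Real.exp (r ^ 2 / 2) * ‖hm.toLp‖, fun k => ?_⟩
  rw [← mul_assoc]
  refine Lp.norm_le_mul_norm_of_ae_le_mul ?_
  filter_upwards [coeFn_fock k, hm.coeFn_toLp] with q hfock hexp
  rw [hfock, hexp, norm_mul, norm_mul, norm_mul, norm_inv]
  simp only [Complex.norm_real, Real.norm_eq_abs, Real.abs_exp, abs_of_nonneg (Real.sqrt_nonneg _)]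
  have hx : ‖(√2 * q : ℂ)‖ = √2 * |q| := by simp [abs_of_nonneg (Real.sqrt_nonneg _)]
  have hhermite := norm_hermiteC_eval_le (√2 * q : ℂ) k hr
  rw [hx, Real.exp_add] at hhermite
  have hpos : 0 < √(k.factorial : ℝ) := Real.sqrt_pos.2 (by positivity)
  have hsq : (k.factorial : ℝ) = √k.factorial * √k.factorial :=
    (Real.mul_self_sqrt (by positivity)).symm
  calc (√k.factorial)⁻¹ * (‖(hermiteC k).eval (√2 * q : ℂ)‖ * ‖vacuumFun q‖)
      ≤ (√k.factorial)⁻¹ * ((k.factorial * (Real.exp (√2 * |q| * r) *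
        Real.exp (r ^ 2 / 2)) / r ^ k) * ‖vacuumFun q‖) := by gcongr
    _ = _ := by
      rw [show √2 * |q| * r = √2 * r * |q| by ring]
      generalize √(k.factorial : ℝ) = s at hpos hsq ⊢
      rw [hsq]
      field_simp

theorem exists_summable_fock (R : ℝ) : ∃ u : ℕ → ℝ, Summable u ∧ ∀ (k : ℕ) (α : ℂ), ‖α‖ ≤ R →
    ‖(α ^ k / (√k.factorial : ℂ)) • fock k‖ ≤ u k := by
  have hr : (0 : ℝ) < 2 * |R| + 1 := by positivity
  obtain ⟨C, hC⟩ := exists_norm_fock_le hr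
  refine ⟨fun k => (|R| / (2 * |R| + 1)) ^ k * C, ?_, fun k α hα => ?_⟩
  · refine (summable_geometric_of_lt_one (by positivity) ?_).mul_right C
    rw [div_lt_one hr]
    linarith [abs_nonneg R]
  · have hpos : 0 < √(k.factorial : ℝ) := Real.sqrt_pos.2 (by positivity)
    have hα' : ‖α‖ ≤ |R| := hα.trans (le_abs_self R)
    rw [norm_smul, norm_div, norm_pow, Complex.norm_real, Real.norm_eq_abs, abs_of_pos hpos]
    calc ‖α‖ ^ k / √k.factorial * ‖fock k‖
        ≤ |R| ^ k / √k.factorial * (√k.factorial / (2 * |R| + 1) ^ k * C) := by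
          gcongr
          exact hC k
      _ = (|R| / (2 * |R| + 1)) ^ k * C := by
        rw [div_pow]
        field_simp

/-- The unnormalised coherent vector `∑ₖ α^k / √(k!) |k⟩`, which is entire in `α`. -/
def cohVec (α : ℂ) : Mode := ∑' k : ℕ, (α ^ k / (√k.factorial : ℂ)) • fock k

theorem coherentMode_eq (α : ℂ) :
    coherentMode α = ((Real.exp (-‖α‖ ^ 2 / 2) : ℝ) : ℂ) • cohVec α := rfl

theorem differentiable_cohVec : Differentiable ℂ cohVec := by
  intro α
  obtain ⟨u, hu, hle⟩ := exists_summable_fock (‖α‖ + 1)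
  have hterm (k : ℕ) : Differentiable ℂ fun α : ℂ => (α ^ k / (√k.factorial : ℂ)) • fock k :=
    Differentiable.smul_const (by fun_prop) _
  have hball := Complex.differentiableOn_tsum_of_summable_norm hu
    (fun k => (hterm k).differentiableOn) (Metric.isOpen_ball (x := (0 : ℂ)) (ε := ‖α‖ + 1))
    (fun k w hw => hle k w (by simpa using (Metric.mem_ball.1 hw).le))
  exact hball.differentiableAt (Metric.isOpen_ball.mem_nhds (by simp))

theorem coeFn_cohVec (α : ℂ) : (cohVec α : ℝ → ℂ) =ᵐ[volume] fun q =>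
    hermiteGen (√2 * q : ℂ) α * vacuumFun q := by
  obtain ⟨u, hu, hle⟩ := exists_summable_fock ‖α‖
  have hs : Summable fun k : ℕ => ‖(α ^ k / (√k.factorial : ℂ)) • fock k‖ :=
    Summable.of_nonneg_of_le (fun _ => norm_nonneg _) (fun k => hle k α le_rfl) hu
  have hterm (k : ℕ) : ∀ᵐ q : ℝ, ((α ^ k / (√k.factorial : ℂ)) • fock k : Mode) q =
      (α ^ k / (k.factorial : ℂ)) * (hermiteC k).eval (√2 * q : ℂ) * vacuumFun q := by
    filter_upwards [Lp.coeFn_smul (α ^ k / (√k.factorial : ℂ)) (fock k), coeFn_fock k]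
      with q hsmul hfock
    have hfact : (0 : ℝ) < k.factorial := by positivity
    have hsqrt := ofReal_sqrt_ne_zero hfact
    rw [hsmul, Pi.smul_apply, hfock, smul_eq_mul, ← Complex.ofReal_natCast k.factorial,
      ← ofReal_sqrt_mul_self hfact.le]
    field_simp
  filter_upwards [Lp.hasSum_coeFn_tsum (tsum_enorm_ne_top_iff_summable_norm.2 hs),
    ae_all_iff.2 hterm] with q hsum hq
  simp_rw [hq] at hsum
  exact hsum.unique ((hasSum_hermiteGen (√2 * q : ℂ) α).mul_right (vacuumFun q))

theorem inner_cohVec (α β : ℂ) :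
    inner ℂ (cohVec α) (cohVec β) = Complex.exp (starRingEnd ℂ α * β) := by
  have hgauss : (fun q : ℝ => inner ℂ ((cohVec α : ℝ → ℂ) q) ((cohVec β : ℝ → ℂ) q)) =ᵐ[volume]
      fun q : ℝ => ((Real.pi ^ (-(1 / 2) : ℝ) : ℝ) : ℂ) * Complex.exp ((-1) * (q : ℂ) ^ 2 +
        (√2 * (starRingEnd ℂ α + β)) * q + (-(starRingEnd ℂ α) ^ 2 / 2 - β ^ 2 / 2)) := by
    filter_upwards [coeFn_cohVec α, coeFn_cohVec β] with q hα hβ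
    have hvacuum : starRingEnd ℂ (vacuumFun q) * vacuumFun q =
        ((Real.pi ^ (-(1 / 2) : ℝ) : ℝ) : ℂ) * Complex.exp (-(q : ℂ) ^ 2) := by
      rw [← Complex.normSq_eq_conj_mul_self, Complex.normSq_eq_norm_sq, norm_vacuumFun_sq]
      push_cast
      rfl
    rw [hα, hβ, RCLike.inner_apply', map_mul, hermiteGen, hermiteGen, ← Complex.exp_conj]
    simp only [map_sub, map_mul, map_pow, map_div₀, Complex.conj_ofReal, Complex.conj_ofNat]
    rw [mul_mul_mul_comm, hvacuum, mul_left_comm, ← Complex.exp_add, ← Complex.exp_add]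
    congr 2
    ring
  have hpi : ((Real.pi : ℂ) / -(-1)) ^ (1 / 2 : ℂ) = ((Real.pi ^ (1 / 2 : ℝ) : ℝ) : ℂ) := by
    rw [Complex.ofReal_cpow Real.pi_pos.le]
    norm_num
  rw [L2.inner_def, integral_congr_ae hgauss, integral_const_mul,
    integral_cexp_quadratic (by simp), hpi, ← mul_assoc, ← Complex.ofReal_mul,
    ← Real.rpow_add Real.pi_pos]
  norm_num
  congr 1
  linear_combination (1 / 4 * (starRingEnd ℂ α + β) ^ 2) * ofReal_sqrt_two_mul_self

theorem norm_cohVec (α : ℂ) : ‖cohVec α‖ = Real.exp (‖α‖ ^ 2 / 2) := by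
  have hsq : ((‖cohVec α‖ ^ 2 : ℝ) : ℂ) = (Real.exp (‖α‖ ^ 2) : ℝ) := by
    have hself := inner_self_eq_norm_sq_to_K (𝕜 := ℂ) (cohVec α)
    rw [inner_cohVec, ← Complex.normSq_eq_conj_mul_self, Complex.normSq_eq_norm_sq] at hself
    push_cast at hself ⊢
    exact hself.symm
  rw [← Real.sqrt_sq (norm_nonneg _), Complex.ofReal_injective hsq, Real.sqrt_eq_rpow,
    ← Real.exp_mul]
  ring_nf

theorem norm_coherentMode (α : ℂ) : ‖coherentMode α‖ = 1 := by
  rw [coherentMode_eq, norm_smul, norm_cohVec, Complex.norm_real, Real.norm_eq_abs, Real.abs_exp,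
    ← Real.exp_add]
  norm_num
  ring

theorem continuous_coherentMode : Continuous coherentMode := by
  have hweight : Continuous fun α : ℂ => ((Real.exp (-‖α‖ ^ 2 / 2) : ℝ) : ℂ) := by fun_prop
  exact hweight.smul differentiable_cohVec.continuous

end CoherentStates

/-! ### Gaussian integrals of entire functions -/

section GaussianIntegrals

variable {c s C : ℝ}

theorem mul_le_mul_sq_add_div {e : ℝ} (he : 0 < e) (t x : ℝ) :
    t * x ≤ e * x ^ 2 + t ^ 2 / (4 * e) := by
  have hsq : e * x ^ 2 + t ^ 2 / (4 * e) - t * x = (2 * e * x - t) ^ 2 / (4 * e) := by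
    field_simp
    ring
  have hnonneg : 0 ≤ (2 * e * x - t) ^ 2 / (4 * e) := by positivity
  linarith

theorem re_mul_le_mul_norm {c : ℝ} (hc : 0 ≤ c) (a z : ℂ) :
    (c * starRingEnd ℂ a * z).re ≤ c * ‖a‖ * ‖z‖ := by
  refine (Complex.re_le_norm _).trans_eq ?_
  rw [norm_mul, norm_mul, Complex.norm_real, Complex.norm_conj, Real.norm_of_nonneg hc]

theorem integrable_exp_neg_mul_norm_sq (hc : 0 < c) :
    Integrable fun γ : ℂ => Real.exp (-c * ‖γ‖ ^ 2) := by
  refine (GaussianFourier.integrable_cexp_neg_mul_sq_norm_add (V := ℂ) (b := (c : ℂ))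
    (by simpa using hc) 0 0).norm.congr (.of_forall fun γ => ?_)
  simp only [Complex.norm_exp]
  rw [show (-(c : ℂ) * (‖γ‖ : ℂ) ^ 2 + 0 * ((inner ℝ (0 : ℂ) γ : ℝ) : ℂ)) =
    ((-c * ‖γ‖ ^ 2 : ℝ) : ℂ) by push_cast; ring, Complex.ofReal_re]

theorem integral_exp_neg_mul_norm_sq (hc : 0 < c) :
    ∫ γ : ℂ, Real.exp (-c * ‖γ‖ ^ 2) = Real.pi / c := by
  rw [GaussianFourier.integral_rexp_neg_mul_sq_norm (V := ℂ) hc]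
  simp [Complex.finrank_real_complex]

theorem integral_comp_circleMap_mul (F : ℂ → ℂ) (θ : ℝ) :
    ∫ γ : ℂ, F (circleMap 0 1 θ * γ) = ∫ γ : ℂ, F γ := by
  have hrot := (rotation (Circle.exp θ)).measurePreserving.integral_comp
    (rotation (Circle.exp θ)).toHomeomorph.measurableEmbedding F
  simpa [rotation_apply, Circle.coe_exp, circleMap_zero] using hrot

theorem intervalIntegral_comp_circleMap_mul {g : ℂ → ℂ} (hg : Differentiable ℂ g) (γ : ℂ) :
    ∫ θ in (0 : ℝ)..2 * Real.pi, g (circleMap 0 1 θ * γ) = ((2 * Real.pi : ℝ) : ℂ) * g 0 := by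
  have hd : Differentiable ℂ fun z => g (z * γ) := hg.comp (differentiable_id.mul_const γ)
  have hmean := DiffContOnCl.circleAverage (f := fun z => g (z * γ)) (c := 0) (R := 1)
    hd.diffContOnCl
  rw [Real.circleAverage_def, inv_smul_eq_iff₀ (by positivity)] at hmean
  rw [hmean, zero_mul, Complex.real_smul]

theorem integrable_gauss_mul_comp_circleMap (hs : s < c) {g : ℂ → ℂ} (hg : Continuous g)
    (hC : ∀ γ, ‖g γ‖ ≤ C * Real.exp (s * ‖γ‖ ^ 2)) :
    Integrable (fun p : ℝ × ℂ => (Real.exp (-c * ‖p.2‖ ^ 2) : ℂ) * g (circleMap 0 1 p.1 * p.2))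
      ((volume.restrict (Set.Ioc 0 (2 * Real.pi))).prod (volume : Measure ℂ)) := by
  have hbound := (integrable_exp_neg_mul_norm_sq (sub_pos.2 hs)).const_mul C
  refine (hbound.comp_snd (volume.restrict (Set.Ioc 0 (2 * Real.pi)))).mono'
    (Continuous.aestronglyMeasurable ?_) (.of_forall fun p => ?_)
  · have := continuous_circleMap 0 1
    fun_prop
  · rw [norm_mul, Complex.norm_real, Real.norm_eq_abs, Real.abs_exp]
    calc Real.exp (-c * ‖p.2‖ ^ 2) * ‖g (circleMap 0 1 p.1 * p.2)‖
        ≤ Real.exp (-c * ‖p.2‖ ^ 2) * (C * Real.exp (s * ‖p.2‖ ^ 2)) := by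
          gcongr
          simpa using hC (circleMap 0 1 p.1 * p.2)
      _ = C * Real.exp (-(c - s) * ‖p.2‖ ^ 2) := by
          rw [mul_left_comm, ← Real.exp_add]
          ring_nf

/- Average over rotations and apply the mean value property on each circle. -/
theorem integral_gauss_mul_entire (hc : 0 < c) (hs : s < c) {g : ℂ → ℂ}
    (hg : Differentiable ℂ g) (hC : ∀ γ, ‖g γ‖ ≤ C * Real.exp (s * ‖γ‖ ^ 2)) :
    ∫ γ : ℂ, (Real.exp (-c * ‖γ‖ ^ 2) : ℂ) * g γ = (Real.pi / c : ℝ) * g 0 := by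
  have hrot (θ : ℝ) : ∫ γ : ℂ, (Real.exp (-c * ‖γ‖ ^ 2) : ℂ) * g (circleMap 0 1 θ * γ) =
      ∫ γ : ℂ, (Real.exp (-c * ‖γ‖ ^ 2) : ℂ) * g γ := by
    rw [← integral_comp_circleMap_mul (fun γ => (Real.exp (-c * ‖γ‖ ^ 2) : ℂ) * g γ) θ]
    simp
  have hswap := integral_integral_swap (f := fun (θ : ℝ) (γ : ℂ) =>
    (Real.exp (-c * ‖γ‖ ^ 2) : ℂ) * g (circleMap 0 1 θ * γ))
    (integrable_gauss_mul_comp_circleMap hs hg.continuous hC)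
  simp only [hrot, integral_const_mul] at hswap
  simp_rw [← intervalIntegral.integral_of_le (a := (0 : ℝ)) (b := 2 * Real.pi) (μ := volume)
    (by positivity), intervalIntegral_comp_circleMap_mul hg] at hswap
  rw [intervalIntegral.integral_const, integral_mul_const, integral_complex_ofReal,
    integral_exp_neg_mul_norm_sq hc, Complex.real_smul, sub_zero] at hswap
  have hpi : ((2 * Real.pi : ℝ) : ℂ) ≠ 0 := by
    exact_mod_cast (by positivity : (2 * Real.pi : ℝ) ≠ 0)
  refine mul_left_cancel₀ hpi (hswap.trans ?_)
  ring

theorem nonneg_of_norm_le_mul_exp {E F : Type*} [SeminormedAddCommGroup E]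
    [SeminormedAddCommGroup F] {f : E → F} (hC : ∀ γ, ‖f γ‖ ≤ C * Real.exp (s * ‖γ‖ ^ 2)) :
    0 ≤ C := by
  simpa using (norm_nonneg _).trans (hC 0)

theorem exists_norm_exp_mul_translate_le (hs0 : 0 ≤ s) (hs : s < c) {f : ℂ → ℂ}
    (hC : ∀ γ, ‖f γ‖ ≤ C * Real.exp (s * ‖γ‖ ^ 2)) (α : ℂ) :
    ∃ D : ℝ, ∀ γ : ℂ, ‖Complex.exp (c * starRingEnd ℂ (-α) * γ) * f (γ + α)‖ ≤
      D * Real.exp ((s + c) / 2 * ‖γ‖ ^ 2) := by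
  have hC0 := nonneg_of_norm_le_mul_exp hC
  refine ⟨C * Real.exp (s * ‖α‖ ^ 2 + (c * ‖α‖ + 2 * s * ‖α‖) ^ 2 / (4 * ((c - s) / 2))),
    fun γ => ?_⟩
  have hexp : (c * starRingEnd ℂ (-α) * γ).re ≤ c * ‖α‖ * ‖γ‖ := by
    simpa only [norm_neg] using re_mul_le_mul_norm (hs0.trans hs.le) (-α) γ
  have hf : ‖f (γ + α)‖ ≤ C * Real.exp (s * (‖γ‖ + ‖α‖) ^ 2) :=
    (hC _).trans (by gcongr; exact norm_add_le γ α)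
  rw [norm_mul, Complex.norm_exp]
  calc _ ≤ Real.exp (c * ‖α‖ * ‖γ‖) * (C * Real.exp (s * (‖γ‖ + ‖α‖) ^ 2)) := by gcongr
    _ = C * Real.exp (c * ‖α‖ * ‖γ‖ + s * (‖γ‖ + ‖α‖) ^ 2) := by
      rw [Real.exp_add]
      ring
    _ ≤ C * Real.exp ((s * ‖α‖ ^ 2 + (c * ‖α‖ + 2 * s * ‖α‖) ^ 2 / (4 * ((c - s) / 2))) +
        (s + c) / 2 * ‖γ‖ ^ 2) := by
      refine mul_le_mul_of_nonneg_left (Real.exp_le_exp.2 ?_) hC0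
      linarith [mul_le_mul_sq_add_div (half_pos (sub_pos.2 hs)) (c * ‖α‖ + 2 * s * ‖α‖) ‖γ‖]
    _ = _ := by
      rw [Real.exp_add]
      ring

/- The reproducing property of the kernel `exp (c ⟨β, α⟩)` in the Bargmann–Fock space with weight
`exp (-c |β|²)`. Translating by `α` reduces it to the mean value property. -/
theorem integral_reproducing (hs0 : 0 ≤ s) (hs : s < c) {f : ℂ → ℂ} (hf : Differentiable ℂ f)
    (hC : ∀ γ, ‖f γ‖ ≤ C * Real.exp (s * ‖γ‖ ^ 2)) (α : ℂ) :
    ∫ β : ℂ, Complex.exp (c * starRingEnd ℂ β * α - c * ‖β‖ ^ 2) * f β =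
      (Real.pi / c : ℝ) * f α := by
  have hd : Differentiable ℂ fun γ : ℂ =>
      Complex.exp (c * starRingEnd ℂ (-α) * γ) * f (γ + α) := by
    have : Differentiable ℂ fun γ : ℂ => f (γ + α) := hf.comp (differentiable_id.add_const α)
    fun_prop
  obtain ⟨D, hD⟩ := exists_norm_exp_mul_translate_le hs0 hs hC α
  have hmean := integral_gauss_mul_entire (by linarith) (by linarith : (s + c) / 2 < c) hd hD
  rw [mul_zero, Complex.exp_zero, one_mul, zero_add] at hmean
  rw [← integral_add_right_eq_self _ α, ← hmean]
  refine integral_congr_ae (.of_forall fun γ => ?_)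
  simp only []
  rw [← mul_assoc, Complex.ofReal_exp, ← Complex.exp_add]
  congr 2
  push_cast
  rw [← Complex.conj_mul', ← Complex.conj_mul', map_add, map_neg]
  ring

theorem integral_reproducing_diag_left (hs0 : 0 ≤ s) (hs : s < c) {f : ℂ → ℂ}
    (hf : Differentiable ℂ fun α => starRingEnd ℂ (f α))
    (hC : ∀ γ, ‖f γ‖ ≤ C * Real.exp (s * ‖γ‖ ^ 2)) (β : ℂ) :
    ∫ α : ℂ, Complex.exp (c * starRingEnd ℂ β * α - c * ‖α‖ ^ 2) * f α =
      (Real.pi / c : ℝ) * f β := by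
  have hrep := congrArg (starRingEnd ℂ)
    (integral_reproducing hs0 hs hf (fun γ => by simpa only [Complex.norm_conj] using hC γ) β)
  rw [← integral_conj] at hrep
  simp only [map_mul, ← Complex.exp_conj, Complex.conj_conj, map_sub, map_pow,
    Complex.conj_ofReal] at hrep
  rw [← hrep]
  refine integral_congr_ae (.of_forall fun α => ?_)
  simp only []
  ring_nf

theorem norm_gauss_mul_reproducing_le (hc : 0 < c) (hs : s < c / 2) {K : ℂ → ℂ → ℂ}
    (hC0 : 0 ≤ C) (hC : ∀ α β, ‖K α β‖ ≤ C * Real.exp (s * (‖α‖ ^ 2 + ‖β‖ ^ 2))) (δ α β : ℂ) :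
    ‖(Real.exp (-c * ‖α‖ ^ 2) : ℂ) *
        (Complex.exp (c * starRingEnd ℂ β * (α + δ) - c * ‖β‖ ^ 2) * K α β)‖ ≤
      C * Real.exp ((c * ‖δ‖) ^ 2 / (4 * ((c / 2 - s) / 2))) *
        (Real.exp (-((c / 2 - s) / 2) * ‖α‖ ^ 2) * Real.exp (-((c / 2 - s) / 2) * ‖β‖ ^ 2)) := by
  have hκ : 0 < (c / 2 - s) / 2 := half_pos (sub_pos.2 hs)
  have hexp : (c * starRingEnd ℂ β * (α + δ) - c * ‖β‖ ^ 2 : ℂ).re ≤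
      c * ‖β‖ * (‖α‖ + ‖δ‖) - c * ‖β‖ ^ 2 := by
    have hre : (c * starRingEnd ℂ β * (α + δ)).re ≤ c * ‖β‖ * (‖α‖ + ‖δ‖) :=
      (re_mul_le_mul_norm hc.le β _).trans (by gcongr; exact norm_add_le α δ)
    have hsq : ((c : ℂ) * (‖β‖ : ℂ) ^ 2).re = c * ‖β‖ ^ 2 := by
      rw [← Complex.ofReal_pow, ← Complex.ofReal_mul, Complex.ofReal_re]
    rw [Complex.sub_re, hsq]
    linarith
  have hK := hC α β
  rw [norm_mul, norm_mul, Complex.norm_real, Real.norm_eq_abs, Real.abs_exp, Complex.norm_exp]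
  calc _ ≤ Real.exp (-c * ‖α‖ ^ 2) * (Real.exp (c * ‖β‖ * (‖α‖ + ‖δ‖) - c * ‖β‖ ^ 2) *
        (C * Real.exp (s * (‖α‖ ^ 2 + ‖β‖ ^ 2)))) := by gcongr
    _ = C * Real.exp (-c * ‖α‖ ^ 2 + (c * ‖β‖ * (‖α‖ + ‖δ‖) - c * ‖β‖ ^ 2) +
        s * (‖α‖ ^ 2 + ‖β‖ ^ 2)) := by
      rw [Real.exp_add, Real.exp_add]
      ring
    _ ≤ C * Real.exp ((c * ‖δ‖) ^ 2 / (4 * ((c / 2 - s) / 2)) +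
        (-((c / 2 - s) / 2) * ‖α‖ ^ 2 + -((c / 2 - s) / 2) * ‖β‖ ^ 2)) := by
      refine mul_le_mul_of_nonneg_left (Real.exp_le_exp.2 ?_) hC0
      have hlin := mul_le_mul_sq_add_div hκ (c * ‖δ‖) ‖β‖
      have hcross : 0 ≤ c / 2 * (‖α‖ - ‖β‖) ^ 2 := by positivity
      have hα : 0 ≤ (c / 2 - s) / 2 * ‖α‖ ^ 2 := by positivity
      linarith
    _ = _ := by
      rw [Real.exp_add, Real.exp_add]
      ring

theorem integrable_gauss_mul_reproducing (hc : 0 < c) (hs : s < c / 2) {K : ℂ → ℂ → ℂ}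
    (hK : Continuous fun p : ℂ × ℂ => K p.1 p.2)
    (hC : ∀ α β, ‖K α β‖ ≤ C * Real.exp (s * (‖α‖ ^ 2 + ‖β‖ ^ 2))) (δ : ℂ) :
    Integrable (fun p : ℂ × ℂ => (Real.exp (-c * ‖p.1‖ ^ 2) : ℂ) *
      (Complex.exp (c * starRingEnd ℂ p.2 * (p.1 + δ) - c * ‖p.2‖ ^ 2) * K p.1 p.2))
      ((volume : Measure ℂ).prod (volume : Measure ℂ)) := by
  have hC0 : 0 ≤ C := by simpa using (norm_nonneg _).trans (hC 0 0)
  have hκ := integrable_exp_neg_mul_norm_sq (half_pos (sub_pos.2 hs))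
  have := Complex.continuous_conj
  exact ((hκ.mul_prod hκ).const_mul _).mono' (Continuous.aestronglyMeasurable (by fun_prop))
    (.of_forall fun p => norm_gauss_mul_reproducing_le hc hs hC0 hC δ p.1 p.2)

/- Reproduce `K α (α + δ)` as an integral over the second argument, then use the reproducing
property in the first argument. -/
theorem integral_gauss_shift (hs0 : 0 ≤ s) (hs : s < c / 2) {K : ℂ → ℂ → ℂ}
    (hK₁ : ∀ β, Differentiable ℂ fun α => starRingEnd ℂ (K α β)) (hK₂ : ∀ α, Differentiable ℂ (K α))
    (hK : Continuous fun p : ℂ × ℂ => K p.1 p.2)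
    (hC : ∀ α β, ‖K α β‖ ≤ C * Real.exp (s * (‖α‖ ^ 2 + ‖β‖ ^ 2))) (δ : ℂ) :
    ∫ α : ℂ, (Real.exp (-c * ‖α‖ ^ 2) : ℂ) * K α (α + δ) =
      ∫ β : ℂ, (Real.exp (-c * ‖β‖ ^ 2) : ℂ) * (Complex.exp (c * starRingEnd ℂ β * δ) * K β β) := by
  have hc : 0 < c := by linarith
  have hsc : s < c := by linarith
  have hC₁ (β α : ℂ) : ‖K α β‖ ≤ C * Real.exp (s * ‖β‖ ^ 2) * Real.exp (s * ‖α‖ ^ 2) :=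
    (hC α β).trans_eq (by rw [mul_add, Real.exp_add]; ring)
  have hC₂ (α β : ℂ) : ‖K α β‖ ≤ C * Real.exp (s * ‖α‖ ^ 2) * Real.exp (s * ‖β‖ ^ 2) :=
    (hC α β).trans_eq (by rw [mul_add, Real.exp_add]; ring)
  have hleft (α : ℂ) : ∫ β : ℂ, (Real.exp (-c * ‖α‖ ^ 2) : ℂ) *
      (Complex.exp (c * starRingEnd ℂ β * (α + δ) - c * ‖β‖ ^ 2) * K α β) =
      (Real.pi / c : ℝ) * ((Real.exp (-c * ‖α‖ ^ 2) : ℂ) * K α (α + δ)) := by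
    rw [integral_const_mul, integral_reproducing hs0 hsc (hK₂ α) (hC₂ α)]
    ring
  have hright (β : ℂ) : ∫ α : ℂ, (Real.exp (-c * ‖α‖ ^ 2) : ℂ) *
      (Complex.exp (c * starRingEnd ℂ β * (α + δ) - c * ‖β‖ ^ 2) * K α β) =
      (Real.pi / c : ℝ) * ((Real.exp (-c * ‖β‖ ^ 2) : ℂ) *
        (Complex.exp (c * starRingEnd ℂ β * δ) * K β β)) := by
    have hsplit (α : ℂ) : (Real.exp (-c * ‖α‖ ^ 2) : ℂ) *
        (Complex.exp (c * starRingEnd ℂ β * (α + δ) - c * ‖β‖ ^ 2) * K α β) =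
        ((Real.exp (-c * ‖β‖ ^ 2) : ℂ) * Complex.exp (c * starRingEnd ℂ β * δ)) *
          (Complex.exp (c * starRingEnd ℂ β * α - c * ‖α‖ ^ 2) * K α β) := by
      simp only [← mul_assoc, Complex.ofReal_exp, ← Complex.exp_add]
      push_cast
      ring_nf
    simp only [hsplit]
    rw [integral_const_mul, integral_reproducing_diag_left hs0 hsc (hK₁ β) (hC₁ β)]
    ring
  have hswap := integral_integral_swap (f := fun (α β : ℂ) => (Real.exp (-c * ‖α‖ ^ 2) : ℂ) *
    (Complex.exp (c * starRingEnd ℂ β * (α + δ) - c * ‖β‖ ^ 2) * K α β))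
    (integrable_gauss_mul_reproducing hc hs hK hC δ)
  simp only [hleft, hright, integral_const_mul] at hswap
  exact mul_left_cancel₀ (by exact_mod_cast (div_pos Real.pi_pos hc).ne') hswap

end GaussianIntegrals

/-! ### The kernel of a local operation -/

theorem integrable_gauss_shift {c s C : ℝ} (hs0 : 0 ≤ s) (hs : s < c / 2) {K : ℂ → ℂ → ℂ}
    (hK : Continuous fun p : ℂ × ℂ => K p.1 p.2)
    (hC : ∀ α β, ‖K α β‖ ≤ C * Real.exp (s * (‖α‖ ^ 2 + ‖β‖ ^ 2))) (δ : ℂ) :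
    Integrable fun α : ℂ => (Real.exp (-c * ‖α‖ ^ 2) : ℂ) * K α (α + δ) := by
  have hC0 : 0 ≤ C := by simpa using (norm_nonneg _).trans (hC 0 0)
  have he : 0 < (c - 2 * s) / 2 := by linarith
  refine ((integrable_exp_neg_mul_norm_sq he).const_mul
    (C * Real.exp (s * ‖δ‖ ^ 2 + (2 * s * ‖δ‖) ^ 2 / (4 * ((c - 2 * s) / 2))))).mono'
    (Continuous.aestronglyMeasurable ?_) (.of_forall fun α => ?_)
  · have : Continuous fun α : ℂ => K α (α + δ) :=
      hK.comp (continuous_id.prodMk (continuous_id.add continuous_const))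
    fun_prop
  · rw [norm_mul, Complex.norm_real, Real.norm_eq_abs, Real.abs_exp]
    calc _ ≤ Real.exp (-c * ‖α‖ ^ 2) * (C * Real.exp (s * (‖α‖ ^ 2 + (‖α‖ + ‖δ‖) ^ 2))) := by
          refine mul_le_mul_of_nonneg_left ((hC _ _).trans ?_) (Real.exp_pos _).le
          have := norm_add_le α δ
          gcongr
      _ = C * Real.exp (-c * ‖α‖ ^ 2 + s * (‖α‖ ^ 2 + (‖α‖ + ‖δ‖) ^ 2)) := by
          rw [Real.exp_add]; ring
      _ ≤ C * Real.exp ((s * ‖δ‖ ^ 2 + (2 * s * ‖δ‖) ^ 2 / (4 * ((c - 2 * s) / 2))) +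
          -((c - 2 * s) / 2) * ‖α‖ ^ 2) := by
          refine mul_le_mul_of_nonneg_left (Real.exp_le_exp.2 ?_) hC0
          linarith [mul_le_mul_sq_add_div he (2 * s * ‖δ‖) ‖α‖]
      _ = _ := by rw [Real.exp_add]; ring

/-- The Gaussian probability density of one complex amplitude. -/
def modeDensity (l : ℝ) (α : ℂ) : ℝ := l / Real.pi * Real.exp (-l * ‖α‖ ^ 2)

theorem integrable_modeDensity {l : ℝ} (hl : 0 < l) : Integrable (modeDensity l) :=
  (integrable_exp_neg_mul_norm_sq hl).const_mul _

theorem modeDensity_nonneg {l : ℝ} (hl : 0 < l) (α : ℂ) : 0 ≤ modeDensity l α := by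
  have := Real.pi_pos
  unfold modeDensity
  positivity

theorem integral_modeDensity {l : ℝ} (hl : 0 < l) : ∫ α, modeDensity l α = 1 := by
  have := Real.pi_pos
  unfold modeDensity
  rw [integral_const_mul, integral_exp_neg_mul_norm_sq hl]
  field_simp

theorem prod_modeDensity {n : ℕ} (l : ℝ) (α : Fin n → ℂ) :
    ∏ j, modeDensity l (α j) = (l / Real.pi) ^ n * Real.exp (-l * ∑ j, ‖α j‖ ^ 2) := by
  simp only [modeDensity, Finset.prod_mul_distrib, ← Real.exp_sum, Finset.mul_sum]
  simp [div_pow]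

/-- The integrand of `modeKernel` at the phase space points `p` and the amplitude `α`, as a function
of the pair `(p, α)`. -/
def modeIntegrand (l : ℝ) (A : Mode →L[ℂ] Mode) (x : ((ℝ × ℝ) × (ℝ × ℝ)) × ℂ) : ℂ :=
  (modeDensity l x.2 : ℂ) *
    (Complex.exp (-((√2 * (x.1.1.1 * x.2.re + x.1.1.2 * x.2.im) : ℝ) : ℂ) * Complex.I) *
      inner ℂ (A (coherentMode x.2)) (weylMode x.1.2 (A (coherentMode x.2))))

/-- The characteristic function of the output of `A` on the Gaussian ensemble of coherent states,
correlated with the input amplitude: `p.1` is dual to the amplitude, `p.2` to the output. -/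
def modeKernel (l : ℝ) (A : Mode →L[ℂ] Mode) (p : (ℝ × ℝ) × (ℝ × ℝ)) : ℂ :=
  ∫ α, modeIntegrand l A (p, α)

theorem norm_modeIntegrand_le {l : ℝ} (hl : 0 < l) (A : Mode →L[ℂ] Mode)
    (x : ((ℝ × ℝ) × (ℝ × ℝ)) × ℂ) : ‖modeIntegrand l A x‖ ≤ modeDensity l x.2 * ‖A‖ ^ 2 := by
  have hA : ‖A (coherentMode x.2)‖ ≤ ‖A‖ := by
    simpa [norm_coherentMode] using A.le_opNorm (coherentMode x.2)
  rw [modeIntegrand, norm_mul, norm_mul, Complex.norm_real,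
    Real.norm_of_nonneg (modeDensity_nonneg hl _), ← Complex.ofReal_neg,
    Complex.norm_exp_ofReal_mul_I, one_mul, sq]
  refine mul_le_mul_of_nonneg_left ((norm_inner_le_norm _ _).trans ?_) (modeDensity_nonneg hl _)
  rw [LinearIsometry.norm_map]
  gcongr

theorem continuous_modeIntegrand (l : ℝ) (A : Mode →L[ℂ] Mode) :
    Continuous (modeIntegrand l A) := by
  have hA : Continuous fun x : ((ℝ × ℝ) × (ℝ × ℝ)) × ℂ => A (coherentMode x.2) :=
    A.continuous.comp (continuous_coherentMode.comp continuous_snd)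
  have hW := continuous_linearIsometry_apply
    (T := fun x : ((ℝ × ℝ) × (ℝ × ℝ)) × ℂ => weylMode x.1.2)
    (fun v => (continuous_weylMode v).comp (continuous_snd.comp continuous_fst)) hA
  have := Complex.continuous_re
  have := Complex.continuous_im
  unfold modeIntegrand modeDensity
  exact Continuous.mul (by fun_prop) (Continuous.mul (by fun_prop) (hA.inner hW))

theorem continuous_modeKernel {l : ℝ} (hl : 0 < l) (A : Mode →L[ℂ] Mode) :
    Continuous (modeKernel l A) :=
  have hcont := continuous_modeIntegrand l A
  continuous_of_dominated
    (fun _ => (hcont.comp (continuous_const.prodMk continuous_id)).aestronglyMeasurable)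
    (fun p => .of_forall fun α => norm_modeIntegrand_le hl A (p, α))
    ((integrable_modeDensity hl).mul_const _)
    (.of_forall fun _ => hcont.comp (continuous_id.prodMk continuous_const))

theorem weylMode_zero (f : Mode) : weylMode 0 f = f := by
  have h := weylMode_weylMode 0 0 f
  simp only [sympl, Prod.fst_zero, zero_mul, sub_zero, neg_zero, zero_div,
    Complex.ofReal_zero, Complex.exp_zero, one_smul, add_zero] at h
  exact (weylMode 0).injective h

theorem modeKernel_zero (l : ℝ) (A : Mode →L[ℂ] Mode) :
    modeKernel l A 0 = (∫ α, modeDensity l α * ‖A (coherentMode α)‖ ^ 2 : ℝ) := by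
  rw [modeKernel, ← integral_complex_ofReal]
  refine integral_congr_ae (.of_forall fun α => ?_)
  simp [modeIntegrand, weylMode_zero, inner_self_eq_norm_sq_to_K]

/-- The twist of `modeCharFun l A`: the symplectic form of the output phase space minus that of
the input phase space, scaled by `1 / (1 + λ)`. -/
def modeTwist (l : ℝ) (p q : (ℝ × ℝ) × (ℝ × ℝ)) : ℝ := sympl p.2 q.2 - sympl p.1 q.1 / (1 + l)

/-- The kernel `modeKernel l A`, rescaled by the Gaussian factor that turns it into the
characteristic function of a positive operator on two modes. -/
def modeCharFun (l : ℝ) (A : Mode →L[ℂ] Mode) (p : (ℝ × ℝ) × (ℝ × ℝ)) : ℂ :=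
  (Real.exp ((p.1.1 ^ 2 + p.1.2 ^ 2) / (4 * (1 + l))) : ℂ) * modeKernel l A p

theorem continuous_modeCharFun {l : ℝ} (hl : 0 < l) (A : Mode →L[ℂ] Mode) :
    Continuous (modeCharFun l A) :=
  Continuous.mul (by fun_prop) (continuous_modeKernel hl A)

theorem modeCharFun_zero (l : ℝ) (A : Mode →L[ℂ] Mode) :
    modeCharFun l A 0 = (∫ α, modeDensity l α * ‖A (coherentMode α)‖ ^ 2 : ℝ) := by
  simp [modeCharFun, modeKernel_zero]

/-- The complex amplitude `-i (a + i b) / √2` of the phase space point `(a, b)`. -/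
def amplitude (ξ : ℝ × ℝ) : ℂ := -Complex.I * (ξ.1 + ξ.2 * Complex.I) / (√2 : ℂ)

theorem amplitude_sub (ξ η : ℝ × ℝ) : amplitude (ξ - η) = amplitude ξ - amplitude η := by
  simp only [amplitude, Prod.fst_sub, Prod.snd_sub]
  push_cast
  ring

theorem conj_amplitude (ξ : ℝ × ℝ) :
    starRingEnd ℂ (amplitude ξ) = Complex.I * (ξ.1 - ξ.2 * Complex.I) / (√2 : ℂ) := by
  simp only [amplitude, map_div₀, map_mul, map_neg, map_add, Complex.conj_I, Complex.conj_ofReal]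
  ring

theorem conj_amplitude_mul_amplitude (ξ η : ℝ × ℝ) :
    starRingEnd ℂ (amplitude η) * amplitude ξ =
      (ξ.1 + ξ.2 * Complex.I) * (η.1 - η.2 * Complex.I) / 2 := by
  rw [conj_amplitude, amplitude, div_mul_div_comm, ofReal_sqrt_two_mul_self]
  linear_combination (-(ξ.1 + ξ.2 * Complex.I) * (η.1 - η.2 * Complex.I) / 2) * Complex.I_sq

theorem amplitude_phase (ξ : ℝ × ℝ) (α : ℂ) :
    amplitude ξ * starRingEnd ℂ α - starRingEnd ℂ (amplitude ξ) * α =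
      -((√2 * (ξ.1 * α.re + ξ.2 * α.im) : ℝ) : ℂ) * Complex.I := by
  have hα := Complex.re_add_im α
  have hα' : starRingEnd ℂ α = α.re - α.im * Complex.I := by apply Complex.ext <;> simp
  rw [conj_amplitude, amplitude, hα', div_mul_eq_mul_div, div_mul_eq_mul_div, ← sub_div,
    div_eq_iff (ofReal_sqrt_ne_zero two_pos)]
  push_cast
  linear_combination (Complex.I * (ξ.1 * α.re + ξ.2 * α.im)) * ofReal_sqrt_two_mul_self +
    (2 * Complex.I * ξ.2 * α.im) * Complex.I_sq + Complex.I * (ξ.1 - ξ.2 * Complex.I) * hα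

/-- The sesqui-holomorphic kernel of `A† W(ζ) A` in the coherent states: it is antiholomorphic in
`α` and holomorphic in `β`. -/
def bargmannKernel (A : Mode →L[ℂ] Mode) (ζ : ℝ × ℝ) (α β : ℂ) : ℂ :=
  inner ℂ (A (cohVec α)) (weylMode ζ (A (cohVec β)))

section BargmannKernel

variable (A : Mode →L[ℂ] Mode) (ζ : ℝ × ℝ)

theorem differentiable_map_cohVec : Differentiable ℂ fun α => A (cohVec α) :=
  A.differentiable.comp differentiable_cohVec

theorem differentiable_conj_bargmannKernel (β : ℂ) :
    Differentiable ℂ fun α => starRingEnd ℂ (bargmannKernel A ζ α β) := by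
  simp only [bargmannKernel, inner_conj_symm]
  exact (innerSL ℂ _).differentiable.comp (differentiable_map_cohVec A)

theorem differentiable_bargmannKernel (α : ℂ) : Differentiable ℂ (bargmannKernel A ζ α) :=
  ((innerSL ℂ _).comp (weylMode ζ).toContinuousLinearMap).differentiable.comp
    (differentiable_map_cohVec A)

theorem continuous_bargmannKernel :
    Continuous fun p : ℂ × ℂ => bargmannKernel A ζ p.1 p.2 :=
  have hA := (differentiable_map_cohVec A).continuous
  (hA.comp continuous_fst).inner ((weylMode ζ).continuous.comp (hA.comp continuous_snd))

theorem norm_bargmannKernel_le (α β : ℂ) :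
    ‖bargmannKernel A ζ α β‖ ≤ ‖A‖ ^ 2 * Real.exp ((‖α‖ ^ 2 + ‖β‖ ^ 2) / 2) := by
  have hA (γ : ℂ) : ‖A (cohVec γ)‖ ≤ ‖A‖ * Real.exp (‖γ‖ ^ 2 / 2) := by
    simpa [norm_cohVec] using A.le_opNorm (cohVec γ)
  calc ‖bargmannKernel A ζ α β‖ ≤ ‖A (cohVec α)‖ * ‖A (cohVec β)‖ :=
        (norm_inner_le_norm _ _).trans_eq (by rw [LinearIsometry.norm_map])
    _ ≤ (‖A‖ * Real.exp (‖α‖ ^ 2 / 2)) * (‖A‖ * Real.exp (‖β‖ ^ 2 / 2)) := by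
        gcongr <;> exact hA _
    _ = _ := by rw [add_div, Real.exp_add]; ring

theorem modeKernel_eq (l : ℝ) (ξ : ℝ × ℝ) :
    modeKernel l A (ξ, ζ) = (l / Real.pi : ℝ) * ∫ α : ℂ, (Real.exp (-(1 + l) * ‖α‖ ^ 2) : ℂ) *
      (Complex.exp (amplitude ξ * starRingEnd ℂ α - starRingEnd ℂ (amplitude ξ) * α) *
        bargmannKernel A ζ α α) := by
  rw [modeKernel, ← integral_const_mul]
  refine integral_congr_ae (.of_forall fun α => ?_)
  have hexp : Real.exp (-(1 + l) * ‖α‖ ^ 2) =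
      Real.exp (-l * ‖α‖ ^ 2) * (Real.exp (-‖α‖ ^ 2 / 2) * Real.exp (-‖α‖ ^ 2 / 2)) := by
    rw [← Real.exp_add, ← Real.exp_add]
    ring_nf
  simp only [modeIntegrand, bargmannKernel, modeDensity, amplitude_phase, coherentMode_eq, map_smul,
    inner_smul_left, inner_smul_right, Complex.conj_ofReal, hexp]
  push_cast
  ring

/-- The kernel of `A† W(ζ) A` multiplied by the phase that the translation of the amplitude by
`w / c` contributes. -/
def shiftedKernel (c : ℝ) (w α β : ℂ) : ℂ :=
  Complex.exp (-(starRingEnd ℂ w * (β - w / c))) * bargmannKernel A ζ α β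

theorem norm_shiftedKernel_le {c e : ℝ} (hc : 0 < c) (he : 0 < e) (w α β : ℂ) :
    ‖shiftedKernel A ζ c w α β‖ ≤
      (‖A‖ ^ 2 * Real.exp (‖w‖ * (‖w‖ / c) + ‖w‖ ^ 2 / (4 * e))) *
        Real.exp ((1 / 2 + e) * (‖α‖ ^ 2 + ‖β‖ ^ 2)) := by
  have hre : (-(starRingEnd ℂ w * (β - w / c))).re ≤ ‖w‖ * (‖β‖ + ‖w‖ / c) := by
    refine (Complex.re_le_norm _).trans ?_
    rw [norm_neg, norm_mul, Complex.norm_conj]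
    refine mul_le_mul_of_nonneg_left ((norm_sub_le _ _).trans ?_) (norm_nonneg _)
    rw [norm_div, Complex.norm_real, Real.norm_of_nonneg hc.le]
  rw [shiftedKernel, norm_mul, Complex.norm_exp]
  calc _ ≤ Real.exp (‖w‖ * (‖β‖ + ‖w‖ / c)) *
        (‖A‖ ^ 2 * Real.exp ((‖α‖ ^ 2 + ‖β‖ ^ 2) / 2)) := by
        gcongr
        exact norm_bargmannKernel_le A ζ α β
    _ = ‖A‖ ^ 2 * Real.exp (‖w‖ * (‖β‖ + ‖w‖ / c) + (‖α‖ ^ 2 + ‖β‖ ^ 2) / 2) := by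
        rw [Real.exp_add]; ring
    _ ≤ ‖A‖ ^ 2 * Real.exp ((‖w‖ * (‖w‖ / c) + ‖w‖ ^ 2 / (4 * e)) +
          (1 / 2 + e) * (‖α‖ ^ 2 + ‖β‖ ^ 2)) := by
        refine mul_le_mul_of_nonneg_left (Real.exp_le_exp.2 ?_) (by positivity)
        have := mul_le_mul_sq_add_div he ‖w‖ ‖β‖
        have : 0 ≤ e * ‖α‖ ^ 2 := by positivity
        linarith
    _ = _ := by rw [Real.exp_add]; ring

theorem continuous_shiftedKernel (c : ℝ) (w : ℂ) :
    Continuous fun p : ℂ × ℂ => shiftedKernel A ζ c w p.1 p.2 :=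
  Continuous.mul (by fun_prop) (continuous_bargmannKernel A ζ)

theorem integrable_gauss_mul_shiftedKernel {c : ℝ} (hc : 1 < c) (w : ℂ) :
    Integrable fun α : ℂ =>
      (Real.exp (-c * ‖α‖ ^ 2) : ℂ) * shiftedKernel A ζ c w α (α + w / c) :=
  integrable_gauss_shift (s := 1 / 2 + (c - 1) / 4) (by linarith) (by linarith)
    (continuous_shiftedKernel A ζ c w)
    (norm_shiftedKernel_le A ζ (by linarith) (by linarith) w) _

theorem integral_gauss_mul_shiftedKernel {c : ℝ} (hc : 1 < c) (w : ℂ) :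
    ∫ α : ℂ, (Real.exp (-c * ‖α‖ ^ 2) : ℂ) * shiftedKernel A ζ c w α (α + w / c) =
      Complex.exp (starRingEnd ℂ w * w / c) * ∫ α : ℂ, (Real.exp (-c * ‖α‖ ^ 2) : ℂ) *
        (Complex.exp (w * starRingEnd ℂ α - starRingEnd ℂ w * α) * bargmannKernel A ζ α α) := by
  have hc' : (c : ℂ) ≠ 0 := by exact_mod_cast (by linarith : c ≠ 0)
  have hleft (β : ℂ) : Differentiable ℂ fun α => starRingEnd ℂ (shiftedKernel A ζ c w α β) := by
    simp only [shiftedKernel, map_mul]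
    exact (differentiable_conj_bargmannKernel A ζ β).const_mul _
  have hright (α : ℂ) : Differentiable ℂ (shiftedKernel A ζ c w α) :=
    Differentiable.mul (by fun_prop) (differentiable_bargmannKernel A ζ α)
  rw [integral_gauss_shift (s := 1 / 2 + (c - 1) / 4) (by linarith) (by linarith) hleft hright
    (continuous_shiftedKernel A ζ c w) (norm_shiftedKernel_le A ζ (by linarith) (by linarith) w),
    ← integral_const_mul]
  refine integral_congr_ae (.of_forall fun α => ?_)
  have hexp : Complex.exp (c * starRingEnd ℂ α * (w / c)) *
      Complex.exp (-(starRingEnd ℂ w * (α - w / c))) = Complex.exp (starRingEnd ℂ w * w / c) *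
        Complex.exp (w * starRingEnd ℂ α - starRingEnd ℂ w * α) := by
    rw [← Complex.exp_add, ← Complex.exp_add]
    congr 1
    field_simp
    ring
  simp only [shiftedKernel]
  linear_combination (Real.exp (-c * ‖α‖ ^ 2) : ℂ) * bargmannKernel A ζ α α * hexp

/-- The exponent of the weight in `shiftedCoh`. Up to a phase it is `-c ‖α + a / c‖² / 2`, so that
the `shiftedCoh A l p` are phase space translates of a single vector of `L²(ℂ; L²(ℝ))`. -/
def shiftExponent (c : ℝ) (a α : ℂ) : ℂ :=
  -(c * (starRingEnd ℂ α * α) / 2) - starRingEnd ℂ a * a / (2 * c) - starRingEnd ℂ a * α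

theorem conj_shiftExponent_add {c : ℝ} (hc : c ≠ 0) (a b α : ℂ) :
    starRingEnd ℂ (shiftExponent c a α) + shiftExponent c b α =
      (-(starRingEnd ℂ a * a + starRingEnd ℂ b * b) / 2 + starRingEnd ℂ b * a) / c +
        ((-c * ‖α + a / c‖ ^ 2 : ℝ) : ℂ) + -(starRingEnd ℂ (b - a) * (α + a / c)) := by
  have hc' : (c : ℂ) ≠ 0 := by exact_mod_cast hc
  push_cast
  rw [← Complex.conj_mul']
  simp only [shiftExponent, map_sub, map_add, map_neg, map_div₀, map_mul, Complex.conj_conj,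
    Complex.conj_ofReal, Complex.conj_ofNat]
  field_simp
  ring

theorem amplitude_exponent (ξ η : ℝ × ℝ) :
    -(starRingEnd ℂ (amplitude ξ) * amplitude ξ + starRingEnd ℂ (amplitude η) * amplitude η) / 2 +
        starRingEnd ℂ (amplitude η) * amplitude ξ =
      -(Complex.I / 2 * (sympl ξ η : ℝ)) - (((η - ξ).1 ^ 2 + (η - ξ).2 ^ 2 : ℝ) : ℂ) / 4 := by
  simp only [conj_amplitude_mul_amplitude, sympl, Prod.fst_sub, Prod.snd_sub]
  push_cast
  linear_combination ((ξ.2 ^ 2 + η.2 ^ 2 : ℂ) / 4 - ξ.2 * η.2 / 2) * Complex.I_sq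

/-- The vectors of `L²(ℂ; L²(ℝ))`, indexed by pairs of phase space points, whose Gram matrix
realises `modeCharFun` as a twisted positive definite function. -/
def shiftedCoh (l : ℝ) (p : (ℝ × ℝ) × (ℝ × ℝ)) (α : ℂ) : Mode :=
  ((√(l / Real.pi) : ℂ) * Complex.exp (shiftExponent (1 + l) (amplitude p.1) α)) •
    weylMode p.2 (A (cohVec (α + amplitude p.1 / (1 + l : ℝ))))

theorem inner_shiftedCoh {l : ℝ} (hl : 0 < l) (p q : (ℝ × ℝ) × (ℝ × ℝ)) (α : ℂ) :
    inner ℂ (shiftedCoh A l p α) (shiftedCoh A l q α) = ((l / Real.pi : ℝ) *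
      Complex.exp (Complex.I / 2 * (sympl p.2 q.2 - sympl p.1 q.1 / (1 + l) : ℝ) -
        ((((q - p).1.1 ^ 2 + (q - p).1.2 ^ 2) / (4 * (1 + l)) : ℝ) : ℂ))) *
      (fun β : ℂ => (Real.exp (-(1 + l) * ‖β‖ ^ 2) : ℂ) *
        shiftedKernel A (q - p).2 (1 + l) (amplitude (q - p).1) β
          (β + amplitude (q - p).1 / (1 + l : ℝ))) (α + amplitude p.1 / (1 + l : ℝ)) := by
  have := Real.pi_pos
  have hc : 1 + l ≠ 0 := by positivity
  have hshift : α + amplitude p.1 / (1 + l : ℝ) + amplitude (q.1 - p.1) / (1 + l : ℝ) =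
      α + amplitude q.1 / (1 + l : ℝ) := by
    rw [amplitude_sub]; ring
  have hsqrt := ofReal_sqrt_mul_self (x := l / Real.pi) (by positivity)
  have hexp : Complex.exp (starRingEnd ℂ (shiftExponent (1 + l) (amplitude p.1) α)) *
      Complex.exp (shiftExponent (1 + l) (amplitude q.1) α) *
        Complex.exp (Complex.I / 2 * (sympl p.2 q.2 : ℝ)) =
      Complex.exp (Complex.I / 2 * (sympl p.2 q.2 - sympl p.1 q.1 / (1 + l) : ℝ) -
          ((((q - p).1.1 ^ 2 + (q - p).1.2 ^ 2) / (4 * (1 + l)) : ℝ) : ℂ)) *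
        (Real.exp (-(1 + l) * ‖α + amplitude p.1 / (1 + l : ℝ)‖ ^ 2) : ℂ) *
        Complex.exp (-(starRingEnd ℂ (amplitude (q.1 - p.1)) *
          (α + amplitude p.1 / (1 + l : ℝ)))) := by
    rw [Complex.ofReal_exp, ← Complex.exp_add, ← Complex.exp_add, ← Complex.exp_add,
      ← Complex.exp_add, conj_shiftExponent_add hc, amplitude_exponent, ← amplitude_sub]
    simp only [Prod.fst_sub, Prod.snd_sub]
    push_cast
    rw [div_mul_eq_div_div _ (4 : ℂ)]
    congr 1
    ring
  simp only [shiftedCoh, inner_smul_left, inner_smul_right, inner_weylMode_weylMode, shiftedKernel,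
    bargmannKernel, Prod.fst_sub, Prod.snd_sub, hshift, map_mul, Complex.conj_ofReal,
    ← Complex.exp_conj] at hexp ⊢
  rw [← hsqrt, ← eq_sub_of_add_eq hshift]
  linear_combination (√(l / Real.pi) : ℂ) * √(l / Real.pi) *
    inner ℂ (A (cohVec (α + amplitude p.1 / (1 + l : ℝ))))
      (weylMode (q.2 - p.2) (A (cohVec (α + amplitude q.1 / (1 + l : ℝ))))) * hexp

open scoped ComplexOrder in
theorem isTwistedPosDef_modeCharFun {l : ℝ} (hl : 0 < l) :
    IsTwistedPosDef (modeTwist l) (modeCharFun l A) := by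
  have hc : 1 < 1 + l := by linarith
  have hint (p q : (ℝ × ℝ) × (ℝ × ℝ)) :
      Integrable fun α : ℂ => inner ℂ (shiftedCoh A l p α) (shiftedCoh A l q α) := by
    simp only [inner_shiftedCoh A hl]
    exact ((integrable_gauss_mul_shiftedKernel A (q - p).2 hc _).comp_add_right _).const_mul _
  refine (congrArg Matrix.PosSemidef ?_).mpr
    (posSemidef_integral (fun α => posSemidef_gram fun p => shiftedCoh A l p α) hint)
  ext p q
  have hnorm : starRingEnd ℂ (amplitude (q - p).1) * amplitude (q - p).1 =
      (((q - p).1.1 ^ 2 + (q - p).1.2 ^ 2 : ℝ) : ℂ) / 2 := by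
    rw [conj_amplitude_mul_amplitude]
    push_cast
    linear_combination (-((q - p).1.2 : ℂ) ^ 2 / 2) * Complex.I_sq
  simp only [Matrix.of_apply, Matrix.gram, inner_shiftedCoh A hl, modeTwist, modeCharFun]
  rw [integral_const_mul, integral_add_right_eq_self (fun β : ℂ =>
    (Real.exp (-(1 + l) * ‖β‖ ^ 2) : ℂ) * shiftedKernel A (q - p).2 (1 + l) (amplitude (q - p).1) β
          (β + amplitude (q - p).1 / (1 + l : ℝ))), integral_gauss_mul_shiftedKernel A _ hc,
    show q - p = ((q - p).1, (q - p).2) from rfl, modeKernel_eq]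
  have hexp : Complex.exp (Complex.I / 2 * (sympl p.2 q.2 - sympl p.1 q.1 / (1 + l) : ℝ)) *
      (Real.exp (((q - p).1.1 ^ 2 + (q - p).1.2 ^ 2) / (4 * (1 + l))) : ℂ) =
      Complex.exp (Complex.I / 2 * (sympl p.2 q.2 - sympl p.1 q.1 / (1 + l) : ℝ) -
          ((((q - p).1.1 ^ 2 + (q - p).1.2 ^ 2) / (4 * (1 + l)) : ℝ) : ℂ)) *
        Complex.exp (starRingEnd ℂ (amplitude (q - p).1) * amplitude (q - p).1 / (1 + l : ℝ)) := by
    rw [Complex.ofReal_exp, ← Complex.exp_add, ← Complex.exp_add, hnorm]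
    push_cast
    rw [div_mul_eq_div_div _ (4 : ℂ)]
    congr 1
    ring
  rw [← mul_assoc, hexp]
  ring

end BargmannKernel

section

/-! ### Overlaps with coherent states -/

/-- Phase space `ℝ²ⁿ` as the product of its position and momentum parts. -/
def phaseSpaceEquiv (n : ℕ) : ((Fin n → ℝ) × (Fin n → ℝ)) ≃ᵐ (Fin 2 × Fin n → ℝ) where
  toFun p k := if k.1 = 0 then p.1 k.2 else p.2 k.2
  invFun ξ := (fun j => ξ (0, j), fun j => ξ (1, j))
  left_inv p := by simp
  right_inv ξ := by
    funext ⟨i, j⟩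
    fin_cases i <;> simp
  measurable_toFun := by
    refine measurable_pi_lambda _ fun k => ?_
    by_cases h : k.1 = 0
    · simp only [h, Equiv.coe_fn_mk, if_true]
      fun_prop
    · simp only [h, Equiv.coe_fn_mk, if_false]
      fun_prop
  measurable_invFun := by
    simp only [Equiv.symm_mk, Equiv.coe_fn_mk]
    fun_prop

theorem phaseSpaceEquiv_zero {n : ℕ} (p : (Fin n → ℝ) × (Fin n → ℝ)) (j : Fin n) :
    phaseSpaceEquiv n p (0, j) = p.1 j := rfl

theorem phaseSpaceEquiv_one {n : ℕ} (p : (Fin n → ℝ) × (Fin n → ℝ)) (j : Fin n) :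
    phaseSpaceEquiv n p (1, j) = p.2 j := rfl

theorem measurePreserving_phaseSpaceEquiv (n : ℕ) :
    MeasurePreserving (phaseSpaceEquiv n) (volume.prod volume) volume := by
  refine ⟨(phaseSpaceEquiv n).measurable, (Measure.pi_eq fun s _ => ?_).symm⟩
  rw [(phaseSpaceEquiv n).map_apply]
  have hpre : phaseSpaceEquiv n ⁻¹' Set.univ.pi s =
      (Set.univ.pi fun j => s (0, j)) ×ˢ (Set.univ.pi fun j => s (1, j)) := by
    ext p
    simp only [Set.mem_preimage, Set.mem_pi, Set.mem_univ, true_imp_iff, Set.mem_prod]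
    constructor
    · exact fun h => ⟨fun j => h (0, j), fun j => h (1, j)⟩
    · rintro ⟨hfst, hsnd⟩ ⟨i, j⟩
      fin_cases i
      · exact hfst j
      · exact hsnd j
  rw [hpre, Measure.prod_prod, volume_pi_pi, volume_pi_pi, Fintype.prod_prod_type,
    Fin.prod_univ_two]

/-- The wave function of a one-mode coherent state. -/
def cohFun (γ : ℂ) (q : ℝ) : ℂ :=
  ((Real.exp (-‖γ‖ ^ 2 / 2) : ℝ) : ℂ) * (hermiteGen (√2 * q : ℂ) γ * vacuumFun q)

theorem coeFn_coherentMode (γ : ℂ) : (coherentMode γ : ℝ → ℂ) =ᵐ[volume] cohFun γ := by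
  rw [coherentMode_eq]
  filter_upwards [Lp.coeFn_smul ((Real.exp (-‖γ‖ ^ 2 / 2) : ℝ) : ℂ) (cohVec γ), coeFn_cohVec γ]
    with q hsmul hcoh
  rw [hsmul, Pi.smul_apply, hcoh, smul_eq_mul, cohFun]

theorem coeFn_coherent {n : ℕ} (γ : Fin n → ℂ) :
    (coherent γ : (Fin n → ℝ) → ℂ) =ᵐ[volume] fun q => ∏ j, cohFun (γ j) (q j) := by
  have hmode : ∀ᵐ q : Fin n → ℝ, ∀ j, (coherentMode (γ j) : ℝ → ℂ) (q j) = cohFun (γ j) (q j) :=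
    ae_all_iff.2 fun j =>
      (Measure.quasiMeasurePreserving_eval (fun _ : Fin n => (volume : Measure ℝ)) j).ae
        (coeFn_coherentMode (γ j))
  filter_upwards [coeFn_tensor fun j => coherentMode (γ j), hmode] with q htensor hq
  rw [coherent, htensor]
  simp only [hq]

theorem pi_div_quarter_cpow_half :
    (Real.pi / (1 / 4 : ℂ)) ^ (1 / 2 : ℂ) =
      2 * Real.pi * (((Real.pi ^ (-(1 / 4) : ℝ) : ℝ) : ℂ) *
        ((Real.pi ^ (-(1 / 4) : ℝ) : ℝ) : ℂ)) := by
  have hreal : (Real.pi / (1 / 4 : ℝ)) ^ (1 / 2 : ℝ) =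
      2 * Real.pi * (Real.pi ^ (-(1 / 4) : ℝ) * Real.pi ^ (-(1 / 4) : ℝ)) := by
    rw [← Real.rpow_add Real.pi_pos, mul_assoc, ← Real.rpow_one_add' Real.pi_pos.le (by norm_num),
      show Real.pi / (1 / 4) = 2 ^ 2 * Real.pi by ring,
      Real.mul_rpow (by norm_num) Real.pi_pos.le, ← Real.sqrt_eq_rpow, Real.sqrt_sq (by norm_num)]
    norm_num
  have hcomplex := congrArg Complex.ofReal hreal
  rw [Complex.ofReal_cpow (by positivity)] at hcomplex
  push_cast at hcomplex ⊢
  exact hcomplex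

theorem cohFun_mul_conj_exponent (γ : ℂ) (q b : ℝ) :
    (Complex.I * (q - √2 * γ.re + b / 2)) ^ 2 / (4 * (1 / 4)) +
        (-(b ^ 2 / 4) - Complex.I * (√2 * γ.im * b)) =
      -(‖γ‖ : ℂ) ^ 2 / 2 + (√2 * q * γ - γ ^ 2 / 2) + -(q : ℂ) ^ 2 / 2 + -(‖γ‖ : ℂ) ^ 2 / 2 +
        (√2 * ((q + b : ℝ) : ℂ) * starRingEnd ℂ γ - starRingEnd ℂ γ ^ 2 / 2) +
        -((q + b : ℝ) : ℂ) ^ 2 / 2 := by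
  have hconj : starRingEnd ℂ γ = γ.re - γ.im * Complex.I := by
    apply Complex.ext <;> simp
  have hγ : γ = γ.re + γ.im * Complex.I := (Complex.re_add_im γ).symm
  have hnorm : (‖γ‖ : ℂ) ^ 2 = γ.re ^ 2 + γ.im ^ 2 := by
    rw [← Complex.conj_mul', hconj]
    conv_lhs => enter [2]; rw [hγ]
    linear_combination (-(γ.im : ℂ) ^ 2) * Complex.I_sq
  push_cast
  rw [hnorm, hconj]
  generalize (γ.re : ℂ) = x at *
  generalize (γ.im : ℂ) = y at *
  rw [hγ]
  linear_combination ((q - √2 * x + b / 2) ^ 2 + y ^ 2) * Complex.I_sq -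
    x ^ 2 * ofReal_sqrt_two_mul_self

theorem cohFun_mul_conj (γ : ℂ) (q b : ℝ) :
    (Real.pi / (1 / 4 : ℂ)) ^ (1 / 2 : ℂ) *
      Complex.exp ((Complex.I * (q - √2 * γ.re + b / 2)) ^ 2 / (4 * (1 / 4))) *
      Complex.exp (-(b ^ 2 / 4) - Complex.I * (√2 * γ.im * b)) =
      2 * Real.pi * (cohFun γ q * starRingEnd ℂ (cohFun γ (q + b))) := by
  rw [mul_assoc, ← Complex.exp_add, cohFun_mul_conj_exponent, pi_div_quarter_cpow_half]
  simp only [cohFun, vacuumFun, hermiteGen, map_mul, Complex.conj_ofReal, ← Complex.exp_conj,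
    map_sub, map_div₀, map_pow, Complex.conj_ofNat, Complex.exp_add]
  push_cast
  ring

variable {n : ℕ}

/-- The Gaussian weight of the Weyl operator `W(a, b)` in the expansion of `|γ⟩⟨γ|`, times the phase
of `W(a, b)` at the position `q`. -/
def gaussPhase (γ : Fin n → ℂ) (a b q : Fin n → ℝ) : ℂ :=
  Complex.exp (-∑ j, (1 / 4 : ℂ) * (a j : ℂ) ^ 2 +
    ∑ j, (Complex.I * (q j - √2 * (γ j).re + b j / 2)) * a j) *
    ∏ j, Complex.exp (-((b j : ℂ) ^ 2 / 4) - Complex.I * (√2 * (γ j).im * b j))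

theorem norm_gaussPhase (γ : Fin n → ℂ) (a b q : Fin n → ℝ) :
    ‖gaussPhase γ a b q‖ =
      Real.exp (-∑ j, 1 / 4 * a j ^ 2) * Real.exp (-∑ j, 1 / 4 * b j ^ 2) := by
  rw [gaussPhase, ← Complex.exp_sum, norm_mul, Complex.norm_exp, Complex.norm_exp]
  congr 2
  · simp [Complex.add_re, Complex.mul_re, ← Complex.ofReal_pow]
  · simp [Complex.mul_re, ← Complex.ofReal_pow, ← Finset.sum_neg_distrib, div_eq_inv_mul]

theorem integral_gaussPhase (γ : Fin n → ℂ) (b q : Fin n → ℝ) :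
    ∫ a, gaussPhase γ a b q =
      (2 * Real.pi) ^ n * ((∏ j, cohFun (γ j) (q j)) *
        starRingEnd ℂ (∏ j, cohFun (γ j) ((q + b) j))) := by
  simp only [gaussPhase]
  rw [integral_mul_const, GaussianFourier.integral_cexp_neg_sum_mul_add fun _ => by norm_num,
    ← Finset.prod_mul_distrib, map_prod, ← Finset.prod_mul_distrib]
  simp only [Pi.add_apply, cohFun_mul_conj]
  rw [Finset.prod_mul_distrib]
  simp

/-- The integrand of the Weyl expansion of `⟨φ|γ⟩⟨γ|φ⟩`. -/
def overlapIntegrand (φ : Modes n) (γ : Fin n → ℂ) (ξ : Fin 2 × Fin n → ℝ) : ℂ :=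
  (Real.exp (-∑ k, 1 / 4 * ξ k ^ 2) : ℂ) *
    (Complex.exp (-((√2 * ∑ j, (ξ (0, j) * (γ j).re + ξ (1, j) * (γ j).im) : ℝ) : ℂ) *
      Complex.I) * inner ℂ φ (weyl ξ φ))

/-- The integrand of the expansion of `⟨φ|γ⟩⟨γ|φ⟩` with the inner products also written as
integrals over the position `q`. -/
def overlapKernel (φ : Modes n) (γ : Fin n → ℂ) (a b q : Fin n → ℝ) : ℂ :=
  gaussPhase γ a b q *
    (starRingEnd ℂ ((φ : (Fin n → ℝ) → ℂ) q) * (φ : (Fin n → ℝ) → ℂ) (q + b))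

variable (φ : Modes n) (γ : Fin n → ℂ)

theorem measurable_overlapKernel :
    Measurable fun p : ((Fin n → ℝ) × (Fin n → ℝ)) × (Fin n → ℝ) =>
      overlapKernel φ γ p.1.1 p.1.2 p.2 := by
  have hφ : Measurable φ := (Lp.stronglyMeasurable φ).measurable
  have : Measurable fun q : Fin n → ℝ => starRingEnd ℂ ((φ : (Fin n → ℝ) → ℂ) q) :=
    Complex.continuous_conj.measurable.comp hφ
  unfold overlapKernel gaussPhase
  fun_prop

theorem overlapIntegrand_phaseSpaceEquiv (a b : Fin n → ℝ) :
    overlapIntegrand φ γ (phaseSpaceEquiv n (a, b)) = ∫ q, overlapKernel φ γ a b q := by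
  have hphase (u v w x y z : ℂ) (h : u + v + w = x) : Complex.exp u * (Complex.exp v *
      (y * (Complex.exp w * z))) = Complex.exp x * (y * z) := by
    rw [← h, Complex.exp_add, Complex.exp_add]
    ring
  rw [overlapIntegrand, L2.inner_def, ← integral_const_mul, ← integral_const_mul]
  refine integral_congr_ae ?_
  filter_upwards [coeFn_weyl (phaseSpaceEquiv n (a, b)) φ] with q hq
  rw [hq, overlapKernel, gaussPhase]
  simp only [weylPhase, phaseSpaceEquiv_zero, phaseSpaceEquiv_one, RCLike.inner_apply',
    Fintype.sum_prod_type, Fin.sum_univ_two]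
  rw [← Complex.exp_sum, ← Complex.exp_add, Complex.ofReal_exp]
  refine hphase _ _ _ _ _ _ ?_
  push_cast
  simp only [Finset.mul_sum, Finset.sum_mul, ← Finset.sum_neg_distrib, neg_mul, neg_add,
    ← Finset.sum_add_distrib]
  exact Finset.sum_congr rfl fun j _ => by ring

theorem integrable_conj_mul_translate (b : Fin n → ℝ) :
    Integrable fun q =>
      starRingEnd ℂ ((φ : (Fin n → ℝ) → ℂ) q) * (φ : (Fin n → ℝ) → ℂ) (q + b) := by
  refine (L2.integrable_inner (𝕜 := ℂ) φ (weyl (phaseSpaceEquiv n (0, b)) φ)).congr ?_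
  filter_upwards [coeFn_weyl (phaseSpaceEquiv n (0, b)) φ] with q hq
  rw [hq, RCLike.inner_apply']
  simp only [weylPhase, phaseSpaceEquiv_zero, phaseSpaceEquiv_one, Pi.zero_apply, zero_mul,
    zero_div, add_zero, Finset.sum_const_zero, Complex.ofReal_zero, Complex.exp_zero, one_mul]

theorem integrable_overlapKernel (b : Fin n → ℝ) :
    Integrable (fun p : (Fin n → ℝ) × (Fin n → ℝ) => overlapKernel φ γ p.1 b p.2)
      (volume.prod volume) := by
  have hgauss : Integrable fun a : Fin n → ℝ => Real.exp (-∑ j, 1 / 4 * a j ^ 2) :=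
    integrable_gauss (c := fun _ => 1 / 4) fun _ => by norm_num
  refine ((hgauss.mul_prod (integrable_conj_mul_translate φ b).norm).const_mul
    (Real.exp (-∑ j, 1 / 4 * b j ^ 2))).mono' ?_ (.of_forall fun p => ?_)
  · have hpair : Measurable fun p : (Fin n → ℝ) × (Fin n → ℝ) => ((p.1, b), p.2) := by fun_prop
    exact ((measurable_overlapKernel φ γ).comp hpair).aestronglyMeasurable
  · rw [overlapKernel, norm_mul, norm_gaussPhase]
    exact le_of_eq (by ring)

/-- The product of `φ` and the wave function of a coherent state, whose integral is `⟨φ|γ⟩`. -/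
def conjMulCoh (q : Fin n → ℝ) : ℂ :=
  starRingEnd ℂ ((φ : (Fin n → ℝ) → ℂ) q) * ∏ j, cohFun (γ j) (q j)

theorem inner_ae_eq_conjMulCoh :
    (fun q => inner ℂ ((φ : (Fin n → ℝ) → ℂ) q) ((coherent γ : (Fin n → ℝ) → ℂ) q)) =ᵐ[volume]
      conjMulCoh φ γ := by
  filter_upwards [coeFn_coherent γ] with q hq
  rw [hq, RCLike.inner_apply', conjMulCoh]

theorem integrable_conjMulCoh : Integrable (conjMulCoh φ γ) :=
  (L2.integrable_inner (𝕜 := ℂ) φ (coherent γ)).congr (inner_ae_eq_conjMulCoh φ γ)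

theorem integral_conjMulCoh : ∫ q, conjMulCoh φ γ q = inner ℂ φ (coherent γ) := by
  rw [L2.inner_def, integral_congr_ae (inner_ae_eq_conjMulCoh φ γ)]

theorem integral_integral_overlapKernel (b : Fin n → ℝ) :
    ∫ a, ∫ q, overlapKernel φ γ a b q =
      (2 * Real.pi) ^ n * ∫ q, conjMulCoh φ γ q * starRingEnd ℂ (conjMulCoh φ γ (q + b)) := by
  rw [integral_integral_swap (integrable_overlapKernel φ γ b), ← integral_const_mul]
  refine integral_congr_ae (.of_forall fun q => ?_)
  simp only [overlapKernel, conjMulCoh]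
  rw [integral_mul_const, integral_gaussPhase, map_mul, Complex.conj_conj]
  ring

theorem integrable_overlapIntegrand :
    Integrable (fun p => overlapIntegrand φ γ (phaseSpaceEquiv n p)) (volume.prod volume) := by
  have hgauss := ((measurePreserving_phaseSpaceEquiv n).integrable_comp_of_integrable
    (integrable_gauss (c := fun _ => 1 / 4) fun _ => by norm_num)).mul_const (‖φ‖ ^ 2)
  refine hgauss.mono' ?_ (.of_forall fun p => ?_)
  · have hmeas := StronglyMeasurable.integral_prod_right (ν := volume)
      (f := fun (p : (Fin n → ℝ) × (Fin n → ℝ)) q => overlapKernel φ γ p.1 p.2 q)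
      (measurable_overlapKernel φ γ).stronglyMeasurable
    simp only [← overlapIntegrand_phaseSpaceEquiv] at hmeas
    exact hmeas.aestronglyMeasurable
  · rw [overlapIntegrand, norm_mul, Complex.norm_real, Real.norm_eq_abs, Real.abs_exp,
      ← Complex.ofReal_neg, norm_exp_mul_I_mul]
    refine mul_le_mul_of_nonneg_left ((norm_inner_le_norm _ _).trans ?_) (Real.exp_pos _).le
    rw [LinearIsometry.norm_map, sq]

theorem integral_integral_mul_conj_translate {G : Type*} [MeasurableSpace G] [AddGroup G]
    [MeasurableAdd₂ G] [MeasurableNeg G] {μ : Measure G} [SFinite μ] [μ.IsAddLeftInvariant]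
    {g : G → ℂ} (hg : Integrable g μ) :
    ∫ b, ∫ q, g q * starRingEnd ℂ (g (q + b)) ∂μ ∂μ = ((‖∫ q, g q ∂μ‖ ^ 2 : ℝ) : ℂ) := by
  have hshear := measurePreserving_prod_add μ μ
  have hemb : MeasurableEmbedding fun z : G × G => (z.1, z.1 + z.2) :=
    (MeasurableEquiv.shearAddRight G).measurableEmbedding
  have hint : Integrable (fun p : G × G => g p.1 * starRingEnd ℂ (g p.2)) (μ.prod μ) :=
    hg.mul_prod (Complex.conjCLE.toContinuousLinearMap.integrable_comp hg)
  have hint' : Integrable (fun p : G × G => g p.1 * starRingEnd ℂ (g (p.1 + p.2))) (μ.prod μ) :=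
    (hshear.integrable_comp_emb hemb).2 hint
  rw [← integral_integral_swap (f := fun q b => g q * starRingEnd ℂ (g (q + b))) hint',
    integral_integral hint',
    hshear.integral_comp hemb (fun p => g p.1 * starRingEnd ℂ (g p.2)),
    integral_prod_mul g (fun q => starRingEnd ℂ (g q)), integral_conj, Complex.mul_conj']
  push_cast
  rfl

theorem norm_inner_coherent_sq :
    ((‖inner ℂ φ (coherent γ)‖ ^ 2 : ℝ) : ℂ) =
      ((2 * Real.pi) ^ n : ℂ)⁻¹ * ∫ ξ, overlapIntegrand φ γ ξ := by
  have hpi : ((2 * Real.pi : ℂ) ^ n) ≠ 0 := by simp [Real.pi_ne_zero]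
  rw [← (measurePreserving_phaseSpaceEquiv n).integral_comp' (overlapIntegrand φ γ),
    integral_prod_symm _ (integrable_overlapIntegrand φ γ)]
  simp only [overlapIntegrand_phaseSpaceEquiv, integral_integral_overlapKernel]
  rw [integral_const_mul, inv_mul_cancel_left₀ hpi,
    integral_integral_mul_conj_translate (integrable_conjMulCoh φ γ), integral_conjMulCoh]

end

/-! ### One branch of a protocol -/

section Branch

variable {n : ℕ}

theorem norm_coherent (α : Fin n → ℂ) : ‖coherent α‖ = 1 := by
  simp [coherent, norm_tensor, norm_coherentMode]

theorem continuous_coherent : Continuous (coherent : (Fin n → ℂ) → Modes n) := by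
  refine continuous_of_norm_eq_of_inner (𝕜 := ℂ) norm_coherent fun α₀ => ?_
  refine Continuous.continuousAt ?_
  simp only [coherent, inner_tensor]
  refine continuous_finsetProd _ fun j _ => continuous_const.inner ?_
  exact continuous_coherentMode.comp (continuous_apply j)

/-- The component of party `j` of the phase space point `ξ` and of its image `S⁻ᵀ ξ`: the
arguments at which the branch probes the input and the output of party `j`. -/
def phasePoint (S : Matrix (Fin 2 × Fin n) (Fin 2 × Fin n) ℝ) (j : Fin n) :
    (Fin 2 × Fin n → ℝ) →+ (ℝ × ℝ) × (ℝ × ℝ) where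
  toFun ξ := ((ξ (0, j), ξ (1, j)), (((S⁻¹)ᵀ *ᵥ ξ) (0, j), ((S⁻¹)ᵀ *ᵥ ξ) (1, j)))
  map_zero' := by simp
  map_add' ξ η := by simp [Matrix.mulVec_add]

theorem phasePoint_apply (S : Matrix (Fin 2 × Fin n) (Fin 2 × Fin n) ℝ) (j : Fin n)
    (ξ : Fin 2 × Fin n → ℝ) : phasePoint S j ξ =
      ((ξ (0, j), ξ (1, j)), (((S⁻¹)ᵀ *ᵥ ξ) (0, j), ((S⁻¹)ᵀ *ᵥ ξ) (1, j))) :=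
  rfl

theorem continuous_phasePoint (S : Matrix (Fin 2 × Fin n) (Fin 2 × Fin n) ℝ) (j : Fin n) :
    Continuous (phasePoint S j) := by
  have : Continuous fun ξ : Fin 2 × Fin n → ℝ => (S⁻¹)ᵀ *ᵥ ξ := by fun_prop
  change Continuous fun ξ : Fin 2 × Fin n → ℝ =>
    ((ξ (0, j), ξ (1, j)), (((S⁻¹)ᵀ *ᵥ ξ) (0, j), ((S⁻¹)ᵀ *ᵥ ξ) (1, j)))
  fun_prop

variable {S : Matrix (Fin 2 × Fin n) (Fin 2 × Fin n) ℝ} {U : Modes n ≃ₗᵢ[ℂ] Modes n}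
  {A : Fin n → (Mode →L[ℂ] Mode)} {K : Modes n →L[ℂ] Modes n} {l : ℝ}

theorem inner_weyl_symm_tensor (hS : IsSymplectic S) (hU : IsGaussianUnitary S U)
    (hK : IsTensorOp A K) (f : Fin n → Mode) (ξ : Fin 2 × Fin n → ℝ) :
    inner ℂ (U.symm (K (tensor f))) (weyl ξ (U.symm (K (tensor f)))) =
      ∏ j, inner ℂ (A j (f j)) (weylMode (phasePoint S j ξ).2 (A j (f j))) := by
  have hξ : Sᵀ *ᵥ ((S⁻¹)ᵀ *ᵥ ξ) = ξ := by
    rw [Matrix.mulVec_mulVec, ← Matrix.transpose_mul, Matrix.nonsing_inv_mul _ hS.isUnit_det,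
      Matrix.transpose_one, Matrix.one_mulVec]
  have hconj := hU.conj_weyl ((S⁻¹)ᵀ *ᵥ ξ) (K (tensor f))
  rw [hξ] at hconj
  rw [← U.inner_map_map, U.apply_symm_apply, hconj, hK, weyl_tensor, inner_tensor]
  rfl

theorem prod_modeDensity_mul_norm_inner_sq (hS : IsSymplectic S) (hU : IsGaussianUnitary S U)
    (hK : IsTensorOp A K) (l : ℝ) (α : Fin n → ℂ) :
    (((∏ j, modeDensity l (α j)) * ‖inner ℂ (K (coherent α)) (U (coherent α))‖ ^ 2 : ℝ) : ℂ) =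
      ((2 * Real.pi) ^ n : ℂ)⁻¹ * ∫ ξ : Fin 2 × Fin n → ℝ,
        (Real.exp (-∑ k, 1 / 4 * ξ k ^ 2) : ℂ) *
          ∏ j, modeIntegrand l (A j) (phasePoint S j ξ, α j) := by
  have hpull : inner ℂ (K (coherent α)) (U (coherent α)) =
      inner ℂ (U.symm (K (coherent α))) (coherent α) := by
    conv_rhs => rw [← U.inner_map_map, U.apply_symm_apply]
  rw [Complex.ofReal_mul, hpull, norm_inner_coherent_sq, mul_left_comm, ← integral_const_mul]
  congr 1
  refine integral_congr_ae (.of_forall fun ξ => ?_)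
  have hphase : Complex.exp (-((√2 * ∑ j, (ξ (0, j) * (α j).re + ξ (1, j) * (α j).im) : ℝ) : ℂ) *
        Complex.I) = ∏ j, Complex.exp (-((√2 * ((phasePoint S j ξ).1.1 * (α j).re +
        (phasePoint S j ξ).1.2 * (α j).im) : ℝ) : ℂ) * Complex.I) := by
    rw [← Complex.exp_sum, ← Finset.sum_mul, Finset.sum_neg_distrib, ← Complex.ofReal_sum,
      ← Finset.mul_sum]
    rfl
  simp only [overlapIntegrand, modeIntegrand, Finset.prod_mul_distrib]
  rw [hphase, coherent, inner_weyl_symm_tensor hS hU hK, Complex.ofReal_prod]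
  ring

theorem integrable_gauss_mul_prod_modeIntegrand (S : Matrix (Fin 2 × Fin n) (Fin 2 × Fin n) ℝ)
    (A : Fin n → (Mode →L[ℂ] Mode)) (hl : 0 < l) :
    Integrable (fun p : (Fin n → ℂ) × (Fin 2 × Fin n → ℝ) =>
      (Real.exp (-∑ k, 1 / 4 * p.2 k ^ 2) : ℂ) *
        ∏ j, modeIntegrand l (A j) (phasePoint S j p.2, p.1 j)) (volume.prod volume) := by
  have hdens : Integrable fun α : Fin n → ℂ => ∏ j, modeDensity l (α j) * ‖A j‖ ^ 2 :=
    .fintype_prod (f := fun j α => modeDensity l α * ‖A j‖ ^ 2)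
      fun j => (integrable_modeDensity hl).mul_const _
  have hgauss : Integrable fun ξ : Fin 2 × Fin n → ℝ => Real.exp (-∑ k, 1 / 4 * ξ k ^ 2) :=
    integrable_gauss fun _ => by norm_num
  refine (hdens.mul_prod hgauss).mono' (Continuous.aestronglyMeasurable ?_)
    (.of_forall fun p => ?_)
  · refine Continuous.mul (by fun_prop) (continuous_finsetProd _ fun j _ => ?_)
    have := continuous_phasePoint S j
    exact (continuous_modeIntegrand l (A j)).comp (by fun_prop)
  · rw [norm_mul, norm_prod, Complex.norm_real, Real.norm_eq_abs, Real.abs_exp, mul_comm]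
    refine mul_le_mul_of_nonneg_right ?_ (Real.exp_pos _).le
    exact Finset.prod_le_prod (fun _ _ => norm_nonneg _) fun j _ => norm_modeIntegrand_le hl _ _

theorem integral_norm_inner_sq (hS : IsSymplectic S) (hU : IsGaussianUnitary S U)
    (hK : IsTensorOp A K) (hl : 0 < l) :
    ((∫ α : Fin n → ℂ, (∏ j, modeDensity l (α j)) *
      ‖inner ℂ (K (coherent α)) (U (coherent α))‖ ^ 2 : ℝ) : ℂ) =
      ((2 * Real.pi) ^ n : ℂ)⁻¹ *
        gaussAvg (fun _ => 1 / 4) fun ξ => ∏ j, modeKernel l (A j) (phasePoint S j ξ) := by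
  rw [← integral_complex_ofReal]
  simp only [prod_modeDensity_mul_norm_inner_sq hS hU hK]
  rw [integral_const_mul, integral_integral_swap (integrable_gauss_mul_prod_modeIntegrand S A hl),
    gaussAvg]
  congr 1
  refine integral_congr_ae (.of_forall fun ξ => ?_)
  simp only [modeKernel, integral_const_mul]
  rw [integral_fintype_prod_volume_eq_prod
    (f := fun j α => modeIntegrand l (A j) (phasePoint S j ξ, α))]

/-- The product of the characteristic functions of the parties, as a function on the phase space
of all modes. -/
def branchCharFun (l : ℝ) (S : Matrix (Fin 2 × Fin n) (Fin 2 × Fin n) ℝ)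
    (A : Fin n → (Mode →L[ℂ] Mode)) (ξ : Fin 2 × Fin n → ℝ) : ℂ :=
  ∏ j, modeCharFun l (A j) (phasePoint S j ξ)

theorem continuous_branchCharFun (S : Matrix (Fin 2 × Fin n) (Fin 2 × Fin n) ℝ)
    (A : Fin n → (Mode →L[ℂ] Mode)) (hl : 0 < l) : Continuous (branchCharFun l S A) :=
  continuous_finsetProd _ fun j _ =>
    (continuous_modeCharFun hl (A j)).comp (continuous_phasePoint S j)

theorem gaussAvg_prod_modeKernel (S : Matrix (Fin 2 × Fin n) (Fin 2 × Fin n) ℝ)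
    (A : Fin n → (Mode →L[ℂ] Mode)) (hl : 0 < l) :
    gaussAvg (fun _ => 1 / 4) (fun ξ => ∏ j, modeKernel l (A j) (phasePoint S j ξ)) =
      gaussAvg (fun _ => (2 + l) / (4 * (1 + l))) (branchCharFun l S A) := by
  refine integral_congr_ae (.of_forall fun ξ => ?_)
  simp only [branchCharFun, modeCharFun, Finset.prod_mul_distrib]
  rw [← mul_assoc, ← Complex.ofReal_prod, ← Real.exp_sum, ← Complex.ofReal_mul, ← Real.exp_add]
  congr 3
  simp only [Fintype.sum_prod_type, Fin.sum_univ_two, ← Finset.sum_add_distrib,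
    ← Finset.sum_neg_distrib, phasePoint_apply]
  refine Finset.sum_congr rfl fun j _ => ?_
  field_simp
  ring

theorem branchCharFun_zero (l : ℝ) (S : Matrix (Fin 2 × Fin n) (Fin 2 × Fin n) ℝ)
    (hK : IsTensorOp A K) : branchCharFun l S A 0 =
      (∫ α : Fin n → ℂ, (∏ j, modeDensity l (α j)) * ‖K (coherent α)‖ ^ 2 : ℝ) := by
  simp only [branchCharFun, map_zero, modeCharFun_zero]
  rw [← Complex.ofReal_prod, ← integral_fintype_prod_volume_eq_prod
    (f := fun j α => modeDensity l α * ‖A j (coherentMode α)‖ ^ 2)]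
  simp only [coherent, hK fun _ => coherentMode _, norm_tensor, Finset.prod_mul_distrib,
    Finset.prod_pow]

theorem matForm_omegaJ (J : Finset (Fin n)) (x y : Fin 2 × Fin n → ℝ) :
    matForm (omegaJ J) x y = ∑ j, (if j ∈ J then sympl (x (0, j), x (1, j)) (y (0, j), y (1, j))
      else -sympl (x (0, j), x (1, j)) (y (0, j), y (1, j))) := by
  simp only [matForm, dotProduct, Matrix.mulVec, Fintype.sum_prod_type, Fin.sum_univ_two, omegaJ,
    Matrix.blockDiagonal_apply]
  rw [← Finset.sum_add_distrib]
  refine Finset.sum_congr rfl fun j _ => ?_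
  simp only [ite_mul, zero_mul, Finset.sum_ite_eq, Finset.mem_univ, if_true]
  by_cases h : j ∈ J
  all_goals
    simp [h, sympl]
    ring

theorem matForm_twistMatrix (l : ℝ) (J : Finset (Fin n)) (x y : Fin 2 × Fin n → ℝ) :
    matForm (twistMatrix l S J) x y = ∑ j, (if j ∈ J
      then modeTwist l (phasePoint S j x) (phasePoint S j y)
      else -modeTwist l (phasePoint S j x) (phasePoint S j y)) := by
  have hform : matForm (twistMatrix l S J) x y =
      matForm (omegaJ J) ((S⁻¹)ᵀ *ᵥ x) ((S⁻¹)ᵀ *ᵥ y) - (1 + l)⁻¹ * matForm (omegaJ J) x y := by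
    simp only [matForm, twistMatrix, congOmega, Matrix.sub_mulVec, dotProduct_sub,
      Matrix.smul_mulVec, dotProduct_smul, smul_eq_mul]
    rw [Matrix.mul_assoc, ← Matrix.mulVec_mulVec, ← Matrix.mulVec_mulVec, Matrix.dotProduct_mulVec,
      Matrix.mulVec_transpose, Matrix.mulVec_transpose]
  rw [hform, matForm_omegaJ, matForm_omegaJ, Finset.mul_sum, ← Finset.sum_sub_distrib]
  refine Finset.sum_congr rfl fun j _ => ?_
  simp only [modeTwist, phasePoint_apply]
  split_ifs <;> ring

/-- Transposing the systems of the parties outside `J` flips the sign of their twists without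
affecting positivity; this is where the tensor product structure of the branch is used. -/
theorem isTwistedPosDef_branchCharFun (S : Matrix (Fin 2 × Fin n) (Fin 2 × Fin n) ℝ)
    (A : Fin n → (Mode →L[ℂ] Mode)) (hl : 0 < l) (J : Finset (Fin n)) :
    IsTwistedPosDef (matForm (twistMatrix l S J)) (branchCharFun l S A) := by
  have hmode (j : Fin n) : IsTwistedPosDef (fun x y => if j ∈ J
      then modeTwist l (phasePoint S j x) (phasePoint S j y)
      else -modeTwist l (phasePoint S j x) (phasePoint S j y))
      (fun ξ => modeCharFun l (A j) (phasePoint S j ξ)) := by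
    have hpos := isTwistedPosDef_modeCharFun (A j) hl
    split_ifs
    · exact hpos.comp (phasePoint S j)
    · refine (hpos.neg_twist (fun p q => ?_) (fun p q => ?_)).comp (phasePoint S j)
      · simp only [modeTwist, sympl]; ring
      · simp only [modeTwist, sympl, Prod.fst_neg, Prod.snd_neg]; ring
  rw [show matForm (twistMatrix l S J) = _ from funext₂ (matForm_twistMatrix l J)]
  exact .prod Finset.univ fun j _ => hmode j

theorem integral_norm_inner_sq_le (hS : IsSymplectic S) (hU : IsGaussianUnitary S U)
    (hK : IsTensorOp A K) (hl : 0 < l) (J : Finset (Fin n)) :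
    ∫ α : Fin n → ℂ, (∏ j, modeDensity l (α j)) *
      ‖inner ℂ (K (coherent α)) (U (coherent α))‖ ^ 2 ≤
      bound l S J * ∫ α : Fin n → ℂ, (∏ j, modeDensity l (α j)) * ‖K (coherent α)‖ ^ 2 := by
  have hbd := (isTwistedPosDef_branchCharFun S A hl J).norm_gaussAvg_const_le
    (continuous_branchCharFun S A hl) (twistMatrix_transpose l S J)
    (c := (2 + l) / (4 * (1 + l))) (by positivity)
  rw [branchCharFun_zero l S hK, Complex.ofReal_re] at hbd
  have hnorm : ‖((2 * Real.pi) ^ n : ℂ)⁻¹‖ = ((2 * Real.pi) ^ n)⁻¹ := by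
    simp [abs_of_pos Real.pi_pos]
  calc _ ≤ _ := (le_abs_self _).trans (Complex.norm_real _).ge
    _ = ((2 * Real.pi) ^ n)⁻¹ *
          ‖gaussAvg (fun _ => (2 + l) / (4 * (1 + l))) (branchCharFun l S A)‖ := by
        rw [integral_norm_inner_sq hS hU hK hl, gaussAvg_prod_modeKernel S A hl, norm_mul, hnorm]
    _ ≤ _ := by
        rw [← prod_sqrt_eq_bound hl J, mul_assoc, mul_comm (∏ _, _)]
        exact mul_le_mul_of_nonneg_left hbd (by positivity)

end Branch

/-! ### Decompositions into pure states -/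

section PureState

variable {H : Type} [NormedAddCommGroup H] [InnerProductSpace ℂ H]

theorem hasSum_norm_inner_sq {ι : Type} {v : ι → H} {R : H →L[ℂ] H}
    (h : HasSum (fun i => pureState (v i)) R) (φ : H) :
    HasSum (fun i => ‖inner ℂ (v i) φ‖ ^ 2) (inner ℂ φ (R φ)).re := by
  have happly := (ContinuousLinearMap.apply ℂ H φ).hasSum h
  refine (Complex.reCLM.hasSum ((innerSL ℂ φ).hasSum happly)).congr_fun fun i => ?_
  simp only [ContinuousLinearMap.apply_apply, innerSL_apply_apply,
    Complex.reCLM_apply, pureState, ContinuousLinearMap.smulRight_apply, inner_smul_right]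
  rw [← inner_conj_symm φ (v i), Complex.mul_conj', ← Complex.ofReal_pow, Complex.ofReal_re]

theorem tsum_ofReal_norm_inner_sq {ι : Type} {v : ι → H} {R : H →L[ℂ] H}
    (h : HasSum (fun i => pureState (v i)) R) (φ : H) :
    ∑' i, ENNReal.ofReal (‖inner ℂ (v i) φ‖ ^ 2) = ENNReal.ofReal (inner ℂ φ (R φ)).re := by
  have hsum := hasSum_norm_inner_sq h φ
  rw [← hsum.tsum_eq, ENNReal.ofReal_tsum_of_nonneg (fun _ => by positivity) hsum.summable]

theorem norm_pureState (v : H) : ‖pureState v‖ = ‖v‖ ^ 2 := by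
  rw [pureState, ContinuousLinearMap.norm_smulRight_apply, innerSL_apply_norm, sq]

theorem tsum_ofReal_norm_inner_hilbertBasis {ι : Type} (b : HilbertBasis ι ℂ H) (v : H) :
    ∑' m, ENNReal.ofReal (‖inner ℂ v (b m)‖ ^ 2) = ENNReal.ofReal (‖v‖ ^ 2) := by
  have hsum : HasSum (fun m => ‖inner ℂ v (b m)‖ ^ 2) (‖v‖ ^ 2) := by
    have hre := Complex.reCLM.hasSum (b.hasSum_inner_mul_inner v v)
    rw [inner_self_eq_norm_sq_to_K, Complex.reCLM_apply, ← RCLike.ofReal_pow] at hre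
    refine hre.congr_fun fun m => ?_
    rw [← inner_conj_symm (b m) v, Complex.mul_conj', ← Complex.ofReal_pow,
      Complex.reCLM_apply, Complex.ofReal_re]
  rw [← hsum.tsum_eq, ENNReal.ofReal_tsum_of_nonneg (fun _ => by positivity) hsum.summable]

variable [CompleteSpace H]

/-- Both sides are the trace of `R`. -/
theorem tsum_norm_sq_eq_of_hasSum_pureState {ι κ : Type} {v : ι → H} {w : κ → H} {R : H →L[ℂ] H}
    (hv : HasSum (fun i => pureState (v i)) R) (hw : HasSum (fun k => pureState (w k)) R) :
    ∑' i, ENNReal.ofReal (‖v i‖ ^ 2) = ∑' k, ENNReal.ofReal (‖w k‖ ^ 2) := by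
  obtain ⟨s, b, -⟩ := exists_hilbertBasis ℂ H
  simp only [← tsum_ofReal_norm_inner_hilbertBasis b]
  rw [ENNReal.tsum_comm, ENNReal.tsum_comm (α := κ)]
  simp only [tsum_ofReal_norm_inner_sq hv, tsum_ofReal_norm_inner_sq hw]

theorem Channel.hasSum_apply (L : Channel H) (ψ : H) :
    HasSum (fun i => pureState (L.kraus i ψ)) (L.apply (pureState ψ)) := by
  have hconj (i : ℕ) : (L.kraus i).comp
      ((pureState ψ).comp (ContinuousLinearMap.adjoint (L.kraus i))) = pureState (L.kraus i ψ) := by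
    ext x
    simp [pureState, ContinuousLinearMap.adjoint_inner_right]
  simp only [Channel.apply, hconj]
  refine (Summable.of_norm ?_).hasSum
  simp only [norm_pureState]
  exact (L.complete ψ).summable

theorem Channel.tsum_norm_sq_eq (L : Channel H) {ι : Type} {ψ : H} {v : ι → H}
    (hv : HasSum (fun i => pureState (v i)) (L.apply (pureState ψ))) :
    ∑' i, ENNReal.ofReal (‖v i‖ ^ 2) = ENNReal.ofReal (‖ψ‖ ^ 2) := by
  rw [tsum_norm_sq_eq_of_hasSum_pureState hv (L.hasSum_apply ψ), ← (L.complete ψ).tsum_eq,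
    ENNReal.ofReal_tsum_of_nonneg (fun _ => by positivity) (L.complete ψ).summable]

end PureState

/-! ### The fidelity of LOCC channels -/

section Fidelity

variable {n : ℕ} {l : ℝ}

theorem lintegral_gaussianEnsemble (hl : 0 < l) {g : (Fin n → ℂ) → ℝ} (hg : Continuous g)
    (hg0 : ∀ α, 0 ≤ g α) {C : ℝ} (hC : ∀ α, g α ≤ C) :
    ∫⁻ α, ENNReal.ofReal (g α) ∂(gaussianEnsemble n l) =
      ENNReal.ofReal (∫ α : Fin n → ℂ, (∏ j, modeDensity l (α j)) * g α) := by
  have hd : Continuous fun α : Fin n → ℂ => ∏ j, modeDensity l (α j) := by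
    unfold modeDensity
    fun_prop
  have hd0 (α : Fin n → ℂ) : 0 ≤ ∏ j, modeDensity l (α j) :=
    Finset.prod_nonneg fun j _ => modeDensity_nonneg hl _
  have hdi : Integrable fun α : Fin n → ℂ => ∏ j, modeDensity l (α j) :=
    .fintype_prod (f := fun _ α => modeDensity l α) fun _ => integrable_modeDensity hl
  have hi : Integrable fun α : Fin n → ℂ => (∏ j, modeDensity l (α j)) * g α := by
    refine (hdi.mul_const C).mono' (hd.mul hg).aestronglyMeasurable (.of_forall fun α => ?_)
    rw [Real.norm_of_nonneg (mul_nonneg (hd0 α) (hg0 α))]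
    exact mul_le_mul_of_nonneg_left (hC α) (hd0 α)
  rw [ofReal_integral_eq_lintegral_ofReal hi (.of_forall fun α => mul_nonneg (hd0 α) (hg0 α)),
    gaussianEnsemble]
  simp only [← prod_modeDensity]
  rw [lintegral_withDensity_eq_lintegral_mul _ hd.measurable.ennreal_ofReal
    hg.measurable.ennreal_ofReal]
  simp only [Pi.mul_apply, ENNReal.ofReal_mul (hd0 _)]

theorem gaussianEnsemble_univ (hl : 0 < l) : gaussianEnsemble n l Set.univ = 1 := by
  have h := lintegral_gaussianEnsemble (n := n) hl (g := fun _ => 1) continuous_const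
    (fun _ => zero_le_one) (fun _ => le_rfl)
  simp only [ENNReal.ofReal_one, lintegral_const, one_mul, mul_one] at h
  rw [h, integral_fintype_prod_volume_eq_prod (f := fun (_ : Fin n) α => modeDensity l α)]
  simp [integral_modeDensity hl]

theorem bound_nonneg (hl : 0 < l) (S : Matrix (Fin 2 × Fin n) (Fin 2 × Fin n) ℝ)
    (J : Finset (Fin n)) : 0 ≤ bound l S J := by
  unfold bound
  positivity

theorem continuous_map_coherent (K : Modes n →L[ℂ] Modes n) :
    Continuous fun α : Fin n → ℂ => K (coherent α) :=
  K.continuous.comp continuous_coherent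

theorem continuous_norm_map_coherent_sq (K : Modes n →L[ℂ] Modes n) :
    Continuous fun α : Fin n → ℂ => ‖K (coherent α)‖ ^ 2 :=
  (continuous_map_coherent K).norm.pow 2

theorem continuous_norm_inner_coherent_sq (U : Modes n ≃ₗᵢ[ℂ] Modes n)
    (K : Modes n →L[ℂ] Modes n) :
    Continuous fun α : Fin n → ℂ => ‖inner ℂ (K (coherent α)) (U (coherent α))‖ ^ 2 :=
  (((continuous_map_coherent K).inner (U.continuous.comp continuous_coherent)).norm).pow 2

variable {S : Matrix (Fin 2 × Fin n) (Fin 2 × Fin n) ℝ} {U : Modes n ≃ₗᵢ[ℂ] Modes n}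

theorem lintegral_norm_inner_sq_le (hS : IsSymplectic S) (hU : IsGaussianUnitary S U)
    {A : Fin n → (Mode →L[ℂ] Mode)} {K : Modes n →L[ℂ] Modes n}
    (hK : IsTensorOp A K) (hl : 0 < l) (J : Finset (Fin n)) :
    ∫⁻ α, ENNReal.ofReal (‖inner ℂ (K (coherent α)) (U (coherent α))‖ ^ 2)
      ∂(gaussianEnsemble n l) ≤ ENNReal.ofReal (bound l S J) *
      ∫⁻ α, ENNReal.ofReal (‖K (coherent α)‖ ^ 2) ∂(gaussianEnsemble n l) := by
  have hnorm (α : Fin n → ℂ) : ‖K (coherent α)‖ ≤ ‖K‖ := by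
    simpa [norm_coherent] using K.le_opNorm (coherent α)
  have hinner (α : Fin n → ℂ) : ‖inner ℂ (K (coherent α)) (U (coherent α))‖ ≤ ‖K‖ := by
    refine (norm_inner_le_norm _ _).trans ?_
    rw [LinearIsometryEquiv.norm_map, norm_coherent, mul_one]
    exact hnorm α
  rw [lintegral_gaussianEnsemble hl (continuous_norm_inner_coherent_sq U K)
      (fun _ => by positivity) fun α => pow_le_pow_left₀ (norm_nonneg _) (hinner α) 2,
    lintegral_gaussianEnsemble hl (continuous_norm_map_coherent_sq K)
      (fun _ => by positivity) fun α => pow_le_pow_left₀ (norm_nonneg _) (hnorm α) 2,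
    ← ENNReal.ofReal_mul (bound_nonneg hl S J)]
  exact ENNReal.ofReal_le_ofReal (integral_norm_inner_sq_le hS hU hK hl J)

theorem Protocol.countable_branch {H H' : Fin n → HilbertSpace} (P : Protocol H H') :
    Countable P.Branch := by
  induction P with
  | done H => exact inferInstanceAs (Countable Unit)
  | round M _ next ih =>
    have := ih
    exact inferInstanceAs (Countable (Σ x, (next x).Branch))

/-- The fidelity of the output of `L` on the coherent state `|α⟩` with `U |α⟩`. -/
def channelFidelity (U : Modes n ≃ₗᵢ[ℂ] Modes n) (L : Channel (Modes n)) (α : Fin n → ℂ) :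
    ℝ≥0∞ :=
  ENNReal.ofReal (inner ℂ (U (coherent α)) (L.apply (pureState (coherent α)) (U (coherent α)))).re

theorem channelFidelity_eq_tsum {L : Channel (Modes n)} {ι : Type}
    {K : ι → (Modes n →L[ℂ] Modes n)}
    (hK : ∀ ψ, HasSum (fun b => pureState (K b ψ)) (L.apply (pureState ψ))) :
    channelFidelity U L = fun α : Fin n → ℂ =>
      ∑' b, ENNReal.ofReal (‖inner ℂ (K b (coherent α)) (U (coherent α))‖ ^ 2) :=
  funext fun α => (tsum_ofReal_norm_inner_sq (hK (coherent α)) _).symm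

variable {L : Channel (Modes n)}
  {P : Protocol (fun _ : Fin n => modeSpace) (fun _ : Fin n => modeSpace)}

theorem IsImplementedBy.measurable_channelFidelity (hL : IsImplementedBy L P) :
    Measurable (channelFidelity U L) := by
  obtain ⟨K, -, hsum⟩ := hL
  have := P.countable_branch
  rw [channelFidelity_eq_tsum hsum]
  exact .tsum fun b => (continuous_norm_inner_coherent_sq U (K b)).measurable.ennreal_ofReal

theorem IsImplementedBy.lintegral_channelFidelity_le (hS : IsSymplectic S)
    (hU : IsGaussianUnitary S U) (hL : IsImplementedBy L P) (hl : 0 < l) (J : Finset (Fin n)) :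
    ∫⁻ α, channelFidelity U L α ∂(gaussianEnsemble n l) ≤ ENNReal.ofReal (bound l S J) := by
  obtain ⟨K, hK, hsum⟩ := hL
  have := P.countable_branch
  rw [channelFidelity_eq_tsum hsum, lintegral_tsum fun b =>
    (continuous_norm_inner_coherent_sq U (K b)).measurable.ennreal_ofReal.aemeasurable]
  calc _ ≤ ∑' b, ENNReal.ofReal (bound l S J) *
        ∫⁻ α, ENNReal.ofReal (‖K b (coherent α)‖ ^ 2) ∂(gaussianEnsemble n l) :=
        ENNReal.tsum_le_tsum fun b => lintegral_norm_inner_sq_le hS hU (hK b) hl J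
    _ = ENNReal.ofReal (bound l S J) *
        ∫⁻ α, ∑' b, ENNReal.ofReal (‖K b (coherent α)‖ ^ 2) ∂(gaussianEnsemble n l) := by
        rw [ENNReal.tsum_mul_left, lintegral_tsum fun b =>
          (continuous_norm_map_coherent_sq (K b)).measurable.ennreal_ofReal.aemeasurable]
    _ = ENNReal.ofReal (bound l S J) := by
        simp only [fun α : Fin n → ℂ => L.tsum_norm_sq_eq (hsum (coherent α)), norm_coherent,
          one_pow, ENNReal.ofReal_one, lintegral_const, gaussianEnsemble_univ hl, mul_one]

theorem IsLOCC.lintegral_channelFidelity_le (hS : IsSymplectic S) (hU : IsGaussianUnitary S U)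
    (hL : IsLOCC L) (hl : 0 < l) (J : Finset (Fin n)) :
    ∫⁻ α, channelFidelity U L α ∂(gaussianEnsemble n l) ≤ ENNReal.ofReal (bound l S J) := by
  obtain ⟨P, Lm, hLm, hlim⟩ := hL
  have htendsto (α : Fin n → ℂ) : Filter.Tendsto (fun m => channelFidelity U (Lm m) α)
      Filter.atTop (nhds (channelFidelity U L α)) :=
    (ENNReal.continuous_ofReal.tendsto _).comp ((Complex.continuous_re.tendsto _).comp
      (hlim (U (coherent α)) (coherent α)))
  calc _ = ∫⁻ α, Filter.liminf (fun m => channelFidelity U (Lm m) α) Filter.atTop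
        ∂(gaussianEnsemble n l) := lintegral_congr fun α => (htendsto α).liminf_eq.symm
    _ ≤ Filter.liminf (fun m => ∫⁻ α, channelFidelity U (Lm m) α ∂(gaussianEnsemble n l))
        Filter.atTop := lintegral_liminf_le fun m => (hLm m).measurable_channelFidelity
    _ ≤ Filter.liminf (fun _ : ℕ => ENNReal.ofReal (bound l S J)) Filter.atTop :=
        Filter.liminf_le_liminf (.of_forall fun m =>
          (hLm m).lintegral_channelFidelity_le hS hU hl J)
    _ = _ := Filter.liminf_const _

theorem simulationFidelity_le (hS : IsSymplectic S) (hU : IsGaussianUnitary S U) (hl : 0 < l) :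
    simulationFidelity (gaussianEnsemble n l) coherent U ≤
      ENNReal.ofReal (⨅ J : Finset (Fin n), bound l S J) := by
  obtain ⟨J, hJ⟩ := exists_eq_ciInf_of_finite (f := fun J : Finset (Fin n) => bound l S J)
  rw [← hJ]
  exact iSup₂_le fun L hL => hL.lintegral_channelFidelity_le hS hU hl J

end Fidelity

end GaussLOCC

end

theorem theorem2 (n : ℕ) (S : Matrix (Fin 2 × Fin n) (Fin 2 × Fin n) ℝ)
    (hS : GaussLOCC.IsSymplectic S)
    (U : GaussLOCC.Modes n ≃ₗᵢ[ℂ] GaussLOCC.Modes n) (hU : GaussLOCC.IsGaussianUnitary S U)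
    (l : ℝ) (hl : 0 < l) :
    GaussLOCC.simulationFidelity (GaussLOCC.gaussianEnsemble n l) GaussLOCC.coherent U ≤
        ENNReal.ofReal (⨅ J : Finset (Fin n), GaussLOCC.bound l S J) ∧
      (2 ≤ n →
        (⨅ J : Finset (Fin n), GaussLOCC.bound l S J) =
          (⨅ J : {J : Finset (Fin n) // 1 ≤ J.card ∧ J.card ≤ n / 2},
            GaussLOCC.bound l S J.1)) :=
  ⟨GaussLOCC.simulationFidelity_le hS hU hl, fun hn => hS.iInf_bound_eq hl hn⟩
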